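/- **CTL satisfiability is in EXPTIME, by reduction to Büchi games.** Let CTL be the set of formulas $$\varphi ::= \mathtt{tt} \mid \mathtt{ff} \mid p \mid \neg p \mid \varphi\vee\varphi \mid \varphi\wedge\varphi \mid Q\mathtt X\varphi \mid Q(\varphi\,\mathtt U\,\varphi) \mid Q(\varphi\,\mathtt R\,\varphi),\qquad Q\in\{E,A\},$$ over countably many propositions $p$, interpreted as usual in total transition systems. Let $|\vartheta|$ be the number of distinct subformulas of $\vartheta$ (state formulas and path formulas). A formula is satisfiable if it holds in the initial state of some total transition system. The *satisfiability game* of $\vartheta$ is played on the configurations, i.e. the non-empty subsets $C$ of $\{\varphi, E\mathtt X\varphi, A\mathtt X\varphi \mid \varphi$ a state subformula of $\vartheta\}$, from $\{\vartheta\}$. A configuration is inconsistent if it contains $\mathtt{ff}$ or both $p$ and $\neg p$ for some $p$; no rule applies to it. In a consistent configuration player 0 picks a formula of $C$ and replaces it: $\varphi_1\wedge\varphi_2$ by $\varphi_1,\varphi_2$; $\varphi_1\vee\varphi_2$ by $\varphi_1$ or by $\varphi_2$; $Q(\varphi_1\mathtt U\varphi_2)$ by $\varphi_2$ or by $\varphi_1,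 Q\mathtt XQ(\varphi_1\mathtt U\varphi_2)$; $Q(\varphi_1\mathtt R\varphi_2)$ by $\varphi_1,\varphi_2$ or by $\varphi_2, Q\mathtt XQ(\varphi_1\mathtt R\varphi_2)$. If $C$ consists of literals and formulas $E\mathtt X\varphi'_1,\dots,E\mathtt X\varphi'_m, A\mathtt X\varphi_1,\dots,A\mathtt X\varphi_n$ only, then the successors are the sets $\{\varphi'_i,\varphi_1,\dots,\varphi_n\}$, among which player 1 chooses, if $m\ge 1$, and the successor is $\{\varphi_1,\dots,\varphi_n\}$ if $m=0<n$. A $\mathtt U$-thread of an infinite play is a sequence of formulas, one in each configuration, that follows each formula to one of its descendants, or to its copy if it was not transformed, and in which some $Q(\varphi_1\mathtt U\varphi_2)$ occurs infinitely often. Player 0 wins an infinite play iff it has no $\mathtt U$-thread; a play that reaches a configuration to which no rule applies is won by player 0 iff that configuration is a consistent set of literals. 1. Deciding satisfiability of CTL formulas is in EXPTIME: there are a polynomial $p$ and a random access machine (with addition and subtraction, one time step per instruction) that decides in time $2^{p(\ell)}$ whether an input of bit length $\ell$ describes a satisfiable CTL formula. Here a formula is given as a list of its subformulas, in which each one is described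 by its outermost connective and the positions of its immediate subformulas earlier in the list (or its proposition, if it is a literal), the formula itself being the last entry. 2. There is a constant $c$ such that for every CTL formula $\vartheta$ there is a deterministic Büchi automaton $\mathcal B$, reading rule applications, that accepts exactly those infinite plays of the satisfiability game of $\vartheta$ that have no $\mathtt U$-thread, and such that the product of the satisfiability game with $\mathcal B$ is a Büchi game with at most $2^{c|\vartheta|}$ positions and at most $2^{c|\vartheta|}$ edges, in which player 0 has a winning strategy iff $\vartheta$ is satisfiable. (In the product, a position with a configuration to which no rule applies is repeated for ever, and it is accepting iff that configuration is a consistent set of literals; a position with a configuration to which some rule applies is accepting iff its automaton state is. Player 1 moves as described above, player 0 in all other positions.) 3. Büchi games with $n$ positions and $m$ edges (every position having a successor) can be solved in time $O(n\cdot m)$: there is a random access machine that decides, given such a game by its list of edges, in at most $K\cdot n\cdot m$ steps, for a constant $K$, whether player 0 has a winning strategy from the initial position. -/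

import Mathlib

open Filter

/-! ### CTL: syntax, size, semantics -/

/-- Path quantifiers: `E` (some path) and `A` (all paths). -/
inductive Quant
  | E
  | A
  deriving DecidableEq

/-- CTL formulas in negation normal form. Atomic propositions are natural numbers. Each temporal
operator comes with the path quantifier in front of it: `next q φ` is `q X φ`, `untl q φ ψ` is
`q (φ U ψ)` and `rel q φ ψ` is `q (φ R ψ)`. -/
inductive CTL
  | tt
  | ff
  | pos (p : ℕ)
  | neg (p : ℕ)
  | or (φ ψ : CTL)
  | and (φ ψ : CTL)
  | next (q : Quant) (φ : CTL)
  | untl (q : Quant) (φ ψ : CTL)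
  | rel (q : Quant) (φ ψ : CTL)
  deriving DecidableEq

/-- The path formulas `X φ`, `φ U ψ`, `φ R ψ` that occur under a path quantifier. -/
inductive CTLPath
  | next (φ : CTL)
  | untl (φ ψ : CTL)
  | rel (φ ψ : CTL)
  deriving DecidableEq

namespace CTL

/-- The subformulas of a CTL formula that are state formulas. -/
def sub : CTL → Finset CTL
  | tt => {tt}
  | ff => {ff}
  | pos p => {pos p}
  | neg p => {neg p}
  | or φ ψ => insert (or φ ψ) (φ.sub ∪ ψ.sub)
  | and φ ψ => insert (and φ ψ) (φ.sub ∪ ψ.sub)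
  | next q φ => insert (next q φ) φ.sub
  | untl q φ ψ => insert (untl q φ ψ) (φ.sub ∪ ψ.sub)
  | rel q φ ψ => insert (rel q φ ψ) (φ.sub ∪ ψ.sub)

/-- The subformulas of a CTL formula that are path formulas `X φ`, `φ U ψ`, `φ R ψ`. -/
def pathSub : CTL → Finset CTLPath
  | tt => ∅
  | ff => ∅
  | pos _ => ∅
  | neg _ => ∅
  | or φ ψ => φ.pathSub ∪ ψ.pathSub
  | and φ ψ => φ.pathSub ∪ ψ.pathSub
  | next _ φ => insert (.next φ) φ.pathSub
  | untl _ φ ψ => insert (.untl φ ψ) (φ.pathSub ∪ ψ.pathSub)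
  | rel _ φ ψ => insert (.rel φ ψ) (φ.pathSub ∪ ψ.pathSub)

/-- The size `|φ|`: the number of (distinct) subformulas of `φ`. -/
def size (φ : CTL) : ℕ := φ.sub.card + φ.pathSub.card

end CTL

/-- Total transition systems with an initial state. -/
structure TransitionSystem where
  State : Type
  init : State
  rel : State → State → Prop
  total : ∀ s, ∃ t, rel s t
  label : State → Set ℕ

/-- `T.PathsFrom q s P`: some path (`q = E`), respectively every path (`q = A`), that starts in the
state `s` has the property `P`. -/
def TransitionSystem.PathsFrom (T : TransitionSystem) (q : Quant) (s : T.State)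
    (P : (ℕ → T.State) → Prop) : Prop :=
  match q with
  | .E => ∃ π : ℕ → T.State, (∀ i, T.rel (π i) (π (i + 1))) ∧ π 0 = s ∧ P π
  | .A => ∀ π : ℕ → T.State, (∀ i, T.rel (π i) (π (i + 1))) → π 0 = s → P π

/-- `T.Sat φ s` is the satisfaction relation `T, s ⊨ φ`. -/
def TransitionSystem.Sat (T : TransitionSystem) : CTL → T.State → Prop
  | .tt, _ => True
  | .ff, _ => False
  | .pos p, s => p ∈ T.label s
  | .neg p, s => p ∉ T.label s
  | .or φ ψ, s => T.Sat φ s ∨ T.Sat ψ s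
  | .and φ ψ, s => T.Sat φ s ∧ T.Sat ψ s
  | .next q φ, s => T.PathsFrom q s fun π => T.Sat φ (π 1)
  | .untl q φ ψ, s => T.PathsFrom q s fun π =>
      ∃ k, T.Sat ψ (π k) ∧ ∀ j < k, T.Sat φ (π j)
  | .rel q φ ψ, s => T.PathsFrom q s fun π =>
      ∀ k, T.Sat ψ (π k) ∨ ∃ j < k, T.Sat φ (π j)

/-- A CTL formula is satisfiable if it holds in the initial state of some total transition
system. -/
def CTL.Satisfiable (φ : CTL) : Prop := ∃ T : TransitionSystem, T.Sat φ T.init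

/-! ### Random access machines, exponential time -/

/-- Instructions of a random access machine with registers `R 0, R 1, …` and a memory
`M 0, M 1, …`, both holding natural numbers. Each instruction takes one time step. -/
inductive Instr
  | const (i c : ℕ)   -- R i := c
  | add (i j k : ℕ)   -- R i := R j + R k
  | sub (i j k : ℕ)   -- R i := R j - R k (truncated at 0)
  | load (i j : ℕ)    -- R i := M (R j)
  | store (i j : ℕ)   -- M (R i) := R j
  | jumpz (i l : ℕ)   -- if R i = 0 then go to line l

structure RAMState where
  pc : ℕ
  reg : ℕ → ℕ
  mem : ℕ → ℕ

/-- The effect of one instruction. -/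
def Instr.exec (s : RAMState) : Instr → RAMState
  | const i c => ⟨s.pc + 1, Function.update s.reg i c, s.mem⟩
  | add i j k => ⟨s.pc + 1, Function.update s.reg i (s.reg j + s.reg k), s.mem⟩
  | sub i j k => ⟨s.pc + 1, Function.update s.reg i (s.reg j - s.reg k), s.mem⟩
  | load i j => ⟨s.pc + 1, Function.update s.reg i (s.mem (s.reg j)), s.mem⟩
  | store i j => ⟨s.pc + 1, s.reg, Function.update s.mem (s.reg i) (s.reg j)⟩
  | jumpz i l => ⟨if s.reg i = 0 then l else s.pc + 1, s.reg, s.mem⟩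

/-- A program is a finite list of instructions; a machine whose program counter points behind the
last instruction has halted and stays as it is. -/
def RAMState.next (P : List Instr) (s : RAMState) : RAMState :=
  match P[s.pc]? with
  | some I => I.exec s
  | none => s

/-- The start: the input `w` stands in the first cells of the memory, its length in `R 0`, and
everything else is zero. -/
def RAMState.start (w : List ℕ) : RAMState where
  pc := 0
  reg i := if i = 0 then w.length else 0
  mem i := w.getD i 0

/-- On input `w` the program `P` halts after at most `t` steps, with `1` in `R 0` if the proposition
`p` is true and with `0` in `R 0` if it is false. -/
def DecidesWithin (P : List Instr) (w : List ℕ) (t : ℕ) (p : Prop) : Prop :=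
  ∃ k ≤ t, ∃ s : RAMState, s = (RAMState.next P)^[k] (RAMState.start w) ∧
    P.length ≤ s.pc ∧ ((p ∧ s.reg 0 = 1) ∨ (¬ p ∧ s.reg 0 = 0))

/-- The length of an input, a list of numbers, when the numbers are written in binary and each is
followed by a separator. -/
def bitSize (w : List ℕ) : ℕ := (w.map fun a => a.size + 1).sum

/-- The complexity class EXPTIME: time `2 ^ p(ℓ)` on inputs of length `ℓ`, for a polynomial `p`.
(The machines add and subtract but do not multiply, so they and Turing machines simulate each other
with polynomial overhead.) -/
def InEXPTIME (L : Set (List ℕ)) : Prop :=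
  ∃ (P : List Instr) (p : Polynomial ℕ),
    ∀ w : List ℕ, DecidesWithin P w (2 ^ p.eval (bitSize w)) (w ∈ L)

/-! ### The satisfiability problem as a set of inputs -/

namespace CTL

/-- One entry of an input: an operation code and two arguments. The arguments of a connective are
positions in the list `L` of the formulas that were described before; the first argument of a
literal is its proposition. Arguments that are not needed are ignored. -/
def decodeEntry (L : List CTL) (op a b : ℕ) : Option CTL :=
  match op with
  | 0 => some tt
  | 1 => some ff
  | 2 => some (pos a)
  | 3 => some (neg a)
  | 4 => do return or (← L[a]?) (← L[b]?)
  | 5 => do return and (← L[a]?) (← L[b]?)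
  | 6 => do return next .E (← L[a]?)
  | 7 => do return next .A (← L[a]?)
  | 8 => do return untl .E (← L[a]?) (← L[b]?)
  | 9 => do return untl .A (← L[a]?) (← L[b]?)
  | 10 => do return rel .E (← L[a]?) (← L[b]?)
  | 11 => do return rel .A (← L[a]?) (← L[b]?)
  | _ => none

/-- The list of formulas described by a sequence of entries, after the formulas in `L`. -/
def decodeList (L : List CTL) : List ℕ → Option (List CTL)
  | [] => some L
  | op :: a :: b :: w =>
    match decodeEntry L op a b with
    | some φ => decodeList (L ++ [φ]) w
    | none => none
  | _ => none

/-- A formula is given to a machine as a list of its subformulas, in which every formula stands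
after its immediate subformulas and refers to them by their positions. The formula that is meant is
the last one. So an input for `φ` need not have more entries than `φ` has subformulas. -/
def decode (w : List ℕ) : Option CTL := (decodeList [] w).bind List.getLast?

/-- The satisfiability problem for CTL: the inputs that describe a satisfiable CTL formula. -/
def SAT : Set (List ℕ) := {w | ∃ φ : CTL, decode w = some φ ∧ φ.Satisfiable}

end CTL

/-! ### Büchi games and Büchi automata -/

/-- A Büchi game with positions `V`: the positions in `player0` belong to player 0, all others to
player 1. -/
structure BuchiGame (V : Type) where
  player0 : Set V
  edge : V → V → Prop
  total : ∀ v, ∃ u, edge v u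
  init : V
  accepting : Set V

/-- Player 0 has a winning strategy: a map `σ` that yields a legal move after each history that ends
in a position of player 0, such that every play that conforms to `σ` visits accepting positions
infinitely often. -/
def BuchiGame.Player0Wins {V : Type} (G : BuchiGame V) : Prop :=
  ∃ σ : List V → V,
    (∀ (h : List V) (v : V), v ∈ G.player0 → G.edge v (σ (h ++ [v]))) ∧
    ∀ π : ℕ → V, π 0 = G.init → (∀ j, G.edge (π j) (π (j + 1))) →
      (∀ j, π j ∈ G.player0 → π (j + 1) = σ ((List.range (j + 1)).map π)) →
      ∃ᶠ j in atTop, π j ∈ G.accepting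

open Classical in
/-- A Büchi game with the positions `0, …, n - 1` and the given list of edges as an input for a
machine: the number of positions, the number of edges, the initial position, for each position
whether it belongs to player 0, for each position whether it is accepting, and the edges. -/
noncomputable def BuchiGame.code {n : ℕ} (G : BuchiGame (Fin n)) (edges : List (Fin n × Fin n)) :
    List ℕ :=
  [n, edges.length, G.init.val] ++
    (List.finRange n).map (fun v => if v ∈ G.player0 then 1 else 0) ++
    (List.finRange n).map (fun v => if v ∈ G.accepting then 1 else 0) ++
    edges.flatMap (fun e => [e.1.val, e.2.val])

/-- Deterministic Büchi automata over the alphabet `α`. -/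
structure DBA (α : Type) where
  State : Type
  finite : Finite State
  init : State
  step : State → α → State
  final : Set State

/-- The run of the automaton on an infinite word. -/
def DBA.run {α : Type} (B : DBA α) (w : ℕ → α) : ℕ → B.State
  | 0 => B.init
  | n + 1 => B.step (B.run w n) (w n)

def DBA.Accepts {α : Type} (B : DBA α) (w : ℕ → α) : Prop :=
  ∃ᶠ n in atTop, B.run w n ∈ B.final

/-! ### The satisfiability game for CTL -/

namespace CTL

/-- The formulas `φ`, `EX φ`, `AX φ` for the subformulas `φ` of `ϑ`. -/
def closure (ϑ : CTL) : Finset CTL :=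
  ϑ.sub ∪ ϑ.sub.image (next .E) ∪ ϑ.sub.image (next .A)

def IsLiteral : CTL → Prop
  | tt | ff | pos _ | neg _ => True
  | _ => False

/-- Literals and formulas `EX φ`, `AX φ`: no rule but the modal ones transforms these. -/
def IsLiteralOrNext : CTL → Prop
  | next _ _ => True
  | φ => φ.IsLiteral

/-- A set of formulas is consistent if it contains neither `ff` nor a complementary pair of
literals. -/
def Consistent (C : Finset CTL) : Prop :=
  ff ∉ C ∧ ∀ p, ¬ (pos p ∈ C ∧ neg p ∈ C)

/-- The formulas that replace a principal formula in an application of a non-modal rule. The rules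
for disjunctions, `U` and `R` have a left (`false`) and a right (`true`) alternative. -/
def reduct : CTL → Bool → Option (Finset CTL)
  | and φ ψ, false => some {φ, ψ}
  | or φ _, false => some {φ}
  | or _ ψ, true => some {ψ}
  | untl _ _ ψ, false => some {ψ}
  | untl q φ ψ, true => some {φ, next q (untl q φ ψ)}
  | rel _ φ ψ, false => some {φ, ψ}
  | rel q φ ψ, true => some {ψ, next q (rel q φ ψ)}
  | _, _ => none

/-- The formulas `φ` with `AX φ ∈ C`. -/
def universalPart (C : Finset CTL) : Finset CTL :=
  C.biUnion fun χ => match χ with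
    | next .A φ => {φ}
    | _ => ∅

/-- Configurations for `ϑ`: non-empty subsets of the closure. -/
def Config (ϑ : CTL) : Type := {C : Finset CTL // C ⊆ ϑ.closure ∧ C.Nonempty}

instance (ϑ : CTL) : Finite (Config ϑ) :=
  Set.Finite.to_subtype (ϑ.closure.powerset.finite_toSet.subset fun _ hC =>
    Finset.mem_coe.2 (Finset.mem_powerset.2 hC.1))

theorem self_mem_sub (ϑ : CTL) : ϑ ∈ ϑ.sub := by
  cases ϑ <;> simp [sub]

/-- The initial configuration `{ϑ}`. -/
def initConfig (ϑ : CTL) : Config ϑ :=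
  ⟨{ϑ}, by simp [closure, self_mem_sub], Finset.singleton_nonempty ϑ⟩

/-- Symbols for rule applications: a non-modal rule with its principal formula and the chosen
alternative, the modal rule `X0`, and the modal rule `X1` with the formula `φ` of the chosen
`EX φ`. -/
inductive Rule (ϑ : CTL)
  | reduce (φ : {χ : CTL // χ ∈ ϑ.closure}) (alternative : Bool)
  | x0
  | x1 (φ : {χ : CTL // χ ∈ ϑ.closure})

/-- The rule `X1` applies to the consistent configuration `C`. -/
def X1Applies (C : Finset CTL) : Prop :=
  Consistent C ∧ (∀ χ ∈ C, χ.IsLiteralOrNext) ∧ ∃ φ, next .E φ ∈ C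

/-- `Step C r C'`: the rule application `r` leads from the configuration `C` to the
configuration `C'`. Inconsistent configurations have no rule applications. -/
inductive Step {ϑ : CTL} : Finset CTL → Rule ϑ → Finset CTL → Prop
  | reduce {C D : Finset CTL} {φ : {χ : CTL // χ ∈ ϑ.closure}} {alternative : Bool}
      (hC : Consistent C) (hφ : φ.1 ∈ C) (hD : φ.1.reduct alternative = some D) :
      Step C (.reduce φ alternative) (C.erase φ.1 ∪ D)
  | x0 {C : Finset CTL} (hC : Consistent C) (hmodal : ∀ χ ∈ C, χ.IsLiteralOrNext)
      (hE : ∀ φ, next .E φ ∉ C) (hA : ∃ φ, next .A φ ∈ C) :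
      Step C .x0 (universalPart C)
  | x1 {C : Finset CTL} {φ : {χ : CTL // χ ∈ ϑ.closure}} (hC : X1Applies C)
      (hφ : next .E φ.1 ∈ C) :
      Step C (.x1 φ) (insert φ.1 (universalPart C))

/-- Some rule is applicable to the configuration `C`. -/
def Applicable {ϑ : CTL} (C : Config ϑ) : Prop :=
  ∃ (r : Rule ϑ) (C' : Config ϑ), Step C.1 r C'.1

/-- An infinite play of the satisfiability game for `ϑ`, with the rule applications made in it. -/
structure IsPlay {ϑ : CTL} (C : ℕ → Config ϑ) (r : ℕ → Rule ϑ) : Prop where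
  init : C 0 = ϑ.initConfig
  step : ∀ i, Step (C i).1 (r i) (C (i + 1)).1

/-- `Connected r χ χ'`: in the rule application `r`, the formula `χ'` is a descendant of the
principal formula `χ`, or `χ` is not principal and `χ'` is its copy. -/
def Connected {ϑ : CTL} : Rule ϑ → CTL → CTL → Prop
  | .reduce φ alternative, χ, χ' =>
      (χ = φ.1 ∧ ∃ D, χ.reduct alternative = some D ∧ χ' ∈ D) ∨ (χ ≠ φ.1 ∧ χ' = χ)
  | .x0, χ, χ' => χ = next .A χ'
  | .x1 φ, χ, χ' => χ = next .A χ' ∨ (χ = next .E χ' ∧ χ' = φ.1)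

/-- The play contains a `U`-thread: an infinite sequence of connected formulas in which some formula
`E (φ U ψ)` or `A (φ U ψ)` occurs infinitely often. -/
def HasUThread {ϑ : CTL} (C : ℕ → Config ϑ) (r : ℕ → Rule ϑ) : Prop :=
  ∃ t : ℕ → CTL, (∀ i, t i ∈ (C i).1) ∧ (∀ i, Connected (r i) (t i) (t (i + 1))) ∧
    ∃ q φ ψ, ∃ᶠ i in atTop, t i = untl q φ ψ

/-- The automaton accepts exactly those infinite plays of the satisfiability game for `ϑ` that
contain no `U`-thread, that is, the plays won by player 0. -/
def RecognisesWinningPlays (ϑ : CTL) (B : DBA (Rule ϑ)) : Prop :=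
  ∀ (C : ℕ → Config ϑ) (r : ℕ → Rule ϑ), IsPlay C r → (B.Accepts r ↔ ¬ HasUThread C r)

/-- The Büchi game for `ϑ`: the product of the satisfiability game for `ϑ` with a deterministic
Büchi automaton that reads the rule applications. The modal rule `X1` is played by player 1, and all
other rules by player 0. A configuration to which no rule is applicable is repeated for ever, to the
benefit of player 0 if it is a consistent set of literals, and of player 1 otherwise. -/
def satGame (ϑ : CTL) (B : DBA (Rule ϑ)) : BuchiGame (Config ϑ × B.State) where
  player0 := {v | ¬ X1Applies v.1.1}
  edge v u := (∃ r : Rule ϑ, Step v.1.1 r u.1.1 ∧ u.2 = B.step v.2 r) ∨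
    (¬ Applicable v.1 ∧ u = v)
  total v := by
    by_cases h : Applicable v.1
    · obtain ⟨r, C', hC'⟩ := h
      exact ⟨(C', B.step v.2 r), Or.inl ⟨r, hC', rfl⟩⟩
    · exact ⟨v, Or.inr ⟨h, rfl⟩⟩
  init := (ϑ.initConfig, B.init)
  accepting := {v | (Consistent v.1.1 ∧ ∀ χ ∈ v.1.1, χ.IsLiteral) ∨
    (Applicable v.1 ∧ v.2 ∈ B.final)}

end CTL

/-! ### Nested fixpoints of monotone operators on finite types -/

/-! Büchi games. The winning region of player 0 is the nested fixpoint νZ μY ((acc ∩ cpre Z) ∪ cpre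
Y). The stage at which a position enters the inner iteration is a rank that player 0 can lower until
the next accepting position; the stage at which a position drops out of the outer iteration is a
level that player 1 never has to raise and can lower at accepting positions. Hence membership in the
fixpoint decides the game (`BuchiGame.player0Wins_iff`). The algorithm evaluates the fixpoint with
`n` outer iterations; each is an attractor computation with counters in time O(n + m), and `n ≤ m`
because every position has a successor. It is written as a loop program, and `Cmd.compile_reaches`
transfers both its result and its cost to random access machines.

The automaton. The size of a formula without counting EX and AX never grows along a thread, so a
U-thread is finally confined to one formula χ = Q(φ U ψ) and QXχ (`thread_eventually`). Two bits
record whether a token is on χ or on QXχ. A deterministic automaton takes the candidates χ in cyclic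
order, follows the tokens of the current one until they are gone and then turns to the next one; it
is idle infinitely often iff there is no U-thread (`frequently_idle_iff`).

Satisfiability and the game. In a model, player 0 keeps all formulas of the configuration true,
fulfils every U at once when this is possible, and answers a choice of an EU formula by a successor
nearest to its fulfilment; then no U-thread can arise (`not_hasUThread`). If the initial position
were not winning, playing this against the level-lowering moves of player 1 would be contradictory
(`mem_win_of_satisfiable`). Conversely, the winning positions form a Hintikka structure: a state is
labelled with everything that occurs before the next modal rule, and an eventuality that is
postponed for ever would be a U-thread of a play inside the winning region (`Moves.isHintikka`).
Hintikka structures satisfy their labels (`IsHintikka.sat`).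

EXPTIME. The decision procedure does not build the game. It evaluates a nested fixpoint over pairs
(set of entries of the input, eventuality that is waited for). From the fixpoint a Hintikka
structure is read off (`Search.satisfiable_of_mem_outer`), and the theories of the states of a model
lie in it (`Search.theory_mem_outer`). All its loops run B = 2^|w| times, sets are stored as binary
numbers, and a calculus of computable functions (`Cmd.IsComputable`) yields a program with time
polynomial in B. -/

namespace NestedFix

variable {V : Type}

theorem iterate_empty_mono {g : Set V → Set V} (hg : Monotone g) :
    Monotone fun n => g^[n] ∅ := by
  refine monotone_nat_of_le_succ fun n => ?_
  induction n with
  | zero => exact Set.empty_subset _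
  | succ n ih => rw [Function.iterate_succ_apply', Function.iterate_succ_apply']; exact hg ih

/-- A chain that has not yet stopped gains an element at every stage, so by stage `N` it has stopped
or has exhausted `V`. -/
theorem iterate_empty_fix [Finite V] {g : Set V → Set V} (hg : Monotone g) {N : ℕ}
    (hN : Nat.card V ≤ N) : g (g^[N] ∅) = g^[N] ∅ := by
  have key : ∀ n, g (g^[n] ∅) = g^[n] ∅ ∨ n ≤ (g^[n] ∅).ncard := by
    intro n
    induction n with
    | zero => exact Or.inr (Nat.zero_le _)
    | succ n ih =>
      rw [Function.iterate_succ_apply']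
      by_cases h : g (g^[n] ∅) = g^[n] ∅
      · left; rw [h, h]
      · right
        have h1 : g^[n] ∅ ⊆ g (g^[n] ∅) := by
          have := iterate_empty_mono hg (Nat.le_succ n)
          simpa only [Function.iterate_succ_apply'] using this
        have h2 := Set.ncard_lt_ncard (h1.ssubset_of_ne (Ne.symm h)) (Set.toFinite _)
        have := ih.resolve_left h
        omega
  rcases key N with h | h
  · exact h
  · have h1 : g^[N] ∅ = Set.univ := by
      apply Set.eq_of_subset_of_ncard_le (Set.subset_univ _) _ (Set.toFinite _)
      rw [Set.ncard_univ]; omega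
    have h2 : g^[N] ∅ ⊆ g (g^[N] ∅) := by
      have := iterate_empty_mono hg (Nat.le_succ N)
      simpa only [Function.iterate_succ_apply'] using this
    rw [h1] at h2 ⊢
    exact Set.univ_subset_iff.1 h2

theorem iterate_empty_subset {g : Set V → Set V} (hg : Monotone g) {Y : Set V} (hY : g Y ⊆ Y)
    (n : ℕ) : g^[n] ∅ ⊆ Y := by
  induction n with
  | zero => exact Set.empty_subset _
  | succ n ih => rw [Function.iterate_succ_apply']; exact (hg ih).trans hY

/-- Complementation turns descending iterations into ascending ones; in this way stabilisation is
transferred from least to greatest fixpoints. -/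
theorem iterate_univ_compl (g : Set V → Set V) (n : ℕ) :
    (fun X => (g Xᶜ)ᶜ)^[n] ∅ = (g^[n] Set.univ)ᶜ := by
  induction n with
  | zero => simp
  | succ n ih => rw [Function.iterate_succ_apply', ih, Function.iterate_succ_apply', compl_compl]

theorem monotone_dual {g : Set V → Set V} (hg : Monotone g) : Monotone fun X => (g Xᶜ)ᶜ :=
  fun _ _ h => Set.compl_subset_compl.2 (hg (Set.compl_subset_compl.2 h))

theorem iterate_univ_fix [Finite V] {g : Set V → Set V} (hg : Monotone g) {N : ℕ}
    (hN : Nat.card V ≤ N) : g (g^[N] Set.univ) = g^[N] Set.univ := by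
  have := iterate_empty_fix (monotone_dual hg) hN
  rw [iterate_univ_compl, compl_compl] at this
  exact compl_injective this

theorem subset_iterate_univ {g : Set V → Set V} (hg : Monotone g) {Y : Set V} (hY : Y ⊆ g Y)
    (n : ℕ) : Y ⊆ g^[n] Set.univ := by
  induction n with
  | zero => exact Set.subset_univ _
  | succ n ih => rw [Function.iterate_succ_apply']; exact hY.trans (hg ih)

/-- A two-place operator on sets that is monotone in both arguments. -/
def Mono (F : Set V → Set V → Set V) : Prop :=
  ∀ ⦃Z Z' Y Y' : Set V⦄, Z ⊆ Z' → Y ⊆ Y' → F Z Y ⊆ F Z' Y'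

/-- The least fixpoint `μ Y, F Z Y`, computed by `N` iterations. -/
def inner (F : Set V → Set V → Set V) (N : ℕ) (Z : Set V) : Set V := (F Z)^[N] ∅

/-- The nested fixpoint `ν Z, μ Y, F Z Y`, computed by `N` iterations. -/
def outer (F : Set V → Set V → Set V) (N : ℕ) : Set V := (inner F N)^[N] Set.univ

variable {F : Set V → Set V → Set V} {N : ℕ}

theorem Mono.right (hF : Mono F) (Z : Set V) : Monotone (F Z) :=
  fun _ _ h => hF subset_rfl h

theorem inner_mono (hF : Mono F) : Monotone (inner F N) := by
  intro Z Z' h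
  have : ∀ n, (F Z)^[n] ∅ ⊆ (F Z')^[n] ∅ := by
    intro n
    induction n with
    | zero => exact subset_rfl
    | succ n ih =>
      rw [Function.iterate_succ_apply', Function.iterate_succ_apply']; exact hF h ih
  exact this N

theorem inner_fix [Finite V] (hF : Mono F) (hN : Nat.card V ≤ N) (Z : Set V) :
    F Z (inner F N Z) = inner F N Z :=
  iterate_empty_fix (hF.right Z) hN

theorem inner_subset (hF : Mono F) {Z Y : Set V} (h : F Z Y ⊆ Y) : inner F N Z ⊆ Y :=
  iterate_empty_subset (hF.right Z) h N

theorem inner_eq [Finite V] (hF : Mono F) (hN : Nat.card V ≤ N) {Z Y : Set V} (h : F Z Y ⊆ Y)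
    (h' : ∀ Y', F Z Y' ⊆ Y' → Y ⊆ Y') : Y = inner F N Z :=
  (h' _ (inner_fix hF hN Z).subset).antisymm (inner_subset hF h)

theorem outer_fix [Finite V] (hF : Mono F) (hN : Nat.card V ≤ N) :
    inner F N (outer F N) = outer F N :=
  iterate_univ_fix (inner_mono hF) hN

theorem subset_outer (hF : Mono F) {Z : Set V} (h : Z ⊆ inner F N Z) : Z ⊆ outer F N :=
  subset_iterate_univ (inner_mono hF) h N

/-- Members of the nested fixpoint are ranked by the stage of the inner iteration. -/
theorem exists_rank [Finite V] (hF : Mono F) (hN : Nat.card V ≤ N) :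
    ∃ rk : V → ℕ, ∀ v ∈ outer F N, v ∈ F (outer F N) {u | u ∈ outer F N ∧ rk u < rk v} := by
  classical
  set W := outer F N with hW
  have hin : ∀ n, (F W)^[n] ∅ ⊆ W := fun n =>
    iterate_empty_subset (hF.right W) (by
      have := inner_fix hF hN W
      rw [show inner F N W = W from outer_fix hF hN] at this
      exact this.subset) n
  have hex : ∀ v ∈ W, ∃ n, v ∈ (F W)^[n] ∅ := by
    intro v hv
    rw [hW, ← outer_fix hF hN] at hv
    exact ⟨N, hv⟩
  refine ⟨fun v => if h : v ∈ W then Nat.find (hex v h) else 0, fun v hv => ?_⟩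
  have h0 := Nat.find_spec (hex v hv)
  obtain ⟨n, hn⟩ : ∃ n, Nat.find (hex v hv) = n + 1 := by
    refine Nat.exists_eq_succ_of_ne_zero fun h => ?_
    rw [h] at h0; exact h0
  rw [hn, Function.iterate_succ_apply'] at h0
  refine hF subset_rfl (fun u hu => ?_) h0
  have huW := hin n hu
  refine ⟨huW, ?_⟩
  simp only [huW, hv, dif_pos, hn]
  exact Nat.lt_succ_of_le (Nat.find_min' _ hu)

/-- Non-members of the nested fixpoint are ranked by the stage of the outer iteration. -/
theorem exists_level [Finite V] (hF : Mono F) (hN : Nat.card V ≤ N) :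
    ∃ lvl : V → ℕ, ∀ v ∉ outer F N,
      v ∉ F {u | u ∉ outer F N → lvl v ≤ lvl u} {u | u ∉ outer F N → lvl v < lvl u} := by
  classical
  set W := outer F N with hW
  -- Stage 0 is the whole type, so a non-member is first missing at some stage `n + 1`. Its level is
  -- this `n`.
  have hex : ∀ v, v ∉ W → ∃ n, v ∉ (inner F N)^[n + 1] Set.univ := by
    intro v hv
    refine ⟨N, ?_⟩
    rw [Function.iterate_succ_apply']
    change v ∉ inner F N (outer F N)
    rwa [outer_fix hF hN]
  have hWsub : ∀ n, W ⊆ (inner F N)^[n] Set.univ := fun n =>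
    subset_iterate_univ (inner_mono hF) (outer_fix hF hN).symm.subset n
  refine ⟨fun v => if h : v ∈ W then 0 else Nat.find (hex v h), fun v hv hmem => ?_⟩
  have h0 := Nat.find_spec (hex v hv)
  set k := Nat.find (hex v hv) with hk
  -- Stage `k + 1` is the inner fixpoint for stage `k`, hence `F` maps these two stages back to
  -- stage `k + 1`, where `v` is missing. The two sets in the statement are contained in the stages
  -- `k` and `k + 1`.
  have e : F ((inner F N)^[k] Set.univ) ((inner F N)^[k + 1] Set.univ) =
      (inner F N)^[k + 1] Set.univ := by
    rw [Function.iterate_succ_apply']; exact inner_fix hF hN _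
  refine h0 (e.subset (hF (fun u hu => ?_) (fun u hu => ?_) hmem))
  · by_cases huW : u ∈ W
    · exact hWsub _ huW
    · have := hu huW
      simp only [hv, huW, dif_neg, not_false_eq_true] at this
      by_contra hcon
      rcases Nat.eq_zero_or_pos k with h | h
      · rw [h] at hcon; exact hcon (Set.mem_univ _)
      · have h1 := Nat.find_min' (hex u huW) (m := k - 1)
          (by rwa [Nat.sub_add_cancel h])
        omega
  · by_cases huW : u ∈ W
    · exact hWsub _ huW
    · have := hu huW
      simp only [hv, huW, dif_neg, not_false_eq_true] at this
      by_contra hcon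
      have h1 := Nat.find_min' (hex u huW) hcon
      omega

end NestedFix

/-! ### Büchi games are positionally determined -/

namespace BuchiGame

variable {V : Type} (G : BuchiGame V)

/-- The positions from which player 0 can force the next position into `X`. -/
def cpre (X : Set V) : Set V :=
  {v | (v ∈ G.player0 ∧ ∃ u, G.edge v u ∧ u ∈ X) ∨ (v ∉ G.player0 ∧ ∀ u, G.edge v u → u ∈ X)}

/-- The operator whose nested fixpoint is the winning region of player 0. -/
def op (Z Y : Set V) : Set V := (G.accepting ∩ G.cpre Z) ∪ G.cpre Y

theorem cpre_mono {X Y : Set V} (h : X ⊆ Y) : G.cpre X ⊆ G.cpre Y := by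
  rintro v (⟨h0, u, hu, hX⟩ | ⟨h0, h1⟩)
  · exact Or.inl ⟨h0, u, hu, h hX⟩
  · exact Or.inr ⟨h0, fun u hu => h (h1 u hu)⟩

theorem op_mono : NestedFix.Mono G.op := fun _ _ _ _ hZ hY =>
  Set.union_subset_union (Set.inter_subset_inter_right _ (G.cpre_mono hZ)) (G.cpre_mono hY)

/-- The winning region of player 0. -/
noncomputable def win : Set V := NestedFix.outer G.op (Nat.card V)

/-- In the winning region player 0 can make a rank decrease up to the next accepting position. -/
theorem exists_rank [Finite V] : ∃ rk : V → ℕ, ∀ v ∈ G.win,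
    v ∈ G.cpre {u | u ∈ G.win ∧ (v ∉ G.accepting → rk u < rk v)} := by
  obtain ⟨rk, h⟩ := NestedFix.exists_rank G.op_mono (N := Nat.card V) le_rfl
  refine ⟨rk, fun v hv => ?_⟩
  rcases h v hv with ⟨h1, h2⟩ | h2
  · refine G.cpre_mono ?_ h2
    exact fun u hu => ⟨hu, fun h => absurd h1 h⟩
  · refine G.cpre_mono ?_ h2
    exact fun u hu => ⟨hu.1, fun _ => hu.2⟩

/-- Outside of the winning region player 1 can make a level decrease weakly in each move, and
strictly in accepting positions. -/
theorem exists_level [Finite V] : ∃ lvl : V → ℕ, ∀ v ∉ G.win,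
    (v ∈ G.player0 → ∀ u, G.edge v u →
      u ∉ G.win ∧ lvl u ≤ lvl v ∧ (v ∈ G.accepting → lvl u < lvl v)) ∧
    (v ∉ G.player0 → ∃ u, G.edge v u ∧
      u ∉ G.win ∧ lvl u ≤ lvl v ∧ (v ∈ G.accepting → lvl u < lvl v)) := by
  obtain ⟨lvl, h⟩ := NestedFix.exists_level G.op_mono (N := Nat.card V) le_rfl
  refine ⟨lvl, fun v hv => ?_⟩
  have h1 := h v hv
  change v ∉ (G.accepting ∩ G.cpre {u | u ∉ G.win → lvl v ≤ lvl u}) ∪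
    G.cpre {u | u ∉ G.win → lvl v < lvl u} at h1
  simp only [cpre, Set.mem_union, Set.mem_inter_iff, Set.mem_ofPred_eq, not_or, not_and,
    not_exists, not_forall, not_lt, not_le, exists_prop] at h1
  obtain ⟨hA, hB0, hB1⟩ := h1
  refine ⟨fun h0 u hu => ?_, fun h0 => ?_⟩
  · obtain ⟨hu1, hu2⟩ := hB0 h0 u hu
    exact ⟨hu1, hu2, fun ha => ((hA ha).1 h0 u hu).2⟩
  · by_cases ha : v ∈ G.accepting
    · obtain ⟨u, hu, hu1, hu2⟩ := (hA ha).2 h0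
      exact ⟨u, hu, hu1, hu2.le, fun _ => hu2⟩
    · obtain ⟨u, hu, hu1, hu2⟩ := hB1 h0
      exact ⟨u, hu, hu1, hu2, fun h => absurd h ha⟩

/-- A sequence along which a rank decreases in all steps but those of a set visits the set infinitely
often. -/
theorem frequently_of_rank {α : Type} {x : ℕ → α} {A : Set α} {rk : α → ℕ}
    (h : ∀ n, x n ∉ A → rk (x (n + 1)) < rk (x n)) : ∃ᶠ n in atTop, x n ∈ A := by
  rw [frequently_atTop]
  intro a
  by_contra hcon
  push Not at hcon
  have : ∀ k, rk (x (a + k)) + k ≤ rk (x a) := by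
    intro k
    induction k with
    | zero => simp
    | succ k ih =>
      have := h (a + k) (hcon _ (by omega))
      change rk (x (a + k + 1)) + (k + 1) ≤ _
      omega
  have := this (rk (x a) + 1)
  omega

/-- A sequence along which a level never increases and decreases at the members of a set leaves the
set eventually. -/
theorem not_frequently_of_level {α : Type} {x : ℕ → α} {A : Set α} {lvl : α → ℕ}
    (h : ∀ n, lvl (x (n + 1)) ≤ lvl (x n) ∧ (x n ∈ A → lvl (x (n + 1)) < lvl (x n))) :
    ¬ ∃ᶠ n in atTop, x n ∈ A := by
  intro hf
  have anti : Antitone fun n => lvl (x n) := antitone_nat_of_succ_le fun n => (h n).1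
  have : ∀ k, ∃ n, lvl (x n) + k ≤ lvl (x 0) := by
    intro k
    induction k with
    | zero => exact ⟨0, le_rfl⟩
    | succ k ih =>
      obtain ⟨n, hn⟩ := ih
      obtain ⟨m, hm, hA⟩ := frequently_atTop.1 hf n
      have h1 := (h m).2 hA
      have h2 := anti hm
      exact ⟨m + 1, by simp only at h2; omega⟩
  obtain ⟨n, hn⟩ := this (lvl (x 0) + 1)
  omega

/-- Outside of the winning region, any strategy of player 0 is refuted by the play in which player 1
follows the level: the level drops at each accepting position, so there are only finitely many of
them. Inside, moving as the rank demands is a winning strategy that looks only at the last position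
of the history. -/
theorem player0Wins_iff [Finite V] : G.Player0Wins ↔ G.init ∈ G.win := by
  classical
  constructor
  · rintro ⟨σ, hσ, hwin⟩
    by_contra hinit
    obtain ⟨lvl, hl⟩ := G.exists_level
    have hτ : ∀ v, ∃ u, (v ∉ G.win → v ∉ G.player0 → G.edge v u ∧
        u ∉ G.win ∧ lvl u ≤ lvl v ∧ (v ∈ G.accepting → lvl u < lvl v)) := by
      intro v
      by_cases h : v ∉ G.win ∧ v ∉ G.player0
      · obtain ⟨u, hu⟩ := (hl v h.1).2 h.2
        exact ⟨u, fun _ _ => hu⟩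
      · exact ⟨v, fun h1 h2 => absurd ⟨h1, h2⟩ h⟩
    choose τ hτ using hτ
    -- the histories of the play, together with their last positions
    let H : ℕ → List V × V := fun n => Nat.rec ([], G.init)
      (fun _ p => (p.1 ++ [p.2], if p.2 ∈ G.player0 then σ (p.1 ++ [p.2]) else τ p.2)) n
    have hH : ∀ n, (H n).1 ++ [(H n).2] = (List.range (n + 1)).map fun i => (H i).2 := by
      intro n
      induction n with
      | zero => rfl
      | succ n ih =>
        rw [List.range_succ, List.map_append, ← ih]; rfl
    have hstep : ∀ n, (H (n + 1)).2 =
        if (H n).2 ∈ G.player0 then σ ((H n).1 ++ [(H n).2]) else τ (H n).2 := fun n => rfl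
    have hinv : ∀ n, (H n).2 ∉ G.win := by
      intro n
      induction n with
      | zero => exact hinit
      | succ n ih =>
        rw [hstep]
        split_ifs with h
        · exact ((hl _ ih).1 h _ (hσ _ _ h)).1
        · exact (hτ _ ih h).2.1
    have hedge : ∀ n, G.edge (H n).2 (H (n + 1)).2 ∧ (lvl (H (n + 1)).2 ≤ lvl (H n).2 ∧
        ((H n).2 ∈ G.accepting → lvl (H (n + 1)).2 < lvl (H n).2)) := by
      intro n
      rw [hstep]
      split_ifs with h
      · exact ⟨hσ _ _ h, ((hl _ (hinv n)).1 h _ (hσ _ _ h)).2⟩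
      · exact ⟨(hτ _ (hinv n) h).1, (hτ _ (hinv n) h).2.2⟩
    refine not_frequently_of_level (fun n => (hedge n).2)
      (hwin (fun n => (H n).2) rfl (fun n => (hedge n).1) fun n hn => ?_)
    rw [hstep, if_pos hn, hH]
  · intro hinit
    obtain ⟨rk, hr⟩ := G.exists_rank
    have hf : ∀ v, ∃ u, G.edge v u ∧
        (v ∈ G.win → v ∈ G.player0 → u ∈ G.win ∧ (v ∉ G.accepting → rk u < rk v)) := by
      intro v
      by_cases h : v ∈ G.win ∧ v ∈ G.player0
      · rcases hr v h.1 with ⟨_, u, hu, h2⟩ | ⟨h0, _⟩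
        · exact ⟨u, hu, fun _ _ => h2⟩
        · exact absurd h.2 h0
      · obtain ⟨u, hu⟩ := G.total v
        exact ⟨u, hu, fun h1 h2 => absurd ⟨h1, h2⟩ h⟩
    choose f hf using hf
    refine ⟨fun l => f (l.getLastD G.init), fun h v _ => by simpa using (hf v).1, ?_⟩
    intro π h0 hedge hcons
    have key : ∀ n, π n ∈ G.win → π (n + 1) ∈ G.win ∧
        (π n ∉ G.accepting → rk (π (n + 1)) < rk (π n)) := by
      intro n hn
      rcases hr _ hn with ⟨hp, -⟩ | ⟨_, h1⟩
      · have := hcons n hp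
        rw [List.range_succ, List.map_append, List.map_singleton] at this
        simp only [List.getLastD_concat] at this
        rw [this]
        exact (hf _).2 hn hp
      · exact h1 _ (hedge n)
    have hinv : ∀ n, π n ∈ G.win := by
      intro n
      induction n with
      | zero => rwa [h0]
      | succ n ih => exact (key n ih).1
    exact frequently_of_rank fun n => (key n (hinv n)).2

end BuchiGame

/-! ### A language of loop programs with arrays, and its compilation to random access machines -/

/-- The memory of a loop program: variables and sixteen infinite arrays. -/
structure Store where
  var : ℕ → ℕ
  arr : Fin 16 → ℕ → ℕ

/-- Loop programs. -/
inductive Cmd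
  | const (x c : ℕ)               -- `x := c`
  | add (x y z : ℕ)               -- `x := y + z`
  | sub (x y z : ℕ)               -- `x := y - z`
  | len (x : ℕ)                   -- `x :=` the length of the input `w`
  | input (x y : ℕ)               -- `x := w[y]` for the input `w`, or `0` beyond its end
  | get (x : ℕ) (a : Fin 16) (y : ℕ)   -- `x := a[y]`
  | put (a : Fin 16) (y x : ℕ)    -- `a[y] := x`
  | seq (c d : Cmd)
  | ite (x : ℕ) (c d : Cmd)       -- `if x ≠ 0 then c else d`
  | rep (x : ℕ) (c : Cmd)         -- repeat `c` as often as `x` says at the beginning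

namespace Store

def set (s : Store) (x v : ℕ) : Store := ⟨Function.update s.var x v, s.arr⟩

def setArr (s : Store) (a : Fin 16) (i v : ℕ) : Store :=
  ⟨s.var, Function.update s.arr a (Function.update (s.arr a) i v)⟩

end Store

namespace Cmd

def eval (w : List ℕ) : Cmd → Store → Store
  | const x c, s => s.set x c
  | add x y z, s => s.set x (s.var y + s.var z)
  | sub x y z, s => s.set x (s.var y - s.var z)
  | len x, s => s.set x w.length
  | input x y, s => s.set x (w.getD (s.var y) 0)
  | get x a y, s => s.set x (s.arr a (s.var y))
  | put a y x, s => s.setArr a (s.var y) (s.var x)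
  | seq c d, s => d.eval w (c.eval w s)
  | ite x c d, s => if s.var x = 0 then d.eval w s else c.eval w s
  | rep x c, s => (c.eval w)^[s.var x] s

/-- The number of machine steps. -/
def cost (w : List ℕ) : Cmd → Store → ℕ
  | const _ _, _ | add _ _ _, _ | sub _ _ _, _ | len _, _ => 1
  | input _ _, _ => 4
  | get _ _ _, _ | put _ _ _, _ => 8
  | seq c d, s => c.cost w s + d.cost w (c.eval w s)
  | ite x c d, s => if s.var x = 0 then 1 + d.cost w s else 2 + c.cost w s
  | rep x c, s => 2 + ∑ i ∈ Finset.range (s.var x), (4 + c.cost w ((c.eval w)^[i] s))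

/-- The length of the compiled program. -/
def size : Cmd → ℕ
  | const _ _ | add _ _ _ | sub _ _ _ | len _ => 1
  | input _ _ => 5
  | get _ _ _ | put _ _ _ => 8
  | seq c d => c.size + d.size
  | ite _ c d => c.size + d.size + 2
  | rep _ c => c.size + 5

/-- Puts the address of `a[y]` into register 1. -/
def address (a : Fin 16) (y : ℕ) : List Instr :=
  [.add 1 (2 * y + 4) (2 * y + 4), .add 1 1 1, .add 1 1 1, .add 1 1 1, .add 1 1 0, .const 3 a,
    .add 1 1 3]

/-- Compilation of a command inside `d` loops to code that starts at line `l`. Variables and loop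
counters occupy the registers `2 x + 4` and `2 d + 5`; register 0 holds the length of the input and
register 2 holds `0`. -/
def compile : Cmd → ℕ → ℕ → List Instr
  | const x c, _, _ => [.const (2 * x + 4) c]
  | add x y z, _, _ => [.add (2 * x + 4) (2 * y + 4) (2 * z + 4)]
  | sub x y z, _, _ => [.sub (2 * x + 4) (2 * y + 4) (2 * z + 4)]
  | len x, _, _ => [.add (2 * x + 4) 0 2]
  | input x y, _, l => [.sub 1 0 (2 * y + 4), .jumpz 1 (l + 4), .load (2 * x + 4) (2 * y + 4),
      .jumpz 2 (l + 5), .const (2 * x + 4) 0]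
  | get x a y, _, _ => address a y ++ [.load (2 * x + 4) 1]
  | put a y x, _, _ => address a y ++ [.store 1 (2 * x + 4)]
  | seq c c', d, l => c.compile d l ++ c'.compile d (l + c.size)
  | ite x c c', d, l => [.jumpz (2 * x + 4) (l + 1 + c.size + 1)] ++ c.compile d (l + 1) ++
      [.jumpz 2 (l + 1 + c.size + 1 + c'.size)] ++ c'.compile d (l + 1 + c.size + 1)
  | rep x c, d, l => [.add (2 * d + 5) (2 * x + 4) 2, .jumpz (2 * d + 5) (l + 4 + c.size + 1),
      .const 1 1, .sub (2 * d + 5) (2 * d + 5) 1] ++ c.compile (d + 1) (l + 4) ++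
      [.jumpz 2 (l + 1)]

theorem length_compile (c : Cmd) : ∀ d l, (c.compile d l).length = c.size := by
  induction c with
  | seq c d hc hd => intro _ _; simp [compile, size, hc, hd]
  | ite x c d hc hd => intro _ _; simp [compile, size, hc, hd]; omega
  | rep x c hc => intro _ _; simp [compile, size, hc]
  | _ => intro _ _; rfl

/-- The instructions of `L` stand in the program `P` from line `l` on. -/
def CodeAt (P : List Instr) (l : ℕ) (L : List Instr) : Prop :=
  ∀ i, i < L.length → P[l + i]? = L[i]?

theorem codeAt_append {P L L' : List Instr} {l : ℕ} :
    CodeAt P l (L ++ L') ↔ CodeAt P l L ∧ CodeAt P (l + L.length) L' := by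
  constructor
  · intro h
    refine ⟨fun i hi => ?_, fun i hi => ?_⟩
    · rw [h i (by rw [List.length_append]; omega), List.getElem?_append_left hi]
    · rw [add_assoc, h _ (by rw [List.length_append]; omega),
        List.getElem?_append_right (by omega), Nat.add_sub_cancel_left]
  · rintro ⟨h, h'⟩ i hi
    rw [List.length_append] at hi
    by_cases hi' : i < L.length
    · rw [h i hi', List.getElem?_append_left hi']
    · have := h' (i - L.length) (by omega)
      rw [show l + L.length + (i - L.length) = l + i by omega] at this
      rw [this, List.getElem?_append_right (by omega)]

theorem codeAt_cons {P L : List Instr} {I : Instr} {l : ℕ} :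
    CodeAt P l (I :: L) ↔ P[l]? = some I ∧ CodeAt P (l + 1) L := by
  constructor
  · intro h
    refine ⟨by simpa using h 0 (by simp), fun i hi => ?_⟩
    have := h (i + 1) (by simpa using hi)
    rw [add_assoc, add_comm 1 i, this, List.getElem?_cons_succ]
  · rintro ⟨h, h'⟩ i hi
    cases i with
    | zero => simpa using h
    | succ i =>
      have := h' i (by simpa using hi)
      rw [List.getElem?_cons_succ, ← this, add_assoc, add_comm 1 i]

/-- The machine state `m` represents the store `s`. -/
structure Sim (w : List ℕ) (s : Store) (m : RAMState) : Prop where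
  len : m.reg 0 = w.length
  zero : m.reg 2 = 0
  var : ∀ x, m.reg (2 * x + 4) = s.var x
  input : ∀ i < w.length, m.mem i = w.getD i 0
  arr : ∀ (a : Fin 16) i, m.mem (w.length + 16 * i + a) = s.arr a i

theorem next_of {P : List Instr} {m : RAMState} {I : Instr} (h : P[m.pc]? = some I) :
    RAMState.next P m = I.exec m := by
  simp [RAMState.next, h]

/-- The machine with program `P` comes from the state `m` to a state with property `Q` in at most `t`
steps. -/
def Reaches (P : List Instr) (m : RAMState) (t : ℕ) (Q : RAMState → Prop) : Prop :=
  ∃ k ≤ t, Q ((RAMState.next P)^[k] m)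

theorem Reaches.refl {P : List Instr} {m : RAMState} {Q : RAMState → Prop} {t : ℕ} (h : Q m) :
    Reaches P m t Q := ⟨0, Nat.zero_le _, h⟩

theorem Reaches.trans {P : List Instr} {m : RAMState} {Q Q' : RAMState → Prop} {t t' : ℕ}
    (h : Reaches P m t Q) (h' : ∀ m', Q m' → Reaches P m' t' Q') : Reaches P m (t + t') Q' := by
  obtain ⟨k, hk, hQ⟩ := h
  obtain ⟨k', hk', hQ'⟩ := h' _ hQ
  refine ⟨k' + k, by omega, ?_⟩
  rwa [Function.iterate_add_apply]

theorem Reaches.mono {P : List Instr} {m : RAMState} {Q Q' : RAMState → Prop} {t t' : ℕ}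
    (h : Reaches P m t Q) (ht : t ≤ t') (hQ : ∀ m', Q m' → Q' m') : Reaches P m t' Q' := by
  obtain ⟨k, hk, h⟩ := h
  exact ⟨k, hk.trans ht, hQ _ h⟩

theorem Reaches.step {P : List Instr} {m : RAMState} {I : Instr} {Q : RAMState → Prop} {t : ℕ}
    (h : P[m.pc]? = some I) (h' : Reaches P (I.exec m) t Q) : Reaches P m (t + 1) Q := by
  obtain ⟨k, hk, hQ⟩ := h'
  refine ⟨k + 1, by omega, ?_⟩
  rwa [Function.iterate_succ_apply, next_of h]

theorem address_reaches {w : List ℕ} {P : List Instr} {s : Store} {m : RAMState} {a : Fin 16}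
    {y : ℕ} (hs : Sim w s m) (hP : CodeAt P m.pc (address a y)) :
    Reaches P m 7 fun m' => m'.pc = m.pc + 7 ∧ m'.mem = m.mem ∧
      m'.reg 1 = w.length + 16 * s.var y + a ∧ ∀ r, r ≠ 1 → r ≠ 3 → m'.reg r = m.reg r := by
  simp only [address, codeAt_cons] at hP
  obtain ⟨h0, h1, h2, h3, h4, h5, h6, -⟩ := hP
  refine .step h0 (.step h1 (.step h2 (.step h3 (.step h4 (.step h5 (.step h6 (.refl ?_)))))))
  refine ⟨rfl, rfl, ?_, fun r h h' => ?_⟩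
  · simp [Instr.exec, hs.var, hs.len]
    ring
  · simp [Instr.exec, h, h']

/-- Induction on the command. `Sim` says nothing about the scratch registers 1 and 3 or about the
loop counters, so the counters of the enclosing loops need a clause of their own; it holds because a
loop at depth `d` uses the counter of `d` and compiles its body for depth `d + 1`. The register 2,
always zero, makes `jumpz 2` an unconditional jump. -/
theorem compile_reaches (w : List ℕ) (P : List Instr) (c : Cmd) : ∀ (d l : ℕ) (s : Store)
    (m : RAMState), CodeAt P l (c.compile d l) → m.pc = l → Sim w s m →
    Reaches P m (c.cost w s) fun m' => m'.pc = l + c.size ∧ Sim w (c.eval w s) m' ∧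
      ∀ e < d, m'.reg (2 * e + 5) = m.reg (2 * e + 5) := by
  have hset : ∀ {s : Store} {m m' : RAMState} {x v : ℕ}, Sim w s m → m'.mem = m.mem →
      (∀ r, r ≠ 1 → r ≠ 3 → m'.reg r = Function.update m.reg (2 * x + 4) v r) →
      Sim w (s.set x v) m' := by
    intro s m m' x v hs hm hr
    refine ⟨?_, ?_, fun y => ?_, by rw [hm]; exact hs.input, by rw [hm]; exact hs.arr⟩
    · rw [hr _ (by omega) (by omega), Function.update_of_ne (by omega), hs.len]
    · rw [hr _ (by omega) (by omega), Function.update_of_ne (by omega), hs.zero]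
    · simp only [Store.set]; rw [hr _ (by omega) (by omega), Function.update_apply,
        Function.update_apply, hs.var]
      simp
  induction c with
  | const x c =>
    intro d l s m hP hl hs
    subst hl
    simp only [compile, codeAt_cons] at hP
    refine .step hP.1 (.refl ⟨rfl, hset hs rfl fun r _ _ => rfl, fun e _ => ?_⟩)
    simp [Instr.exec, Function.update_apply]; omega
  | add x y z =>
    intro d l s m hP hl hs
    subst hl
    simp only [compile, codeAt_cons] at hP
    refine .step hP.1 (.refl ⟨rfl, hset hs rfl fun r _ _ => ?_, fun e _ => ?_⟩)
    · rw [← hs.var, ← hs.var]; rfl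
    · simp [Instr.exec, Function.update_apply]; omega
  | sub x y z =>
    intro d l s m hP hl hs
    subst hl
    simp only [compile, codeAt_cons] at hP
    refine .step hP.1 (.refl ⟨rfl, hset hs rfl fun r _ _ => ?_, fun e _ => ?_⟩)
    · rw [← hs.var, ← hs.var]; rfl
    · simp [Instr.exec, Function.update_apply]; omega
  | len x =>
    intro d l s m hP hl hs
    subst hl
    simp only [compile, codeAt_cons] at hP
    refine .step hP.1 (.refl ⟨rfl, hset hs rfl fun r _ _ => ?_, fun e _ => ?_⟩)
    · simp [Instr.exec, hs.len, hs.zero]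
    · simp [Instr.exec, Function.update_apply]; omega
  | input x y =>
    intro d l s m hP hl hs
    subst hl
    simp only [compile, codeAt_cons] at hP
    obtain ⟨h0, h1, h2, h3, h4, -⟩ := hP
    -- The cells behind the input hold the arrays, so an index out of range must be intercepted:
    -- loading that cell could yield an array entry instead of `0`.
    by_cases hy : s.var y < w.length
    · refine .step h0 (.step (I := .jumpz 1 (m.pc + 4)) h1 ?_)
      have e : (Instr.jumpz 1 (m.pc + 4)).exec ((Instr.sub 1 0 (2 * y + 4)).exec m) =
          ⟨m.pc + 1 + 1, Function.update m.reg 1 (w.length - s.var y), m.mem⟩ := by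
        simp [Instr.exec, hs.var, hs.len]; omega
      rw [e]
      refine .step h2 (.step (I := .jumpz 2 (m.pc + 5)) h3 (.refl ?_))
      refine ⟨by simp [Instr.exec, hs.zero, size],
        hset hs rfl fun r hr hr' => ?_, fun e _ => ?_⟩
      · simp only [Instr.exec, Function.update_apply, hr, if_false]
        rw [if_neg (by omega : 2 * y + 4 ≠ 1), hs.var, hs.input _ hy]
      · simp [Instr.exec, Function.update_apply]; omega
    · refine .mono (t := 3) (.step h0 (.step (I := .jumpz 1 (m.pc + 4)) h1 ?_)) (by simp [cost])
        fun _ h => h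
      have e : (Instr.jumpz 1 (m.pc + 4)).exec ((Instr.sub 1 0 (2 * y + 4)).exec m) =
          ⟨m.pc + 4, Function.update m.reg 1 (w.length - s.var y), m.mem⟩ := by
        simp [Instr.exec, hs.var, hs.len]; omega
      rw [e]
      refine .step (I := .const (2 * x + 4) 0) h4 (.refl ?_)
      refine ⟨rfl, hset hs rfl fun r hr hr' => ?_, fun e _ => ?_⟩
      · simp only [Instr.exec, Function.update_apply, hr, if_false]
        rw [List.getD_eq_default _ _ (by omega)]
      · simp [Instr.exec, Function.update_apply]; omega
  | get x a y =>
    intro d l s m hP hl hs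
    subst hl
    obtain ⟨hP, hP'⟩ := codeAt_append.1 hP
    refine (address_reaches hs hP).trans (t' := 1) fun m' ⟨hpc, hmem, h1, hr⟩ => ?_
    have h7 := (codeAt_cons.1 hP').1
    refine .step (I := .load (2 * x + 4) 1) (by rw [hpc]; exact h7) (.refl ?_)
    refine ⟨by simp [Instr.exec, hpc, size], ?_, fun e _ => ?_⟩
    · refine hset hs hmem fun r h h' => ?_
      simp only [Instr.exec, Function.update_apply, hmem, h1, hs.arr, hr r h h']
    · simp only [Instr.exec]
      rw [Function.update_of_ne (by omega), hr _ (by omega) (by omega)]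
  | put a y x =>
    intro d l s m hP hl hs
    subst hl
    obtain ⟨hP, hP'⟩ := codeAt_append.1 hP
    refine (address_reaches hs hP).trans (t' := 1) fun m' ⟨hpc, hmem, h1, hr⟩ => ?_
    have h7 := (codeAt_cons.1 hP').1
    refine .step (I := .store 1 (2 * x + 4)) (by rw [hpc]; exact h7) (.refl ?_)
    refine ⟨by simp [Instr.exec, hpc, size], ⟨?_, ?_, fun z => ?_, fun i hi => ?_, fun b i => ?_⟩,
      fun e _ => ?_⟩
    · simp only [Instr.exec]; rw [hr _ (by omega) (by omega), hs.len]
    · simp only [Instr.exec]; rw [hr _ (by omega) (by omega), hs.zero]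
    · simp only [Instr.exec]; rw [hr _ (by omega) (by omega), hs.var]; rfl
    · simp only [Instr.exec]
      rw [Function.update_of_ne (by rw [h1]; omega), hmem, hs.input i hi]
    · simp only [Instr.exec, eval, Store.setArr, Function.update_apply]
      rw [hr (2 * x + 4) (by omega) (by omega), hs.var, hmem, h1]
      -- The sixteen arrays are interleaved: since array numbers are below 16, distinct pairs of
      -- array and index have distinct addresses, and one store changes one entry only.
      by_cases hb : b = a
      · subst hb
        by_cases hi : i = s.var y
        · subst hi; simp
        · rw [if_neg (by omega), if_pos rfl, Function.update_of_ne hi, hs.arr]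
      · have : (b : ℕ) ≠ a := fun h => hb (Fin.ext h)
        have := b.2
        have := a.2
        rw [if_neg (by omega), if_neg hb, hs.arr]
    · simp only [Instr.exec]
      rw [hr _ (by omega) (by omega)]
  | seq c c' hc hc' =>
    intro d l s m hP hl hs
    obtain ⟨hP, hP'⟩ := codeAt_append.1 hP
    rw [length_compile] at hP'
    refine (hc d l s m hP hl hs).trans fun m' ⟨hpc, hs', hr⟩ => ?_
    refine (hc' d _ _ m' hP' hpc hs').mono le_rfl fun m'' ⟨hpc', hs'', hr'⟩ => ?_
    exact ⟨by rw [hpc', size, add_assoc], hs'', fun e he => (hr' e he).trans (hr e he)⟩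
  | ite x c c' hc hc' =>
    intro d l s m hP hl hs
    simp only [compile, List.append_assoc, List.cons_append, List.nil_append, codeAt_cons,
      codeAt_append, length_compile] at hP
    obtain ⟨h0, h1, h2, h3⟩ := hP
    subst hl
    have h0' := Reaches.step (P := P) (m := m) h0
      (.refl (t := 0) (Q := fun m' => m' = (Instr.jumpz (2 * x + 4) _).exec m) rfl)
    by_cases hx : s.var x = 0
    · rw [cost, eval, if_pos hx, if_pos hx]
      refine h0'.trans fun m' hm' => ?_
      simp only [Instr.exec, hs.var, hx, if_true] at hm'
      subst hm'
      refine (hc' d _ s ⟨m.pc + 1 + c.size + 1, m.reg, m.mem⟩ h3 rfl ⟨hs.1, hs.2, hs.3, hs.4, hs.5⟩).mono le_rfl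
        fun m'' ⟨hpc', hs'', hr'⟩ => ⟨?_, hs'', hr'⟩
      rw [hpc', size]; omega
    · rw [cost, eval, if_neg hx, if_neg hx]
      refine (h0'.trans (t' := c.cost w s + 1) fun m' hm' => ?_).mono (by omega) fun _ h => h
      simp only [Instr.exec, hs.var, hx, if_false] at hm'
      subst hm'
      refine (hc d _ s ⟨m.pc + 1, m.reg, m.mem⟩ h1 rfl ⟨hs.1, hs.2, hs.3, hs.4, hs.5⟩).trans
        fun m'' ⟨hpc', hs'', hr'⟩ => ?_
      refine .step (by rw [hpc']; exact h2) (.refl ?_)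
      simp only [Instr.exec, hs''.zero, if_true]
      refine ⟨?_, ⟨hs''.1, hs''.2, hs''.3, hs''.4, hs''.5⟩, hr'⟩
      rw [size]; omega
  | rep x c hc =>
    intro d l s m hP hl hs
    simp only [compile, List.cons_append, List.nil_append, codeAt_cons,
      codeAt_append, length_compile] at hP
    obtain ⟨h0, h1, h2, h3, h4, h5, -⟩ := hP
    subst hl
    -- the loop, with the counter already in its register
    have loop : ∀ (n : ℕ) (s : Store) (m' : RAMState), m'.pc = m.pc + 1 → Sim w s m' →
        m'.reg (2 * d + 5) = n →
        Reaches P m' (1 + ∑ i ∈ Finset.range n, (4 + c.cost w ((c.eval w)^[i] s))) fun m'' =>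
          m''.pc = m.pc + (rep x c).size ∧ Sim w ((c.eval w)^[n] s) m'' ∧
          ∀ e < d, m''.reg (2 * e + 5) = m'.reg (2 * e + 5) := by
      intro n
      induction n with
      | zero =>
        intro s m' hpc hs' hn
        refine .step (t := 0) (by rw [hpc]; exact h1) (.refl ?_)
        simp only [Instr.exec, hn, if_true]
        refine ⟨?_, ⟨hs'.1, hs'.2, hs'.3, hs'.4, hs'.5⟩, fun _ _ => trivial⟩
        rw [size]; omega
      | succ n ih =>
        intro s m' hpc hs' hn
        have hm1 : Reaches P m' 3 fun m'' => m''.pc = m.pc + 4 ∧ Sim w s m'' ∧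
            m''.reg (2 * d + 5) = n ∧ ∀ e < d, m''.reg (2 * e + 5) = m'.reg (2 * e + 5) := by
          refine .step (t := 2) (by rw [hpc]; exact h1) ?_
          simp only [Instr.exec, hn, Nat.add_one_ne_zero, if_false, hpc]
          refine .step h2 (.step h3 (.refl ⟨rfl, ⟨?_, ?_, fun y => ?_, hs'.input, hs'.arr⟩, ?_, ?_⟩))
          · simp [Instr.exec, hs'.len]
          · simp [Instr.exec, hs'.zero]
          · simp [Instr.exec, Function.update_apply, hs'.var]; omega
          · simp [Instr.exec, hn]
          · intro e he; simp [Instr.exec, Function.update_apply]; omega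
        -- The summand split off belongs to the current iteration, and the rest is the cost of the
        -- loop restarted from `c.eval w s`. The constant 4 consists of the three instructions
        -- before the body and the jump back.
        rw [Finset.sum_range_succ']
        refine (hm1.trans (t' := c.cost w s + (1 + (1 +
          ∑ i ∈ Finset.range n, (4 + c.cost w ((c.eval w)^[i] (c.eval w s)))))) ?_).mono ?_
          fun _ h => h
        · intro m2 ⟨hpc2, hs2, hn2, hr2⟩
          refine (hc (d + 1) _ s m2 h4 hpc2 hs2).trans fun m3 ⟨hpc3, hs3, hr3⟩ => ?_
          rw [add_comm 1]
          refine .step (by rw [hpc3]; exact h5) ?_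
          simp only [Instr.exec, hs3.zero, if_true]
          refine (ih (c.eval w s) ⟨m.pc + 1, m3.reg, m3.mem⟩ rfl ⟨hs3.1, hs3.2, hs3.3, hs3.4, hs3.5⟩
            ((hr3 d (by omega)).trans hn2)).mono le_rfl fun m4 ⟨hpc4, hs4, hr4⟩ => ⟨hpc4, hs4, ?_⟩
          intro e he
          rw [hr4 e he, ← hr2 e he, ← hr3 e (by omega)]
        · simp only [Function.iterate_succ_apply, Function.iterate_zero, id]
          omega
    refine (Reaches.step (t := _) (P := P) (m := m) h0 (loop (s.var x) s _ rfl ?_ ?_)).mono ?_ ?_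
    · refine ⟨?_, ?_, fun y => ?_, hs.input, hs.arr⟩
      · simp [Instr.exec, hs.len]
      · simp [Instr.exec, hs.zero]
      · simp [Instr.exec, Function.update_apply, hs.var]; omega
    · simp [Instr.exec, hs.var, hs.zero]
    · simp only [cost]; omega
    · intro m' ⟨hpc, hs', hr⟩
      refine ⟨hpc, hs', fun e he => ?_⟩
      rw [hr e he]
      simp [Instr.exec, Function.update_apply]; omega

/-- The machine program for the command `c` with the result in the variable `x`. -/
def program (c : Cmd) (x : ℕ) : List Instr := c.compile 0 0 ++ [.add 0 (2 * x + 4) 2]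

/-- The store in which all variables and arrays are zero. -/
def initStore : Store := ⟨fun _ => 0, fun _ _ => 0⟩

theorem decidesWithin (c : Cmd) (x : ℕ) (w : List ℕ) {t : ℕ} {p : Prop}
    (ht : c.cost w initStore + 1 ≤ t)
    (hp : (p ∧ (c.eval w initStore).var x = 1) ∨ (¬ p ∧ (c.eval w initStore).var x = 0)) :
    DecidesWithin (c.program x) w t p := by
  have hcode : CodeAt (c.program x) 0 (c.program x) := fun i _ => by rw [zero_add]
  obtain ⟨h1, h2⟩ := codeAt_append.1 hcode
  have hs : Sim w initStore (RAMState.start w) := by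
    refine ⟨rfl, rfl, fun x => by simp [RAMState.start, initStore], fun i _ => rfl, fun a i => ?_⟩
    simp only [RAMState.start, initStore, List.getD_eq_getElem?_getD]
    rw [List.getElem?_eq_none (by omega)]; rfl
  obtain ⟨k, hk, hpc, hs'⟩ := (compile_reaches w (c.program x) c 0 0 initStore _ h1 rfl hs).trans
    (t' := 1) (Q' := fun m => (c.program x).length ≤ m.pc ∧
      m.reg 0 = (c.eval w initStore).var x) fun m ⟨hpc, hs', _⟩ => by
      refine .step (I := .add 0 (2 * x + 4) 2) ?_ (.refl ⟨?_, ?_⟩)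
      · rw [hpc, ← length_compile c 0 0]; exact (codeAt_cons.1 h2).1
      · simp [Instr.exec, program, length_compile, hpc]
      · simp [Instr.exec, hs'.var, hs'.zero]
  exact ⟨k, hk.trans ht, _, rfl, hpc, by rwa [hs']⟩

end Cmd

/-! ### Loop programs: cost bounds, frame conditions, loop invariants -/

namespace Cmd

/-- A command without loops. -/
def loopFree : Cmd → Bool
  | rep _ _ => false
  | seq c d | ite _ c d => c.loopFree && d.loopFree
  | _ => true

/-- An upper bound for the cost of a command without loops. -/
def bound : Cmd → ℕ
  | const _ _ | add _ _ _ | sub _ _ _ | len _ => 1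
  | input _ _ => 4
  | get _ _ _ | put _ _ _ => 8
  | seq c d => c.bound + d.bound
  | ite _ c d => 2 + c.bound + d.bound
  | rep _ _ => 0

theorem cost_le_bound {w : List ℕ} {c : Cmd} : ∀ {s : Store}, c.loopFree = true →
    c.cost w s ≤ c.bound := by
  induction c with
  | seq c d hc hd =>
    intro s h
    simp only [loopFree, Bool.and_eq_true] at h
    exact add_le_add (hc h.1) (hd h.2)
  | ite x c d hc hd =>
    intro s h
    simp only [loopFree, Bool.and_eq_true] at h
    have h1 := hc (s := s) h.1
    have h2 := hd (s := s) h.2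
    simp only [cost, bound]
    split_ifs <;> omega
  | rep x c _ => intro s h; simp [loopFree] at h
  | _ => intro s _; exact le_rfl

/-- The command does not write the variables in `xs` and the arrays in `as`. -/
def keeps (xs : List ℕ) (as : List (Fin 16)) : Cmd → Bool
  | const x _ | add x _ _ | sub x _ _ | len x | input x _ | get x _ _ => !xs.contains x
  | put a _ _ => !as.contains a
  | seq c d | ite _ c d => c.keeps xs as && d.keeps xs as
  | rep _ c => c.keeps xs as

theorem eval_keeps {w : List ℕ} {xs : List ℕ} {as : List (Fin 16)} {c : Cmd} :
    ∀ {s : Store}, c.keeps xs as = true →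
      (∀ x ∈ xs, (c.eval w s).var x = s.var x) ∧ ∀ a ∈ as, (c.eval w s).arr a = s.arr a := by
  have hset : ∀ {s : Store} {x v : ℕ}, (!xs.contains x) = true →
      (∀ y ∈ xs, (s.set x v).var y = s.var y) ∧ ∀ a ∈ as, (s.set x v).arr a = s.arr a := by
    intro s x v h
    refine ⟨fun y hy => Function.update_of_ne ?_ _ _, fun _ _ => rfl⟩
    rintro rfl
    simp [hy] at h
  induction c with
  | put a y x =>
    intro s h
    refine ⟨fun _ _ => rfl, fun b hb => Function.update_of_ne ?_ _ _⟩
    rintro rfl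
    simp [keeps, hb] at h
  | seq c d hc hd =>
    intro s h
    simp only [keeps, Bool.and_eq_true] at h
    exact ⟨fun x hx => ((hd h.2).1 x hx).trans ((hc h.1).1 x hx),
      fun a ha => ((hd h.2).2 a ha).trans ((hc h.1).2 a ha)⟩
  | ite x c d hc hd =>
    intro s h
    simp only [keeps, Bool.and_eq_true] at h
    simp only [eval]
    split_ifs
    · exact hd h.2
    · exact hc h.1
  | rep x c hc =>
    intro s h
    simp only [eval]
    induction s.var x with
    | zero => exact ⟨fun _ _ => rfl, fun _ _ => rfl⟩
    | succ n ih =>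
      rw [Function.iterate_succ_apply']
      exact ⟨fun x hx => ((hc h).1 x hx).trans (ih.1 x hx),
        fun a ha => ((hc h).2 a ha).trans (ih.2 a ha)⟩
  | _ => intro s h; exact hset h

/-- The invariant rule for loops, with time. -/
theorem rep_inv {w : List ℕ} {c : Cmd} {x : ℕ} {s : Store} {t N : ℕ} (I : ℕ → Store → Prop)
    (hN : s.var x = N) (h0 : I 0 s)
    (hstep : ∀ i < N, ∀ s', I i s' → I (i + 1) (c.eval w s') ∧ c.cost w s' ≤ t) :
    I N ((rep x c).eval w s) ∧ (rep x c).cost w s ≤ 2 + N * (4 + t) := by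
  subst hN
  have h : ∀ i ≤ s.var x, I i ((c.eval w)^[i] s) := by
    intro i
    induction i with
    | zero => exact fun _ => h0
    | succ i ih =>
      intro hi
      rw [Function.iterate_succ_apply']
      exact (hstep i hi _ (ih (by omega))).1
  refine ⟨h _ le_rfl, ?_⟩
  simp only [cost]
  refine Nat.add_le_add_left ((Finset.sum_le_card_nsmul _ _ (4 + t) fun i hi => ?_).trans ?_) _
  · have hi := Finset.mem_range.1 hi
    have := (hstep i hi _ (h i hi.le)).2
    omega
  · simp

/-- The invariant rule for loops with a loop-free body. -/
theorem rep_inv' {w : List ℕ} {c : Cmd} {x : ℕ} {s : Store} {N : ℕ} (I : ℕ → Store → Prop)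
    (hc : c.loopFree = true) (hN : s.var x = N) (h0 : I 0 s)
    (hstep : ∀ i < N, ∀ s', I i s' → I (i + 1) (c.eval w s')) :
    I N ((rep x c).eval w s) ∧ (rep x c).cost w s ≤ 2 + N * (4 + c.bound) :=
  rep_inv I hN h0 fun i hi s' hs' => ⟨hstep i hi s' hs', cost_le_bound hc⟩

end Cmd

/-! ### The classical algorithm for Büchi games -/

namespace BuchiSolver

open Cmd

/-- A list of commands as one command. -/
def block : List Cmd → Cmd
  | [] => .const 13 0
  | [c] => c
  | c :: l => .seq c (block l)

/-! Variables: 0, 1: the numbers of positions and edges; 2: the initial position; 3: the constant 1;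
4: the loop index; 5: the position in the input; 9: the length of the queue; 10: the number of
positions taken from the queue; 11: the next edge to be processed, plus 1; 12: the number of positions
and edges; 14: the constant 0.
Arrays: 0: player; 1: accepting positions; 2: the number of edges by which a position is attracted;
3: the current winning region; 4: its attractor; 5: counters; 6: queue; 7, 8: the lists of the edges
into a position; 9, 10: the sources and targets of the edges. -/

def resetBody : Cmd := block [.get 6 2 4, .put 5 4 6, .put 4 4 14, .add 4 4 3]

/-- Counters start at the number of edges into a set by which a position is attracted: 1 for player
0 and the out-degree for player 1. After one decrement per edge into the current region, a counter
is zero exactly at the controllable predecessors of that region. -/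
def countBody : Cmd := block [.get 6 10 4, .get 7 3 6,
  .ite 7 (block [.get 6 9 4, .get 7 5 6, .sub 7 7 3, .put 5 6 7]) (block []), .add 4 4 3]

def enqueue (x : ℕ) : Cmd := block [.put 4 x 3, .put 6 9 x, .add 9 9 3]

/-- The accepting positions with counter zero are the seeds of the attractor. Each counter is
restored right after it has been inspected, ready for the attractor computation. -/
def baseBody : Cmd := block [.get 6 1 4, .get 7 5 4,
  .ite 6 (.ite 7 (block []) (enqueue 4)) (block []), .get 6 2 4, .put 5 4 6, .add 4 4 3]

/-- One unit of work: treat the next edge into the position last taken from the queue, or, if there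
is none, take another position. Doing this in a single loop of `n + m` rounds, instead of two nested
loops, makes the linear time bound immediate. -/
def attractBody : Cmd :=
  .ite 11
    (block [.sub 8 11 3, .get 6 9 8, .get 11 8 8, .get 7 5 6,
      .ite 7 (block [.sub 7 7 3, .put 5 6 7,
        .ite 7 (block []) (block [.get 8 4 6, .ite 8 (block []) (enqueue 6)])]) (block [])])
    (block [.sub 7 9 10, .ite 7 (block [.get 6 6 10, .get 11 7 6, .add 10 10 3]) (block [])])

def copyBody : Cmd := block [.get 6 4 4, .put 3 4 6, .add 4 4 3]

/-- One round of the outer iteration, from `Z` to the inner fixpoint for `Z`. -/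
def outerBody : Cmd := block [
  .const 4 0, .rep 0 resetBody,
  .const 4 0, .rep 1 countBody,
  .const 4 0, .const 9 0, .rep 0 baseBody,
  .const 10 0, .const 11 0, .rep 12 attractBody,
  .const 4 0, .rep 0 copyBody]

/-- The pointer `p` is the head of the linked list `l`; pointers are shifted by one. -/
def Chain (nxt : ℕ → ℕ) : ℕ → List ℕ → Prop
  | p, [] => p = 0
  | p, e :: l => p = e + 1 ∧ Chain nxt (nxt e) l

/-- The edges from `v` to members of `X` among those in `E`. -/
noncomputable def edgesInto {n : ℕ} (s₀ : Store) (E : Finset ℕ) (v : ℕ) (X : Set (Fin n)) :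
    Finset ℕ :=
  open Classical in E.filter fun e => s₀.arr 9 e = v ∧ ∃ u ∈ X, s₀.arr 10 e = u

/-- The game with `m` edges has been loaded. -/
structure Loaded {n : ℕ} (G : BuchiGame (Fin n)) (m : ℕ) (s₀ : Store) : Prop where
  var0 : s₀.var 0 = n
  var1 : s₀.var 1 = m
  var2 : s₀.var 2 = G.init
  var3 : s₀.var 3 = 1
  var12 : s₀.var 12 = n + m
  var14 : s₀.var 14 = 0
  acc : ∀ v : Fin n, s₀.arr 1 v ≠ 0 ↔ v ∈ G.accepting
  source : ∀ e < m, s₀.arr 9 e < n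
  target : ∀ e < m, s₀.arr 10 e < n
  chain : ∀ v < n, ∃ l, Chain (s₀.arr 8) (s₀.arr 7 v) l ∧ l.Nodup ∧
    ∀ e, e ∈ l ↔ e < m ∧ s₀.arr 10 e = v
  need_pos : ∀ v : Fin n, 0 < s₀.arr 2 v
  need : ∀ (v : Fin n) (X : Set (Fin n)),
    v ∈ G.cpre X ↔ s₀.arr 2 v ≤ (edgesInto s₀ (Finset.range m) v X).card

/-- The variables and arrays that describe the game. -/
def frameVars : List ℕ := [0, 1, 2, 3, 12, 14]

def frameArrs : List (Fin 16) := [1, 2, 7, 8, 9, 10]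

/-- The data of the game are unchanged. -/
def Frame (s₀ s : Store) : Prop :=
  (∀ x ∈ frameVars, s.var x = s₀.var x) ∧ ∀ a ∈ frameArrs, s.arr a = s₀.arr a

theorem Frame.eval {w : List ℕ} {s₀ s : Store} {c : Cmd} (h : Frame s₀ s)
    (hc : c.keeps frameVars frameArrs = true) : Frame s₀ (c.eval w s) :=
  ⟨fun x hx => ((eval_keeps hc).1 x hx).trans (h.1 x hx),
    fun a ha => ((eval_keeps hc).2 a ha).trans (h.2 a ha)⟩

/-- The invariant rule for loops that keep the data of the game. -/
theorem rep_frame {w : List ℕ} {c : Cmd} {x : ℕ} {s₀ s : Store} {N : ℕ} (I : ℕ → Store → Prop)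
    (hc : c.loopFree = true) (hk : c.keeps frameVars frameArrs = true) (hs : Frame s₀ s)
    (hN : s.var x = N) (h0 : I 0 s)
    (hstep : ∀ i < N, ∀ s', Frame s₀ s' → I i s' → I (i + 1) (c.eval w s')) :
    I N ((Cmd.rep x c).eval w s) ∧ (Cmd.rep x c).cost w s ≤ 2 + N * (4 + c.bound) := by
  have := rep_inv' (w := w) (c := c) (x := x) (s := s) (fun i s => Frame s₀ s ∧ I i s) hc hN
    ⟨hs, h0⟩ fun i hi s' hs' => ⟨hs'.1.eval hk, hstep i hi s' hs'.1 hs'.2⟩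
  exact ⟨this.1.2, this.2⟩

section

variable {n : ℕ} {G : BuchiGame (Fin n)} {m : ℕ} {w : List ℕ} {s₀ s : Store}

theorem card_edgesInto_insert {E : Finset ℕ} {e v : ℕ} {X : Set (Fin n)} (he : e ∉ E) :
    (edgesInto s₀ (insert e E) v X).card = (edgesInto s₀ E v X).card +
      (open Classical in if s₀.arr 9 e = v ∧ ∃ u ∈ X, s₀.arr 10 e = u then 1 else 0) := by
  classical
  unfold edgesInto
  rw [Finset.filter_insert]
  split_ifs
  · rw [Finset.card_insert_of_notMem (by simp [he])]
  · rfl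

theorem reset_spec (hL : Loaded G m s₀) (hs : Frame s₀ s) (h4 : s.var 4 = 0) :
    let s' := (Cmd.rep 0 resetBody).eval w s
    (∀ v < n, s'.arr 5 v = s₀.arr 2 v ∧ s'.arr 4 v = 0) ∧
      (Cmd.rep 0 resetBody).cost w s ≤ 2 + n * (4 + resetBody.bound) := by
  have := rep_frame (w := w) (c := resetBody) (x := 0) (s := s) (N := n)
    (fun i s' => s'.var 4 = i ∧ ∀ v < i, s'.arr 5 v = s₀.arr 2 v ∧ s'.arr 4 v = 0) rfl rfl hs
    ((hs.1 0 (by decide)).trans hL.var0) ⟨h4, by simp⟩ ?_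
  · exact ⟨this.1.2, this.2⟩
  · rintro i hi s' hF ⟨h4, h⟩
    have v3 := (hF.1 3 (by decide)).trans hL.var3
    have v14 := (hF.1 14 (by decide)).trans hL.var14
    have a2 := hF.2 2 (by decide)
    simp only [resetBody, block, Cmd.eval, Store.set, Store.setArr, Function.update_apply]
    simp [h4, v3, v14, a2, Function.update_apply]
    intro v hv
    by_cases hvi : v = i
    · simp [hvi]
    · simpa [hvi] using h v (by omega)

theorem count_spec (hL : Loaded G m s₀) (hs : Frame s₀ s) (h4 : s.var 4 = 0) {Z : Set (Fin n)}
    (hZ : ∀ v : Fin n, s.arr 3 v ≠ 0 ↔ v ∈ Z) (h5 : ∀ v < n, s.arr 5 v = s₀.arr 2 v) :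
    let s' := (Cmd.rep 1 countBody).eval w s
    (∀ v < n, s'.arr 5 v = s₀.arr 2 v - (edgesInto s₀ (Finset.range m) v Z).card) ∧
      (Cmd.rep 1 countBody).cost w s ≤ 2 + m * (4 + countBody.bound) := by
  have := rep_frame (w := w) (c := countBody) (x := 1) (s := s) (N := m)
    (fun i s' => s'.var 4 = i ∧ s'.arr 3 = s.arr 3 ∧
      ∀ v < n, s'.arr 5 v = s₀.arr 2 v - (edgesInto s₀ (Finset.range i) v Z).card) rfl rfl hs
    ((hs.1 1 (by decide)).trans hL.var1) ⟨h4, rfl, fun v hv => by simp [edgesInto, h5 v hv]⟩ ?_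
  · exact ⟨this.1.2.2, this.2⟩
  · rintro i hi s' hF ⟨h4, h3, h⟩
    have v3 := (hF.1 3 (by decide)).trans hL.var3
    have a9 := hF.2 9 (by decide)
    have a10 := hF.2 10 (by decide)
    have hmem : s.arr 3 (s₀.arr 10 i) ≠ 0 ↔ ∃ u ∈ Z, s₀.arr 10 i = u := by
      rw [hZ ⟨_, hL.target i hi⟩]
      constructor
      · exact fun h => ⟨_, h, rfl⟩
      · rintro ⟨u, hu, e⟩
        have : u = ⟨_, hL.target i hi⟩ := Fin.ext e.symm
        rwa [← this]
    refine ⟨?_, ?_, fun v hv => ?_⟩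
    · by_cases hc : s.arr 3 (s₀.arr 10 i) = 0 <;>
        simp [countBody, block, Cmd.eval, Store.set, Store.setArr, h4, v3, a10, h3, hc]
    · by_cases hc : s.arr 3 (s₀.arr 10 i) = 0 <;>
        simp [countBody, block, Cmd.eval, Store.set, Store.setArr, h4, a10, h3, hc]
    · rw [Finset.range_add_one, card_edgesInto_insert Finset.notMem_range_self]
      simp only [countBody, block, Cmd.eval, Store.set, Store.setArr]
      by_cases hc : s.arr 3 (s₀.arr 10 i) = 0
      · have : ¬ (s₀.arr 9 i = v ∧ ∃ u ∈ Z, s₀.arr 10 i = u) := fun h' => hmem.2 h'.2 hc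
        simp [h4, a10, h3, hc, this, h v hv]
      · have h' := hmem.1 hc
        simp only [h', and_true]
        simp [h4, v3, a9, a10, h3, hc, Function.update_apply]
        by_cases hv' : s₀.arr 9 i = v
        · simp [hv', h v hv]; omega
        · simp [hv', Ne.symm hv', h v hv]

/-- The queue in the array 6 is the list `qs`. -/
def Queue (s : Store) (qs : List ℕ) : Prop :=
  s.var 9 = qs.length ∧ ∀ j v, qs[j]? = some v → s.arr 6 j = v

theorem Queue.concat {s s' : Store} {qs : List ℕ} {v : ℕ} (h : Queue s qs)
    (h9 : s'.var 9 = s.var 9 + 1) (h6 : s'.arr 6 = Function.update (s.arr 6) (s.var 9) v) :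
    Queue s' (qs ++ [v]) := by
  refine ⟨by rw [h9, h.1]; simp, fun j u hj => ?_⟩
  rw [h6, h.1, Function.update_apply]
  split_ifs with hjl
  · subst hjl; simpa using hj
  · have hj' : j < (qs ++ [v]).length := (List.getElem?_eq_some_iff.1 hj).1
    rw [List.length_append, List.length_singleton] at hj'
    rw [List.getElem?_append_left (by omega)] at hj
    exact h.2 j u hj

theorem Queue.congr {s s' : Store} {qs : List ℕ} (h : Queue s qs)
    (h9 : s'.var 9 = s.var 9) (h6 : s'.arr 6 = s.arr 6) : Queue s' qs :=
  ⟨h9.trans h.1, by rw [h6]; exact h.2⟩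

/-- The counter of a position is overwritten only in its own round, after the test. So in round `i`
the counters below `i` are the restored ones and the others are still those of the preceding count.
-/
theorem base_spec (hL : Loaded G m s₀) (hs : Frame s₀ s) (h4 : s.var 4 = 0) (h9 : s.var 9 = 0)
    (hA : ∀ v < n, s.arr 4 v = 0) :
    let s' := (Cmd.rep 0 baseBody).eval w s
    (∃ qs : List ℕ, qs.Nodup ∧ Queue s' qs ∧
      (∀ v, v ∈ qs ↔ v < n ∧ s₀.arr 1 v ≠ 0 ∧ s.arr 5 v = 0) ∧
      (∀ v < n, s'.arr 4 v ≠ 0 ↔ v ∈ qs) ∧ ∀ v < n, s'.arr 5 v = s₀.arr 2 v) ∧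
      (Cmd.rep 0 baseBody).cost w s ≤ 2 + n * (4 + baseBody.bound) := by
  have := rep_frame (w := w) (c := baseBody) (x := 0) (s := s) (N := n)
    (fun i s' => s'.var 4 = i ∧ ∃ qs : List ℕ, qs.Nodup ∧ Queue s' qs ∧
      (∀ v, v ∈ qs ↔ v < i ∧ s₀.arr 1 v ≠ 0 ∧ s.arr 5 v = 0) ∧
      (∀ v < n, s'.arr 4 v ≠ 0 ↔ v ∈ qs) ∧ ∀ v < n, s'.arr 5 v =
        if v < i then s₀.arr 2 v else s.arr 5 v) rfl rfl hs
    ((hs.1 0 (by decide)).trans hL.var0) ⟨h4, [], by simp, ⟨by simpa using h9, by simp⟩, by simp,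
      fun v hv => by simp [hA v hv], by simp⟩ ?_
  · obtain ⟨⟨_, qs, h1, h2, h3, h4, h5⟩, h6⟩ := this
    exact ⟨⟨qs, h1, h2, h3, h4, fun v hv => by rw [h5 v hv, if_pos hv]⟩, h6⟩
  · rintro i hi s' hF ⟨h4, qs, hnd, hQ, hqs, hA, h5⟩
    have v3 := (hF.1 3 (by decide)).trans hL.var3
    have a1 := hF.2 1 (by decide)
    have a2 := hF.2 2 (by decide)
    have h5i : s'.arr 5 i = s.arr 5 i := by rw [h5 i hi, if_neg (lt_irrefl _)]
    have h5' : ∀ v < n, Function.update (s'.arr 5) i (s₀.arr 2 i) v =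
        if v < i + 1 then s₀.arr 2 v else s.arr 5 v := by
      intro v hv
      rw [Function.update_apply]
      split_ifs with h h' h'
      · rw [h]
      · omega
      · rw [h5 v hv, if_pos (by omega)]
      · rw [h5 v hv, if_neg (by omega)]
    by_cases hB : s₀.arr 1 i ≠ 0 ∧ s.arr 5 i = 0
    · have hi' : i ∉ qs := fun h => absurd ((hqs i).1 h).1 (lt_irrefl _)
      refine ⟨?_, qs ++ [i], ?_, hQ.concat (v := i) ?_ ?_, fun v => ?_, fun v hv => ?_, ?_⟩
      · simp [baseBody, enqueue, block, Cmd.eval, Store.set, Store.setArr, h4, v3, a1, hB, h5i]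
      · rw [List.nodup_append]
        refine ⟨hnd, by simp, ?_⟩
        intro a ha b hb
        rw [List.mem_singleton.1 hb]
        rintro rfl; exact hi' ha
      · simp [baseBody, enqueue, block, Cmd.eval, Store.set, Store.setArr, h4, v3, a1, hB, h5i]
      · simp [baseBody, enqueue, block, Cmd.eval, Store.set, Store.setArr, h4, v3, a1, hB, h5i]
      · rw [List.mem_append, hqs, List.mem_singleton]
        constructor
        · rintro (h | rfl)
          · exact ⟨by omega, h.2⟩
          · exact ⟨by omega, hB⟩
        · rintro ⟨h, h'⟩
          by_cases hv : v = i
          · exact Or.inr hv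
          · exact Or.inl ⟨by omega, h'⟩
      · simp [baseBody, enqueue, block, Cmd.eval, Store.set, Store.setArr, h4, v3, a1, hB, h5i,
          Function.update_apply]
        by_cases hvi : v = i
        · simp [hvi]
        · simpa [hvi] using hA v hv
      · simpa [baseBody, enqueue, block, Cmd.eval, Store.set, Store.setArr, h4, v3, a1, a2, hB, h5i]
          using h5'
    · have hcase : baseBody.eval w s' =
          ⟨Function.update (Function.update (Function.update (Function.update (Function.update
            s'.var 6 (s₀.arr 1 i)) 7 (s.arr 5 i)) 13 0) 6 (s₀.arr 2 i)) 4 (i + 1),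
            Function.update s'.arr 5 (Function.update (s'.arr 5) i (s₀.arr 2 i))⟩ := by
        by_cases h1 : s₀.arr 1 i = 0
        · simp [baseBody, enqueue, block, Cmd.eval, Store.set, Store.setArr, h4, v3, a1, a2, h1,
            h5i]
        · have h2 : s.arr 5 i ≠ 0 := fun h => hB ⟨h1, h⟩
          simp [baseBody, enqueue, block, Cmd.eval, Store.set, Store.setArr, h4, v3, a1, a2, h1,
            h5i, h2]
      rw [hcase]
      refine ⟨by simp, qs, hnd, hQ.congr (by simp) (by simp), fun v => ?_,
        fun v hv => by simpa using hA v hv, by simpa using h5'⟩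
      rw [hqs]
      constructor
      · rintro ⟨h, h'⟩; exact ⟨by omega, h'⟩
      · rintro ⟨h, h'⟩
        refine ⟨lt_of_le_of_ne (by omega) ?_, h'⟩
        rintro rfl; exact hB h'

/-- The invariant of the attractor computation: `qs` is the queue, `q` the number of positions taken
from it, `l` the list of the remaining edges into the last one of these, and `pr` the set of edges
processed so far. -/
structure AttractInv (G : BuchiGame (Fin n)) (m : ℕ) (s₀ : Store) (Z : Set (Fin n)) (qs l : List ℕ)
    (pr : Finset ℕ) (s : Store) : Prop where
  nodup : qs.Nodup
  lt : ∀ v ∈ qs, v < n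
  queue : Queue s qs
  le : s.var 10 ≤ qs.length
  chain : Chain (s₀.arr 8) (s.var 11) l
  nodup_rest : l.Nodup
  rest : ∀ e ∈ l, e < m ∧ s₀.arr 10 e ∈ qs.take (s.var 10)
  processed : ∀ e, e ∈ pr ↔ e < m ∧ s₀.arr 10 e ∈ qs.take (s.var 10) ∧ e ∉ l
  mem : ∀ v < n, s.arr 4 v ≠ 0 ↔ v ∈ qs
  count : ∀ v < n, s.arr 5 v = s₀.arr 2 v - (pr.filter fun e => s₀.arr 9 e = v).card
  mem_iff : ∀ v : Fin n, v.1 ∈ qs ↔ (v ∈ G.accepting ∧ v ∈ G.cpre Z) ∨ s.arr 5 v = 0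
  sound : ∀ Y : Set (Fin n), G.op Z Y ⊆ Y → ∀ v : Fin n, v.1 ∈ qs → v ∈ Y

theorem AttractInv.processed_subset {Z : Set (Fin n)} {qs l : List ℕ} {pr : Finset ℕ}
    (h : AttractInv G m s₀ Z qs l pr s) : pr ⊆ Finset.range m := fun e he =>
  Finset.mem_range.2 ((h.processed e).1 he).1

/-- All edges into the new position become the list of remaining edges, so the set of processed
edges stays the same. None of them had been processed before, because the queue has no repetitions.
-/
theorem AttractInv.pop {Z : Set (Fin n)} {qs l : List ℕ} {pr : Finset ℕ} (hL : Loaded G m s₀)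
    (hF : Frame s₀ s) (h : AttractInv G m s₀ Z qs l pr s) (h11 : s.var 11 = 0)
    (hq : s.var 10 < qs.length) :
    ∃ l', AttractInv G m s₀ Z qs l' pr (attractBody.eval w s) ∧
      (attractBody.eval w s).var 10 = s.var 10 + 1 := by
  have v3 := (hF.1 3 (by decide)).trans hL.var3
  have a7 := hF.2 7 (by decide)
  have hl : l = [] := by
    have := h.chain
    cases l with
    | nil => rfl
    | cons e l => have := this.1; omega
  subst hl
  have hv := h.queue.2 _ _ (List.getElem?_eq_getElem hq)
  set v := qs[s.var 10] with hvdef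
  have hvq : v ∈ qs := List.getElem_mem hq
  have hvn := h.lt v hvq
  obtain ⟨l', hc, hnd, hl'⟩ := hL.chain v hvn
  have hne : qs.length - s.var 10 ≠ 0 := by omega
  have htake : qs.take (s.var 10 + 1) = qs.take (s.var 10) ++ [v] := by
    rw [List.take_succ_eq_append_getElem hq]
  have hvt : v ∉ qs.take (s.var 10) := by
    have := h.nodup.sublist (List.take_sublist (s.var 10 + 1) qs)
    rw [htake, List.nodup_append] at this
    exact fun hm => this.2.2 v hm v (by simp) rfl
  have e : attractBody.eval w s = ⟨Function.update (Function.update (Function.update (Function.update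
      s.var 7 (qs.length - s.var 10)) 6 v) 11 (s₀.arr 7 v)) 10 (s.var 10 + 1), s.arr⟩ := by
    simp [attractBody, block, Cmd.eval, Store.set, h11, h.queue.1, hne, hv, v3, a7]
  rw [e]
  refine ⟨l', ⟨h.nodup, h.lt, h.queue.congr (by simp) (by simp), by simpa using hq, by simpa using hc,
    hnd, fun e he => ?_, fun e => ?_, h.mem, h.count, h.mem_iff, h.sound⟩, by simp⟩
  · obtain ⟨h1, h2⟩ := (hl' e).1 he
    refine ⟨h1, ?_⟩
    simp [htake, h2]
  · rw [h.processed, hl']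
    simp only [Function.update_self, htake, List.mem_append, List.mem_singleton]
    constructor
    · rintro ⟨h1, h2, -⟩
      exact ⟨h1, Or.inl h2, fun h' => hvt (h'.2 ▸ h2)⟩
    · rintro ⟨h1, h2 | h2, h3⟩
      · exact ⟨h1, h2, by simp⟩
      · exact absurd ⟨h1, h2⟩ h3

theorem attract_edge_eval (hL : Loaded G m s₀) (hF : Frame s₀ s) {e : ℕ} (h11 : s.var 11 = e + 1) :
    let s' := attractBody.eval w s
    s'.var 10 = s.var 10 ∧ s'.var 11 = s₀.arr 8 e ∧
    s'.arr 5 = Function.update (s.arr 5) (s₀.arr 9 e) (s.arr 5 (s₀.arr 9 e) - 1) ∧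
    ((s.arr 5 (s₀.arr 9 e) = 1 ∧ s.arr 4 (s₀.arr 9 e) = 0 ∧
        s'.arr 4 = Function.update (s.arr 4) (s₀.arr 9 e) 1 ∧ s'.var 9 = s.var 9 + 1 ∧
        s'.arr 6 = Function.update (s.arr 6) (s.var 9) (s₀.arr 9 e)) ∨
      (¬ (s.arr 5 (s₀.arr 9 e) = 1 ∧ s.arr 4 (s₀.arr 9 e) = 0) ∧
        s'.arr 4 = s.arr 4 ∧ s'.var 9 = s.var 9 ∧ s'.arr 6 = s.arr 6)) := by
  have v3 := (hF.1 3 (by decide)).trans hL.var3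
  have a8 := hF.2 8 (by decide)
  have a9 := hF.2 9 (by decide)
  by_cases hc : s.arr 5 (s₀.arr 9 e) = 0
  · simp [attractBody, block, Cmd.eval, Store.set, h11, v3, a8, a9, hc]
  · by_cases hc1 : s.arr 5 (s₀.arr 9 e) = 1
    · by_cases hA : s.arr 4 (s₀.arr 9 e) = 0
      · simp [attractBody, enqueue, block, Cmd.eval, Store.set, Store.setArr, h11, v3, a8, a9, hc1, hA]
      · simp [attractBody, enqueue, block, Cmd.eval, Store.set, Store.setArr, h11, v3, a8, a9, hc1, hA]
    · have hc2 : s.arr 5 (s₀.arr 9 e) - 1 ≠ 0 := by omega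
      simp [attractBody, enqueue, block, Cmd.eval, Store.set, Store.setArr, h11, v3, a8, a9, hc, hc1,
        hc2]

/-- The counter of the source of the edge is decremented. When it falls from 1 to 0, enough edges of
the source lead into the queue; by the invariant they lead into every set closed under the operator,
so such a set contains the source too. This is what justifies putting the source into the queue. -/
theorem AttractInv.edge {Z : Set (Fin n)} {qs l : List ℕ} {pr : Finset ℕ} (hL : Loaded G m s₀)
    (hF : Frame s₀ s) (h : AttractInv G m s₀ Z qs l pr s) (h11 : s.var 11 ≠ 0) :
    ∃ qs' l' pr', AttractInv G m s₀ Z qs' l' pr' (attractBody.eval w s) ∧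
      pr'.card = pr.card + 1 ∧ (attractBody.eval w s).var 10 = s.var 10 := by
  obtain ⟨e, l', rfl, he, hc⟩ : ∃ e l', l = e :: l' ∧ s.var 11 = e + 1 ∧
      Chain (s₀.arr 8) (s₀.arr 8 e) l' := by
    have := h.chain
    cases l with
    | nil => exact absurd this h11
    | cons e l => exact ⟨e, l, rfl, this.1, this.2⟩
  obtain ⟨h10, h11', h5, hcase⟩ := attract_edge_eval (w := w) hL hF he
  set s' := attractBody.eval w s
  obtain ⟨hem, het⟩ := h.rest e (by simp)
  have hσ := hL.source e hem
  set σ := s₀.arr 9 e with hσdef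
  have hepr : e ∉ pr := fun hp => ((h.processed e).1 hp).2.2 (by simp)
  have hel : e ∉ l' := (List.nodup_cons.1 h.nodup_rest).1
  have hcount : ∀ v < n, s'.arr 5 v =
      s₀.arr 2 v - ((insert e pr).filter fun e => s₀.arr 9 e = v).card := by
    intro v hv
    rw [h5, Finset.filter_insert, Function.update_apply]
    by_cases hvσ : v = σ
    · rw [if_pos hvσ, if_pos hvσ.symm, Finset.card_insert_of_notMem (by simp [hepr]), hvσ,
        h.count σ hσ]
      omega
    · rw [if_neg hvσ, if_neg (Ne.symm hvσ), h.count v hv]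
  -- the invariant for the new queue
  have main : ∀ qs' : List ℕ, (∀ k ≤ qs.length, qs'.take k = qs.take k) → qs.length ≤ qs'.length →
      qs'.Nodup → (∀ v ∈ qs', v < n) → Queue s' qs' → (∀ v < n, s'.arr 4 v ≠ 0 ↔ v ∈ qs') →
      (∀ v : Fin n, v.1 ∈ qs' ↔ (v ∈ G.accepting ∧ v ∈ G.cpre Z) ∨ s'.arr 5 v = 0) →
      (∀ Y : Set (Fin n), G.op Z Y ⊆ Y → ∀ v : Fin n, v.1 ∈ qs' → v ∈ Y) →
      ∃ qs' l' pr', AttractInv G m s₀ Z qs' l' pr' s' ∧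
        pr'.card = pr.card + 1 ∧ s'.var 10 = s.var 10 := by
    intro qs' ht hlen hnd hlt hQ hmem hiff hsound
    refine ⟨qs', l', insert e pr, ⟨hnd, hlt, hQ, by rw [h10]; exact h.le.trans hlen, by rwa [h11'],
      (List.nodup_cons.1 h.nodup_rest).2, fun f hf => ?_, fun f => ?_, hmem, hcount, hiff, hsound⟩,
      Finset.card_insert_of_notMem hepr, h10⟩
    · rw [h10, ht _ h.le]; exact h.rest f (List.mem_cons_of_mem _ hf)
    · rw [h10, ht _ h.le, Finset.mem_insert, h.processed]
      by_cases hfe : f = e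
      · subst hfe; simp [hem, het, hel]
      · simp [hfe]
  have h5σ : s'.arr 5 σ = s.arr 5 σ - 1 := by rw [h5, Function.update_self]
  have h5v : ∀ v, v ≠ σ → s'.arr 5 v = s.arr 5 v := fun v hv => by
    rw [h5, Function.update_of_ne hv]
  rcases hcase with ⟨hc1, hA, hA', h9, h6⟩ | ⟨hn, hA', h9, h6⟩
  · have hσq : σ ∉ qs := fun hq => (h.mem σ hσ).2 hq hA
    refine main (qs ++ [σ]) (fun k hk => List.take_append_of_le_length hk) (by simp) ?_ ?_
      (h.queue.concat h9 h6) ?_ ?_ ?_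
    · rw [List.nodup_append]
      refine ⟨h.nodup, by simp, ?_⟩
      intro a ha b hb
      rw [List.mem_singleton.1 hb]
      rintro rfl; exact hσq ha
    · intro v hv
      rcases List.mem_append.1 hv with hv | hv
      · exact h.lt v hv
      · rw [List.mem_singleton.1 hv]; exact hσ
    · intro v hv
      rw [hA', Function.update_apply, List.mem_append, List.mem_singleton]
      by_cases hvσ : v = σ
      · simp [hvσ]
      · simpa [hvσ] using h.mem v hv
    · intro v
      rw [List.mem_append, List.mem_singleton]
      by_cases hvσ : v.1 = σ
      · simp [hvσ, h5σ, hc1]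
      · rw [h5v _ hvσ, ← h.mem_iff v]; simp [hvσ]
    · intro Y hY v hv
      rcases List.mem_append.1 hv with hv | hv
      · exact h.sound Y hY v hv
      · have hvσ : v.1 = σ := List.mem_singleton.1 hv
        apply hY
        right
        rw [hL.need]
        have h0 := hcount σ hσ
        rw [h5σ, hc1] at h0
        rw [hvσ]
        refine (Nat.sub_eq_zero_iff_le.1 h0.symm).trans (Finset.card_le_card fun f hf => ?_)
        obtain ⟨hf1, hf2⟩ := Finset.mem_filter.1 hf
        have hf3 : f < m ∧ s₀.arr 10 f ∈ qs := by
          rcases Finset.mem_insert.1 hf1 with rfl | hf1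
          · exact ⟨hem, List.mem_of_mem_take het⟩
          · have := (h.processed f).1 hf1
            exact ⟨this.1, List.mem_of_mem_take this.2.1⟩
        simp only [edgesInto, Finset.mem_filter, Finset.mem_range]
        exact ⟨hf3.1, hf2, ⟨_, hL.target f hf3.1⟩, h.sound Y hY _ hf3.2, rfl⟩
  · refine main qs (fun _ _ => rfl) le_rfl h.nodup h.lt (h.queue.congr h9 h6)
      (by rw [hA']; exact h.mem) (fun v => ?_) h.sound
    by_cases hvσ : v.1 = σ
    -- A position already in the queue, such as a seed, may still have its counter reach zero; it
    -- must not be entered a second time.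
    · by_cases hc1 : s.arr 5 σ = 1
      · have hq : σ ∈ qs := (h.mem σ hσ).1 fun h0 => hn ⟨hc1, h0⟩
        simp [hvσ, hq, h5σ, hc1]
      · rw [h.mem_iff, hvσ, h5σ]
        have : s.arr 5 σ = 0 ↔ s.arr 5 σ - 1 = 0 := by omega
        rw [this]
    · rw [h5v _ hvσ, h.mem_iff v]

/-- Until the work is done, each round either processes one more edge or takes one more position.
There are at most `m` and `n` of these, so `n + m` rounds are enough. At the end all edges into the
queue have been processed, hence the queue is closed under the operator, and `sound` makes it the
least such set. -/
theorem attract_spec (hL : Loaded G m s₀) (hs : Frame s₀ s) {Z : Set (Fin n)} {qs : List ℕ}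
    (h : AttractInv G m s₀ Z qs [] ∅ s) (h10 : s.var 10 = 0) :
    let s' := (Cmd.rep 12 attractBody).eval w s
    (∀ v : Fin n, s'.arr 4 v ≠ 0 ↔ v ∈ NestedFix.inner G.op n Z) ∧
      (Cmd.rep 12 attractBody).cost w s ≤ 2 + (n + m) * (4 + attractBody.bound) := by
  have := rep_frame (w := w) (c := attractBody) (x := 12) (s := s) (N := n + m)
    (fun i s' => ∃ qs l pr, AttractInv G m s₀ Z qs l pr s' ∧
      (pr.card + s'.var 10 = i ∨ (s'.var 11 = 0 ∧ s'.var 10 = qs.length))) rfl rfl hs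
    ((hs.1 12 (by decide)).trans hL.var12) ⟨qs, [], ∅, h, Or.inl (by simpa using h10)⟩ ?_
  · obtain ⟨⟨qs, l, pr, h, hp⟩, hcost⟩ := this
    refine ⟨fun v => ?_, hcost⟩
    set s' := (Cmd.rep 12 attractBody).eval w s
    have hqs : qs.length ≤ n := by
      have := (List.nodup_iff_injective_get.1 h.nodup)
      have h1 : qs.toFinset ⊆ Finset.range n := fun v hv =>
        Finset.mem_range.2 (h.lt v (List.mem_toFinset.1 hv))
      have h2 := Finset.card_le_card h1
      rwa [List.toFinset_card_of_nodup h.nodup, Finset.card_range] at h2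
    have hle := h.le
    have hdone : l = [] ∧ s'.var 10 = qs.length := by
      have hl : s'.var 11 = 0 → l = [] := by
        have := h.chain
        cases l with
        | nil => exact fun _ => rfl
        | cons e l => have := this.1; omega
      rcases hp with hp | hp
      · have hpr := Finset.card_le_card h.processed_subset
        rw [Finset.card_range] at hpr
        refine ⟨?_, by omega⟩
        rcases l with - | ⟨e, l⟩
        · rfl
        · exfalso
          have he := h.rest e (by simp)
          have := Finset.eq_of_subset_of_card_le h.processed_subset (by rw [Finset.card_range]; omega)
          have he' : e ∈ pr := by rw [this]; exact Finset.mem_range.2 he.1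
          exact ((h.processed e).1 he').2.2 (by simp)
      · exact ⟨hl hp.1, hp.2⟩
    obtain ⟨rfl, hq⟩ := hdone
    have hpr : ∀ e, e ∈ pr ↔ e < m ∧ s₀.arr 10 e ∈ qs := by
      intro e; rw [h.processed, hq, List.take_length]; simp
    have heq : {v : Fin n | v.1 ∈ qs} = NestedFix.inner G.op n Z := by
      refine NestedFix.inner_eq G.op_mono (by simp) ?_ fun Y hY v hv => h.sound Y hY v hv
      rintro v (hv | hv)
      · exact (h.mem_iff v).2 (Or.inl hv)
      · refine (h.mem_iff v).2 (Or.inr ?_)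
        rw [hL.need] at hv
        rw [h.count v v.2, Nat.sub_eq_zero_iff_le]
        refine hv.trans (Finset.card_le_card fun e he => ?_)
        simp only [edgesInto, Finset.mem_filter, Finset.mem_range] at he ⊢
        obtain ⟨h1, h2, u, hu, h3⟩ := he
        exact ⟨(hpr e).2 ⟨h1, by rw [h3]; exact hu⟩, h2⟩
    rw [h.mem v v.2, ← heq]; rfl
  · rintro i hi s' hF ⟨qs, l, pr, h, hp⟩
    by_cases h11 : s'.var 11 = 0
    · by_cases hq : s'.var 10 < qs.length
      · obtain ⟨l', h', h1⟩ := h.pop (w := w) hL hF h11 hq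
        refine ⟨qs, l', pr, h', Or.inl ?_⟩
        rw [h1]; omega
      · have hq' : s'.var 10 = qs.length := le_antisymm h.le (not_lt.1 hq)
        have e : attractBody.eval w s' =
            ⟨Function.update (Function.update s'.var 7 0) 13 0, s'.arr⟩ := by
          simp [attractBody, block, Cmd.eval, Store.set, h11, h.queue.1, hq']
        rw [e]
        refine ⟨qs, l, pr, ⟨h.nodup, h.lt, h.queue.congr (by simp) (by simp), by simpa using h.le,
          by simpa using h.chain, h.nodup_rest, by simpa using h.rest, by simpa using h.processed,
          h.mem, h.count, h.mem_iff, h.sound⟩, Or.inr (by simp [h11, hq'])⟩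
    · obtain ⟨qs', l', pr', h', h1, h2⟩ := h.edge (w := w) hL hF h11
      refine ⟨qs', l', pr', h', Or.inl ?_⟩
      rw [h1, h2]
      rcases hp with hp | hp
      · omega
      · exact absurd hp.1 h11

theorem copy_spec (hL : Loaded G m s₀) (hs : Frame s₀ s) (h4 : s.var 4 = 0) :
    let s' := (Cmd.rep 0 copyBody).eval w s
    (∀ v < n, s'.arr 3 v = s.arr 4 v) ∧
      (Cmd.rep 0 copyBody).cost w s ≤ 2 + n * (4 + copyBody.bound) := by
  have := rep_frame (w := w) (c := copyBody) (x := 0) (s := s) (N := n)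
    (fun i s' => s'.var 4 = i ∧ s'.arr 4 = s.arr 4 ∧ ∀ v < i, s'.arr 3 v = s.arr 4 v) rfl rfl hs
    ((hs.1 0 (by decide)).trans hL.var0) ⟨h4, rfl, by simp⟩ ?_
  · exact ⟨this.1.2.2, this.2⟩
  · rintro i hi s' hF ⟨h4, ha, h⟩
    have v3 := (hF.1 3 (by decide)).trans hL.var3
    simp [copyBody, block, Cmd.eval, Store.set, Store.setArr, h4, v3, ha, Function.update_apply]
    intro v hv
    by_cases hvi : v = i
    · simp [hvi]
    · simpa [hvi] using h v (by omega)

theorem outer_spec (hL : Loaded G m s₀) (hs : Frame s₀ s) {Z : Set (Fin n)}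
    (hZ : ∀ v : Fin n, s.arr 3 v ≠ 0 ↔ v ∈ Z) :
    let s' := outerBody.eval w s
    (∀ v : Fin n, s'.arr 3 v ≠ 0 ↔ v ∈ NestedFix.inner G.op n Z) ∧
      outerBody.cost w s ≤ 500 * (n + m) + 50 := by
  have hset : ∀ {s : Store} {x v : ℕ}, Frame s₀ s → (Cmd.const x v).keeps frameVars frameArrs = true →
      Frame s₀ (s.set x v) := fun h hk => h.eval (w := w) (c := .const _ _) hk
  have f1 : Frame s₀ (s.set 4 0) := hset hs rfl
  obtain ⟨r1, c1⟩ := reset_spec (w := w) hL f1 rfl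
  have k1 := (eval_keeps (w := w) (xs := []) (as := [3]) (c := Cmd.rep 0 resetBody)
    (s := s.set 4 0) rfl).2 3 (by simp)
  have f2 := f1.eval (w := w) (c := Cmd.rep 0 resetBody) rfl
  set s2 := (Cmd.rep 0 resetBody).eval w (s.set 4 0) with hs2
  have f3 : Frame s₀ (s2.set 4 0) := hset f2 rfl
  obtain ⟨r2, c2⟩ := count_spec (w := w) hL f3 rfl (Z := Z) (by
    intro v
    change s2.arr 3 v ≠ 0 ↔ _
    rw [k1]; exact hZ v) fun v hv => (r1 v hv).1
  have k2 := (eval_keeps (w := w) (xs := []) (as := [4]) (c := Cmd.rep 1 countBody)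
    (s := s2.set 4 0) rfl).2 4 (by simp)
  have f4 := f3.eval (w := w) (c := Cmd.rep 1 countBody) rfl
  set s4 := (Cmd.rep 1 countBody).eval w (s2.set 4 0) with hs4
  have f5 : Frame s₀ ((s4.set 4 0).set 9 0) := hset (hset f4 rfl) rfl
  obtain ⟨⟨qs, hnd, hQ, hqs, hmem, h5⟩, c3⟩ := base_spec (w := w) hL f5 rfl rfl fun v hv => by
    change s4.arr 4 v = 0
    rw [k2]; exact (r1 v hv).2
  have f6 := f5.eval (w := w) (c := Cmd.rep 0 baseBody) rfl
  set s6 := (Cmd.rep 0 baseBody).eval w ((s4.set 4 0).set 9 0) with hs6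
  have f7 : Frame s₀ ((s6.set 10 0).set 11 0) := hset (hset f6 rfl) rfl
  -- The counters were lowered by the numbers of edges into `Z`, with truncated subtraction; a zero
  -- thus says that the threshold for `cpre Z` has been reached.
  have hbase : ∀ v : Fin n, v.1 ∈ qs ↔ v ∈ G.accepting ∧ v ∈ G.cpre Z := by
    intro v
    rw [hqs, hL.acc, hL.need]
    change v.1 < n ∧ _ ∧ s4.arr 5 v = 0 ↔ _
    rw [r2 v v.2, Nat.sub_eq_zero_iff_le]
    simp [v.2]
  obtain ⟨r4, c4⟩ := attract_spec (w := w) hL f7 (Z := Z) (qs := qs) ⟨hnd, fun v hv => ((hqs v).1 hv).1,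
    hQ.congr rfl rfl, Nat.zero_le _, rfl, List.nodup_nil, by simp, by simp [Store.set], hmem,
    fun v hv => by rw [Finset.filter_empty]; exact h5 v hv, fun v => by
      change _ ↔ _ ∨ s6.arr 5 v = 0
      rw [h5 v v.2, hbase]
      simp [(hL.need_pos v).ne'], fun Y hY v hv => hY (Or.inl ((hbase v).1 hv))⟩ rfl
  have f8 := f7.eval (w := w) (c := Cmd.rep 12 attractBody) rfl
  set s8 := (Cmd.rep 12 attractBody).eval w ((s6.set 10 0).set 11 0) with hs8
  have f9 : Frame s₀ (s8.set 4 0) := hset f8 rfl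
  obtain ⟨r5, c5⟩ := copy_spec (w := w) hL f9 rfl
  have he : outerBody.eval w s = (Cmd.rep 0 copyBody).eval w (s8.set 4 0) := by
    simp only [outerBody, block, Cmd.eval, hs2, hs4, hs6, hs8]
  refine ⟨fun v => ?_, ?_⟩
  · rw [he, r5 v v.2]; exact r4 v
  · have hc : outerBody.cost w s = 1 + ((Cmd.rep 0 resetBody).cost w (s.set 4 0) + (1 +
        ((Cmd.rep 1 countBody).cost w (s2.set 4 0) + (1 + (1 +
        ((Cmd.rep 0 baseBody).cost w ((s4.set 4 0).set 9 0) + (1 + (1 +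
        ((Cmd.rep 12 attractBody).cost w ((s6.set 10 0).set 11 0) + (1 +
        (Cmd.rep 0 copyBody).cost w (s8.set 4 0))))))))))) := rfl
    have b1 : resetBody.bound ≤ 50 := by decide
    have b2 : countBody.bound ≤ 100 := by decide
    have b3 : baseBody.bound ≤ 100 := by decide
    have b4 : attractBody.bound ≤ 150 := by decide
    have b5 : copyBody.bound ≤ 50 := by decide
    rw [hc]
    have := Nat.mul_le_mul_left n (Nat.add_le_add_left b1 4)
    have := Nat.mul_le_mul_left m (Nat.add_le_add_left b2 4)
    have := Nat.mul_le_mul_left n (Nat.add_le_add_left b3 4)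
    have := Nat.mul_le_mul_left (n + m) (Nat.add_le_add_left b4 4)
    have := Nat.mul_le_mul_left n (Nat.add_le_add_left b5 4)
    omega

end

end BuchiSolver

/-! ### Loading the game from the input; running time of the solver -/

namespace BuchiSolver

open Cmd

/-- The player bit goes into array 0 and also into array 2, where it is already the right threshold
1 for player 0 and the start value 0 of the out-degree for player 1. Array 3 is filled with ones
since the outer iteration starts with all positions. -/
def loadPosition : Cmd := block [.input 6 5, .put 2 4 6, .put 0 4 6, .add 7 5 0, .input 8 7,
  .put 1 4 8, .put 3 4 3, .add 5 5 3, .add 4 4 3]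

/-- Only for sources of player 1 the out-degree is counted in array 2. The edge becomes the new head
of the list of its target; the index is increased before it is stored as head, since heads are
shifted by one and 0 stands for the empty list. -/
def loadEdge : Cmd := block [.input 6 5, .add 5 5 3, .input 7 5, .add 5 5 3, .put 9 4 6, .put 10 4 7,
  .get 8 0 6, .ite 8 (block []) (block [.get 8 2 6, .add 8 8 3, .put 2 6 8]),
  .get 8 7 7, .put 8 4 8, .add 4 4 3, .put 7 7 4]

def loadSizes : Cmd := block [.const 3 1, .input 0 4, .add 4 4 3, .input 1 4, .add 4 4 3, .input 2 4,
  .add 12 0 1, .const 4 0, .const 5 3]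

def load : Cmd := block [loadSizes, .rep 0 loadPosition, .const 4 0, .const 5 3, .add 5 5 0,
  .add 5 5 0, .rep 1 loadEdge]

def solver : Cmd := block [load, .rep 0 outerBody, .get 6 3 2,
  .ite 6 (.const 0 1) (.const 0 0)]

theorem Chain.congr {nxt nxt' : ℕ → ℕ} : ∀ {l : List ℕ} {p : ℕ}, (∀ e ∈ l, nxt' e = nxt e) →
    Chain nxt p l → Chain nxt' p l
  | [], _, _, h => h
  | e :: l, _, hl, h => ⟨h.1, by
      rw [hl e (by simp)]
      exact Chain.congr (fun f hf => hl f (List.mem_cons_of_mem _ hf)) h.2⟩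

section

variable {n : ℕ} {w : List ℕ} {s : Store}

theorem loadPosition_spec {m : ℕ} (h0 : s.var 0 = n) (h3 : s.var 3 = 1) (h4 : s.var 4 = 0)
    (h5 : s.var 5 = 3) (_ : s.arr 7 = fun _ => 0) (_ : s.var 1 = m) :
    let s' := (Cmd.rep 0 loadPosition).eval w s
    (∀ v < n, s'.arr 0 v = w.getD (3 + v) 0 ∧ s'.arr 2 v = w.getD (3 + v) 0 ∧
      s'.arr 1 v = w.getD (3 + v + n) 0 ∧ s'.arr 3 v = 1) ∧
      (Cmd.rep 0 loadPosition).cost w s ≤ 2 + n * (4 + loadPosition.bound) := by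
  have := rep_inv' (w := w) (c := loadPosition) (x := 0) (s := s) (N := n)
    (fun i s' => s'.var 0 = n ∧ s'.var 3 = 1 ∧ s'.var 4 = i ∧ s'.var 5 = 3 + i ∧
      ∀ v < i, s'.arr 0 v = w.getD (3 + v) 0 ∧ s'.arr 2 v = w.getD (3 + v) 0 ∧
        s'.arr 1 v = w.getD (3 + v + n) 0 ∧ s'.arr 3 v = 1) rfl h0 ⟨h0, h3, h4, h5, by simp⟩ ?_
  · exact ⟨this.1.2.2.2.2, this.2⟩
  · rintro i hi s' ⟨h0, h3, h4, h5, h⟩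
    refine ⟨?_, ?_, ?_, ?_, fun v hv => ?_⟩
    any_goals simp [loadPosition, block, Cmd.eval, Store.set, Store.setArr, h0, h3, h4, h5, add_assoc]
    simp only [Function.update_apply]
    by_cases hvi : v = i
    · simp [hvi]
    · simpa [hvi, add_assoc] using h v (by omega)

/-- The edges among the first `i` with target `v`, in the order of the linked lists. -/
def edgesTo (w : List ℕ) (n i v : ℕ) : List ℕ :=
  (List.range i).reverse.filter fun e => w.getD (3 + n + n + 2 * e + 1) 0 = v

theorem loadEdge_spec {m : ℕ} (h1 : s.var 1 = m) (h3 : s.var 3 = 1) (h4 : s.var 4 = 0)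
    (h5 : s.var 5 = 3 + n + n) (ha : ∀ v, s.arr 7 v = 0) (h02 : ∀ v < n, s.arr 2 v = s.arr 0 v)
    (hsrc : ∀ e < m, w.getD (3 + n + n + 2 * e) 0 < n) :
    let s' := (Cmd.rep 1 loadEdge).eval w s
    (s'.arr 0 = s.arr 0 ∧
      (∀ e < m, s'.arr 9 e = w.getD (3 + n + n + 2 * e) 0 ∧
        s'.arr 10 e = w.getD (3 + n + n + 2 * e + 1) 0) ∧
      (∀ v < n, s'.arr 2 v = if s.arr 0 v = 0 then
        ((Finset.range m).filter fun e => w.getD (3 + n + n + 2 * e) 0 = v).card else s.arr 0 v) ∧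
      ∀ v, Chain (s'.arr 8) (s'.arr 7 v) (edgesTo w n m v)) ∧
      (Cmd.rep 1 loadEdge).cost w s ≤ 2 + m * (4 + loadEdge.bound) := by
  have := rep_inv' (w := w) (c := loadEdge) (x := 1) (s := s) (N := m)
    (fun i s' => (s'.var 3 = 1 ∧ s'.var 4 = i ∧ s'.var 5 = 3 + n + n + 2 * i) ∧
      s'.arr 0 = s.arr 0 ∧
      (∀ e < i, s'.arr 9 e = w.getD (3 + n + n + 2 * e) 0 ∧
        s'.arr 10 e = w.getD (3 + n + n + 2 * e + 1) 0) ∧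
      (∀ v < n, s'.arr 2 v = if s.arr 0 v = 0 then
        ((Finset.range i).filter fun e => w.getD (3 + n + n + 2 * e) 0 = v).card else s.arr 0 v) ∧
      ∀ v, Chain (s'.arr 8) (s'.arr 7 v) (edgesTo w n i v)) rfl h1
      ⟨⟨h3, h4, h5⟩, rfl, by simp, fun v hv => ?_, fun v => ha v⟩ ?_
  · exact ⟨this.1.2, this.2⟩
  · rw [h02 v hv]; split_ifs with h <;> simp [h]
  · rintro i hi s' ⟨⟨h3, h4, h5⟩, h0, he, h2, hc⟩
    have hpos : 3 + n + n + 2 * i + 1 + 1 = 3 + n + n + 2 * (i + 1) := by ring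
    have hsi := hsrc i hi
    set a := w.getD (3 + n + n + 2 * i) 0 with hadef
    set b := w.getD (3 + n + n + 2 * i + 1) 0 with hbdef
    have e1 : ((loadEdge.eval w s').var 3 = 1 ∧ (loadEdge.eval w s').var 4 = i + 1 ∧
        (loadEdge.eval w s').var 5 = 3 + n + n + 2 * (i + 1)) ∧
        (loadEdge.eval w s').arr 0 = s.arr 0 ∧
        (loadEdge.eval w s').arr 9 = Function.update (s'.arr 9) i a ∧
        (loadEdge.eval w s').arr 10 = Function.update (s'.arr 10) i b ∧
        (loadEdge.eval w s').arr 2 = (if s.arr 0 a = 0 then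
          Function.update (s'.arr 2) a (s'.arr 2 a + 1) else s'.arr 2) ∧
        (loadEdge.eval w s').arr 8 = Function.update (s'.arr 8) i (s'.arr 7 b) ∧
        (loadEdge.eval w s').arr 7 = Function.update (s'.arr 7) b (i + 1) := by
      simp only [hadef, hbdef, List.getD_eq_getElem?_getD]
      by_cases hp : s.arr 0 (w[3 + n + n + 2 * i]?.getD 0) = 0
      · simp [loadEdge, block, Cmd.eval, Store.set, Store.setArr, h3, h4, h5, h0, hp, hpos]
      · simp [loadEdge, block, Cmd.eval, Store.set, Store.setArr, h3, h4, h5, h0, hp, hpos]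
    obtain ⟨e0, e1, e9, e10, e2, e8, e7⟩ := e1
    refine ⟨e0, e1, fun e hei => ?_, fun v hv => ?_, fun v => ?_⟩
    · rw [e9, e10, Function.update_apply, Function.update_apply]
      by_cases h : e = i
      · simp [h, hadef, hbdef]
      · rw [if_neg h, if_neg h]; exact he e (by omega)
    · rw [e2, Finset.range_add_one, Finset.filter_insert]
      by_cases hv' : a = v
      · subst hv'
        rw [if_pos hadef.symm, Finset.card_insert_of_notMem (by simp)]
        by_cases hp : s.arr 0 a = 0
        · rw [if_pos hp, if_pos hp, Function.update_self, h2 a hv, if_pos hp]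
        · rw [if_neg hp, if_neg hp, h2 a hv, if_neg hp]
      · rw [if_neg (show ¬ w.getD (3 + n + n + 2 * i) 0 = v from hv'), ← h2 v hv]
        split_ifs
        · rw [Function.update_of_ne (Ne.symm hv')]
        · rfl
    · have hl : Chain (Function.update (s'.arr 8) i (s'.arr 7 b)) (s'.arr 7 v) (edgesTo w n i v) := by
        refine (hc v).congr fun e he => Function.update_of_ne ?_ _ _
        simp only [edgesTo, List.mem_filter, List.mem_reverse, List.mem_range] at he
        omega
      rw [e7, e8, Function.update_apply]
      by_cases hv : v = b
      · subst hv
        rw [if_pos rfl]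
        have : edgesTo w n (i + 1) b = i :: edgesTo w n i b := by
          simp [edgesTo, List.range_succ, hbdef]
        rw [this]
        refine ⟨rfl, ?_⟩
        rw [Function.update_self]; exact hl
      · rw [if_neg hv]
        have : edgesTo w n (i + 1) v = edgesTo w n i v := by
          simp only [edgesTo, List.range_succ, List.reverse_append, List.reverse_singleton,
            List.singleton_append]
          rw [List.filter_cons_of_neg]
          simpa [hbdef] using Ne.symm hv
        rw [this]; exact hl

end

section

variable {n : ℕ} (G : BuchiGame (Fin n)) (edges : List (Fin n × Fin n))

theorem getD_flatMap_pair {α : Type} (f g : α → ℕ) : ∀ (l : List α) (e : ℕ),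
    (l.flatMap fun x => [f x, g x]).getD (2 * e) 0 = (l[e]?.map f).getD 0 ∧
      (l.flatMap fun x => [f x, g x]).getD (2 * e + 1) 0 = (l[e]?.map g).getD 0
  | [], e => by simp
  | x :: l, 0 => by simp
  | x :: l, e + 1 => by
    have := getD_flatMap_pair f g l e
    simpa [mul_add] using this

open Classical in
theorem code_getD :
    (G.code edges).getD 0 0 = n ∧ (G.code edges).getD 1 0 = edges.length ∧
    (G.code edges).getD 2 0 = G.init.val ∧
    (∀ v : Fin n, (G.code edges).getD (3 + v) 0 = (if v ∈ G.player0 then 1 else 0) ∧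
      (G.code edges).getD (3 + v + n) 0 = if v ∈ G.accepting then 1 else 0) ∧
    ∀ e, (G.code edges).getD (3 + n + n + 2 * e) 0 = (edges[e]?.map fun x => x.1.val).getD 0 ∧
      (G.code edges).getD (3 + n + n + 2 * e + 1) 0 = (edges[e]?.map fun x => x.2.val).getD 0 := by
  refine ⟨by simp [BuchiGame.code], by simp [BuchiGame.code], by simp [BuchiGame.code],
    fun v => ⟨?_, ?_⟩, fun e => ?_⟩
  · simp only [BuchiGame.code, List.append_assoc, List.getD_eq_getElem?_getD]
    rw [List.getElem?_append_right (by simp), List.getElem?_append_left (by simp)]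
    simp
  · simp only [BuchiGame.code, List.append_assoc, List.getD_eq_getElem?_getD]
    rw [List.getElem?_append_right (by simp; omega), List.getElem?_append_right (by simp; omega),
      List.getElem?_append_left (by simp; omega)]
    have : 3 + v.1 + n - 3 - n = v := by omega
    simp [this]
  · have h := getD_flatMap_pair (fun x : Fin n × Fin n => x.1.val) (fun x => x.2.val) edges e
    simp only [BuchiGame.code, List.append_assoc, List.getD_eq_getElem?_getD] at h ⊢
    rw [List.getElem?_append_right (by simp; omega), List.getElem?_append_right (by simp; omega),
      List.getElem?_append_right (by simp; omega), List.getElem?_append_right (by simp; omega),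
      List.getElem?_append_right (by simp; omega), List.getElem?_append_right (by simp; omega)]
    simp only [List.length_map, List.length_finRange, List.length_cons, List.length_nil]
    rw [show 3 + n + n + 2 * e - (0 + 1 + 1 + 1) - n - n = 2 * e by omega,
      show 3 + n + n + 2 * e + 1 - (0 + 1 + 1 + 1) - n - n = 2 * e + 1 by omega]
    exact h

variable {G edges}

theorem load_spec (hedges : ∀ u v, (u, v) ∈ edges ↔ G.edge u v) :
    let s₀ := load.eval (G.code edges) initStore
    Loaded G edges.length s₀ ∧ (∀ v : Fin n, s₀.arr 3 v ≠ 0) ∧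
      load.cost (G.code edges) initStore ≤ 200 * (n + edges.length) + 50 := by
  classical
  obtain ⟨w0, w1, w2, wv, we⟩ := code_getD G edges
  set w := G.code edges with hw
  set m := edges.length with hm
  set s1 := loadSizes.eval w initStore with hs1
  have h1 : s1.var 0 = n ∧ s1.var 1 = m ∧ s1.var 2 = G.init ∧ s1.var 3 = 1 ∧ s1.var 4 = 0 ∧
      s1.var 5 = 3 ∧ s1.var 12 = n + m ∧ s1.var 14 = 0 ∧ s1.arr 7 = fun _ => 0 := by
    simp only [List.getD_eq_getElem?_getD] at w0 w1 w2
    simp [hs1, loadSizes, block, Cmd.eval, Store.set, initStore, w0, w1, w2]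
  obtain ⟨v0, v1, v2, v3, v4, v5, v12, v14, a7⟩ := h1
  obtain ⟨p1, c1⟩ := loadPosition_spec (w := w) v0 v3 v4 v5 a7 v1
  have k1 := eval_keeps (w := w) (xs := frameVars) (as := [7]) (c := Cmd.rep 0 loadPosition)
    (s := s1) rfl
  set s2 := (Cmd.rep 0 loadPosition).eval w s1 with hs2
  set s3 := (block [.const 4 0, .const 5 3, .add 5 5 0, .add 5 5 0]).eval w s2 with hs3
  have v0' : s2.var 0 = n := (k1.1 0 (by decide)).trans v0
  have hs3' : s3.var 4 = 0 ∧ s3.var 5 = 3 + n + n ∧ s3.arr = s2.arr ∧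
      ∀ x ∈ frameVars, s3.var x = s1.var x := by
    refine ⟨?_, ?_, rfl, fun x hx => ?_⟩
    · simp [hs3, block, Cmd.eval, Store.set]
    · simp [hs3, block, Cmd.eval, Store.set, v0']
    · rw [← k1.1 x hx]
      exact (eval_keeps (w := w) (xs := frameVars) (as := []) rfl).1 x hx
  obtain ⟨u4, u5, ua, uv⟩ := hs3'
  have hsrc : ∀ e < m, w.getD (3 + n + n + 2 * e) 0 < n ∧ w.getD (3 + n + n + 2 * e + 1) 0 < n := by
    intro e he
    rw [(we e).1, (we e).2, List.getElem?_eq_getElem he]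
    exact ⟨Fin.is_lt _, Fin.is_lt _⟩
  obtain ⟨⟨q0, q9, q2, qc⟩, c2⟩ := loadEdge_spec (w := w) (s := s3) (n := n) (m := m)
    ((uv 1 (by decide)).trans v1) ((uv 3 (by decide)).trans v3) u4 u5
    (fun v => by rw [ua, k1.2 7 (by simp), a7]) (fun v hv => by
      rw [ua, (p1 v hv).1, (p1 v hv).2.1]) fun e he => (hsrc e he).1
  have k2 := eval_keeps (w := w) (xs := frameVars) (as := [1, 3]) (c := Cmd.rep 1 loadEdge)
    (s := s3) rfl
  have hload : load.eval w initStore = (Cmd.rep 1 loadEdge).eval w s3 := rfl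
  have hcost : load.cost w initStore = loadSizes.cost w initStore +
      ((Cmd.rep 0 loadPosition).cost w s1 + (1 + (1 + (1 + (1 +
        (Cmd.rep 1 loadEdge).cost w s3))))) := rfl
  rw [hload, hcost]
  set s₀ := (Cmd.rep 1 loadEdge).eval w s3 with hs₀
  have vars : ∀ x ∈ frameVars, s₀.var x = s1.var x := fun x hx => (k2.1 x hx).trans (uv x hx)
  have hpl : ∀ v : Fin n, s3.arr 0 v = if v ∈ G.player0 then 1 else 0 := fun v => by
    rw [ua, (p1 v v.2).1, (wv v).1]
  have hedge : ∀ u v : Fin n, G.edge u v ↔ ∃ e < m, s₀.arr 9 e = u ∧ s₀.arr 10 e = v := by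
    intro u v
    rw [← hedges, List.mem_iff_getElem]
    constructor
    · rintro ⟨e, he, h⟩
      refine ⟨e, he, ?_⟩
      rw [(q9 e he).1, (q9 e he).2, (we e).1, (we e).2, List.getElem?_eq_getElem he, h]
      exact ⟨rfl, rfl⟩
    · rintro ⟨e, he, h, h'⟩
      refine ⟨e, he, ?_⟩
      rw [(q9 e he).1, (we e).1, List.getElem?_eq_getElem he] at h
      rw [(q9 e he).2, (we e).2, List.getElem?_eq_getElem he] at h'
      exact Prod.ext (Fin.ext h) (Fin.ext h')
  -- One edge into a set suffices for player 0, while for player 1 all outgoing edges have to lead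
  -- there.
  have hneed : ∀ v : Fin n, s₀.arr 2 v = if v ∈ G.player0 then 1 else
      ((Finset.range m).filter fun e => s₀.arr 9 e = v).card := by
    intro v
    rw [q2 v v.2, hpl]
    by_cases hv : v ∈ G.player0
    · simp [hv]
    · simp only [hv, if_false, if_true]
      congr 1
      refine Finset.filter_congr fun e he => ?_
      rw [(q9 e (Finset.mem_range.1 he)).1]
  refine ⟨⟨(vars 0 (by decide)).trans v0, (vars 1 (by decide)).trans v1,
    (vars 2 (by decide)).trans v2, (vars 3 (by decide)).trans v3, (vars 12 (by decide)).trans v12,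
    (vars 14 (by decide)).trans v14, fun v => ?_, fun e he => ?_, fun e he => ?_, fun v hv => ?_,
    fun v => ?_, fun v X => ?_⟩, fun v => ?_, ?_⟩
  · rw [k2.2 1 (by simp), ua, (p1 v v.2).2.2.1, (wv v).2]
    simp
  · rw [(q9 e he).1]; exact (hsrc e he).1
  · rw [(q9 e he).2]; exact (hsrc e he).2
  · refine ⟨_, qc v, ?_, fun e => ?_⟩
    · exact (List.nodup_reverse.2 List.nodup_range).filter _
    · simp only [edgesTo, List.mem_filter, List.mem_reverse, List.mem_range, decide_eq_true_eq]
      exact and_congr_right fun he => by rw [(q9 e he).2]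
  · rw [hneed]
    split_ifs
    · exact one_pos
    · obtain ⟨u, hu⟩ := G.total v
      obtain ⟨e, he, h, -⟩ := (hedge v u).1 hu
      exact Finset.card_pos.2 ⟨e, by simp [he, h]⟩
  · rw [hneed]
    by_cases hv : v ∈ G.player0
    · rw [if_pos hv, Nat.one_le_iff_ne_zero, ← Nat.pos_iff_ne_zero, Finset.card_pos]
      simp only [BuchiGame.cpre, Set.mem_ofPred_eq, hv, true_and, not_true, false_and, or_false]
      constructor
      · rintro ⟨u, hu, hX⟩
        obtain ⟨e, he, h, h'⟩ := (hedge v u).1 hu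
        exact ⟨e, by simp only [edgesInto, Finset.mem_filter, Finset.mem_range]; exact ⟨he, h, u, hX, h'⟩⟩
      · rintro ⟨e, he⟩
        simp only [edgesInto, Finset.mem_filter, Finset.mem_range] at he
        obtain ⟨he, h, u, hX, h'⟩ := he
        exact ⟨u, (hedge v u).2 ⟨e, he, h, h'⟩, hX⟩
    · rw [if_neg hv]
      simp only [BuchiGame.cpre, Set.mem_ofPred_eq, hv, false_and, not_false_eq_true, true_and,
        false_or]
      have hsub : edgesInto s₀ (Finset.range m) v X ⊆
          (Finset.range m).filter fun e => s₀.arr 9 e = v := fun e he => by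
        simp only [edgesInto, Finset.mem_filter] at he ⊢
        exact ⟨he.1, he.2.1⟩
      constructor
      · intro h
        refine Finset.card_le_card fun e he => ?_
        simp only [edgesInto, Finset.mem_filter, Finset.mem_range] at he ⊢
        have ht : s₀.arr 10 e < n := by rw [(q9 e he.1).2]; exact (hsrc e he.1).2
        exact ⟨he.1, he.2, ⟨_, ht⟩, h _ ((hedge _ _).2 ⟨e, he.1, he.2, rfl⟩), rfl⟩
      · intro h u hu
        obtain ⟨e, he, h1, h2⟩ := (hedge v u).1 hu
        have heq := Finset.eq_of_subset_of_card_le hsub h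
        have : e ∈ edgesInto s₀ (Finset.range m) v X := by rw [heq]; simp [he, h1]
        simp only [edgesInto, Finset.mem_filter] at this
        obtain ⟨-, -, u', hu', h3⟩ := this
        have : u = u' := Fin.ext (h2.symm.trans h3)
        rwa [this]
  · rw [k2.2 3 (by simp), ua, (p1 v v.2).2.2.2]; exact one_ne_zero
  · have b0 : loadSizes.cost w initStore ≤ 30 := (cost_le_bound rfl).trans (by decide)
    have b1 : loadPosition.bound ≤ 100 := by decide
    have b2 : loadEdge.bound ≤ 150 := by decide
    have := Nat.mul_le_mul_left n (Nat.add_le_add_left b1 4)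
    have := Nat.mul_le_mul_left m (Nat.add_le_add_left b2 4)
    omega

/-- `BuchiGame.win` is by definition the result of `n` rounds of the outer iteration, starting with
all positions, and the main loop performs exactly these rounds in time O(n + m) each. -/
theorem solver_spec (hedges : ∀ u v, (u, v) ∈ edges ↔ G.edge u v) :
    DecidesWithin (solver.program 0) (G.code edges) (2000 * (n * edges.length)) G.Player0Wins := by
  classical
  obtain ⟨hL, hZ, hc⟩ := load_spec hedges
  set w := G.code edges with hw
  set m := edges.length with hm
  set s₀ := load.eval w initStore with hs₀
  obtain ⟨⟨hF, hI⟩, hcost⟩ := rep_inv (w := w) (c := outerBody) (x := 0) (s := s₀) (N := n)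
    (t := 500 * (n + m) + 50)
    (fun i s => Frame s₀ s ∧ ∀ v : Fin n, s.arr 3 v ≠ 0 ↔
      v ∈ (NestedFix.inner G.op n)^[i] Set.univ) hL.var0
    ⟨⟨fun _ _ => rfl, fun _ _ => rfl⟩, fun v => by simpa using hZ v⟩ fun i hi s ⟨hF, hs⟩ => by
      obtain ⟨h1, h2⟩ := outer_spec (w := w) hL hF hs
      refine ⟨⟨hF.eval rfl, fun v => ?_⟩, h2⟩
      rw [Function.iterate_succ_apply']; exact h1 v
  set s1 := (Cmd.rep 0 outerBody).eval w s₀ with hs1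
  have hn : 0 < n := G.init.pos
  -- Choosing a successor for every position embeds the positions into the edges. This inequality
  -- turns `n * (n + m)` into a multiple of `n * m`.
  have hnm : n ≤ m := by
    choose f hf using G.total
    have hinj : Function.Injective fun v : Fin n => (v, f v) := fun u v h => (Prod.ext_iff.1 h).1
    have h1 : Finset.univ.image (fun v : Fin n => (v, f v)) ⊆ edges.toFinset := by
      intro x hx
      obtain ⟨v, -, rfl⟩ := Finset.mem_image.1 hx
      exact List.mem_toFinset.2 ((hedges _ _).2 (hf v))
    have h2 := Finset.card_le_card h1
    rw [Finset.card_image_of_injective _ hinj, Finset.card_univ, Fintype.card_fin] at h2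
    exact h2.trans (List.toFinset_card_le _)
  have hwin : G.Player0Wins ↔ s1.arr 3 G.init ≠ 0 := by
    rw [G.player0Wins_iff, hI, BuchiGame.win, NestedFix.outer, Nat.card_fin]
  have v2 : s1.var 2 = G.init := (hF.1 2 (by decide)).trans hL.var2
  refine decidesWithin solver 0 w ?_ ?_
  · have hc' : solver.cost w initStore = load.cost w initStore + ((Cmd.rep 0 outerBody).cost w s₀ +
        (8 + (Cmd.ite 6 (.const 0 1) (.const 0 0)).cost w ((Cmd.get 6 3 2).eval w s1))) := rfl
    have b : (Cmd.ite 6 (.const 0 1) (.const 0 0)).cost w ((Cmd.get 6 3 2).eval w s1) ≤ 4 :=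
      cost_le_bound rfl
    rw [hc']
    have e1 : n * (4 + (500 * (n + m) + 50)) ≤ 1000 * (n * m) + 54 * (n * m) := by nlinarith
    have e2 : n ≤ n * m := Nat.le_mul_of_pos_right n (by omega)
    have e3 : m ≤ n * m := Nat.le_mul_of_pos_left m hn
    omega
  · have he : (solver.eval w initStore).var 0 = if s1.arr 3 G.init = 0 then 0 else 1 := by
      have : solver.eval w initStore = (Cmd.ite 6 (.const 0 1) (.const 0 0)).eval w
        ((Cmd.get 6 3 2).eval w s1) := rfl
      rw [this]
      simp only [Cmd.eval, Store.set, v2, Function.update_self]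
      split_ifs <;> simp
    rw [he, hwin]
    by_cases h : s1.arr 3 G.init = 0 <;> simp [h]

end

end BuchiSolver

/-! ### CTL: unfolding of the temporal operators -/

namespace TransitionSystem

variable (T : TransitionSystem)

def IsPath (π : ℕ → T.State) : Prop := ∀ i, T.rel (π i) (π (i + 1))

theorem exists_isPath (s : T.State) : ∃ π, T.IsPath π ∧ π 0 = s := by
  choose f hf using T.total
  refine ⟨fun i => f^[i] s, fun i => ?_, rfl⟩
  simp only [Function.iterate_succ_apply']
  exact hf _

/-- The path that starts with `s` and goes on with `π`. -/
def consPath (s : T.State) (π : ℕ → T.State) : ℕ → T.State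
  | 0 => s
  | i + 1 => π i

variable {T}

theorem IsPath.cons {s : T.State} {π : ℕ → T.State} (h : T.IsPath π) (hs : T.rel s (π 0)) :
    T.IsPath (T.consPath s π)
  | 0 => hs
  | i + 1 => h i

theorem IsPath.tail {π : ℕ → T.State} (h : T.IsPath π) : T.IsPath fun i => π (i + 1) :=
  fun i => h (i + 1)

variable {s : T.State} {φ ψ : CTL} {q : Quant}

theorem sat_next_E : T.Sat (.next .E φ) s ↔ ∃ s', T.rel s s' ∧ T.Sat φ s' := by
  constructor
  · rintro ⟨π, hπ, rfl, h⟩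
    exact ⟨π 1, hπ 0, h⟩
  · rintro ⟨s', hs, h⟩
    obtain ⟨π, hπ, rfl⟩ := T.exists_isPath s'
    exact ⟨T.consPath s π, hπ.cons hs, rfl, h⟩

theorem sat_next_A : T.Sat (.next .A φ) s ↔ ∀ s', T.rel s s' → T.Sat φ s' := by
  constructor
  · intro h s' hs
    obtain ⟨π, hπ, rfl⟩ := T.exists_isPath s'
    exact h (T.consPath s π) (hπ.cons hs) rfl
  · rintro h π hπ rfl
    exact h _ (hπ 0)

theorem sat_untl : T.Sat (.untl q φ ψ) s ↔
    T.Sat ψ s ∨ (T.Sat φ s ∧ T.Sat (.next q (.untl q φ ψ)) s) := by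
  cases q with
  | E =>
    rw [sat_next_E]
    constructor
    · rintro ⟨π, hπ, rfl, k, hk, hj⟩
      rcases k with - | k
      · exact Or.inl hk
      · exact Or.inr ⟨hj 0 k.succ_pos, π 1, hπ 0, fun i => π (i + 1), IsPath.tail hπ, rfl, k, hk,
          fun j hjk => hj (j + 1) (by omega)⟩
    · rintro (h | ⟨h, s', hs, π, hπ, rfl, k, hk, hj⟩)
      · obtain ⟨π, hπ, rfl⟩ := T.exists_isPath s
        exact ⟨π, hπ, rfl, 0, h, by simp⟩
      · refine ⟨T.consPath s π, IsPath.cons hπ hs, rfl, k + 1, hk, fun j hjk => ?_⟩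
        rcases j with - | j
        · exact h
        · exact hj j (by omega)
  | A =>
    rw [sat_next_A]
    constructor
    · intro h
      rw [or_iff_not_imp_left]
      intro hψ
      refine ⟨?_, fun s' hs π hπ h0 => ?_⟩
      · obtain ⟨π, hπ, rfl⟩ := T.exists_isPath s
        obtain ⟨k, hk, hj⟩ := h π hπ rfl
        exact hj 0 (Nat.pos_of_ne_zero fun h0 => hψ (h0 ▸ hk))
      · subst h0
        obtain ⟨k, hk, hj⟩ := h (T.consPath s π) (IsPath.cons hπ hs) rfl
        rcases k with - | k
        · exact absurd hk hψ
        · exact ⟨k, hk, fun j hjk => hj (j + 1) (by omega)⟩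
    · rintro (h | ⟨h, hA⟩) π hπ rfl
      · exact ⟨0, h, by simp⟩
      · obtain ⟨k, hk, hj⟩ := hA (π 1) (hπ 0) (fun i => π (i + 1)) (IsPath.tail hπ) rfl
        refine ⟨k + 1, hk, fun j hjk => ?_⟩
        rcases j with - | j
        · exact h
        · exact hj j (by omega)

theorem sat_rel : T.Sat (.rel q φ ψ) s ↔
    T.Sat ψ s ∧ (T.Sat φ s ∨ T.Sat (.next q (.rel q φ ψ)) s) := by
  have tail : ∀ {π : ℕ → T.State}, ¬ T.Sat φ (π 0) →
      (∀ k, T.Sat ψ (π k) ∨ ∃ j < k, T.Sat φ (π j)) →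
      ∀ k, T.Sat ψ (π (k + 1)) ∨ ∃ j < k, T.Sat φ (π (j + 1)) := by
    intro π hφ h k
    rcases h (k + 1) with h | ⟨j, hj, h⟩
    · exact Or.inl h
    · rcases j with - | j
      · exact absurd h hφ
      · exact Or.inr ⟨j, by omega, h⟩
  have cons : ∀ {π : ℕ → T.State}, T.Sat ψ (π 0) →
      (∀ k, T.Sat ψ (π (k + 1)) ∨ ∃ j < k, T.Sat φ (π (j + 1))) →
      ∀ k, T.Sat ψ (π k) ∨ ∃ j < k, T.Sat φ (π j) := by
    intro π hψ h k
    rcases k with - | k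
    · exact Or.inl hψ
    · rcases h k with h | ⟨j, hj, h⟩
      · exact Or.inl h
      · exact Or.inr ⟨j + 1, by omega, h⟩
  have now : ∀ {π : ℕ → T.State}, T.Sat ψ (π 0) → T.Sat φ (π 0) →
      ∀ k, T.Sat ψ (π k) ∨ ∃ j < k, T.Sat φ (π j) := by
    intro π hψ hφ k
    rcases k with - | k
    · exact Or.inl hψ
    · exact Or.inr ⟨0, k.succ_pos, hφ⟩
  cases q with
  | E =>
    rw [sat_next_E]
    constructor
    · rintro ⟨π, hπ, rfl, h⟩
      refine ⟨(h 0).resolve_right (by simp), or_iff_not_imp_left.2 fun hφ => ?_⟩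
      exact ⟨π 1, hπ 0, fun i => π (i + 1), IsPath.tail hπ, rfl, tail hφ h⟩
    · rintro ⟨hψ, hφ | ⟨s', hs, π, hπ, rfl, h⟩⟩
      · obtain ⟨π, hπ, rfl⟩ := T.exists_isPath s
        exact ⟨π, hπ, rfl, now hψ hφ⟩
      · exact ⟨T.consPath s π, IsPath.cons hπ hs, rfl, cons hψ h⟩
  | A =>
    rw [sat_next_A]
    constructor
    · intro h
      refine ⟨?_, or_iff_not_imp_left.2 fun hφ s' hs π hπ h0 => ?_⟩
      · obtain ⟨π, hπ, rfl⟩ := T.exists_isPath s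
        exact (h π hπ rfl 0).resolve_right (by simp)
      · subst h0
        exact tail (π := T.consPath s π) hφ (h _ (IsPath.cons hπ hs) rfl)
    · rintro ⟨hψ, hφ | hA⟩ π hπ rfl
      · exact now hψ hφ
      · exact cons hψ (hA (π 1) (hπ 0) _ (IsPath.tail hπ) rfl)

/-- On all paths from the state, `P` holds eventually. -/
inductive Inevitable (T : TransitionSystem) (P : T.State → Prop) : T.State → Prop
  | now {s : T.State} : P s → Inevitable T P s
  | later {s : T.State} : (∀ s', T.rel s s' → Inevitable T P s') → Inevitable T P s

/-- A state where `ψ` is not inevitable has a successor of the same kind. Iterating this would give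
a path that never meets `ψ`. The inductive predicate provides the well-founded induction used for `A
(φ U ψ)`. -/
theorem inevitable_of_sat (h : T.Sat (.untl .A φ ψ) s) : T.Inevitable (T.Sat ψ) s := by
  by_contra hs
  have hstep : ∀ s : {s // ¬ T.Inevitable (T.Sat ψ) s}, ∃ s' : {s // ¬ T.Inevitable (T.Sat ψ) s},
      T.rel s.1 s'.1 := by
    rintro ⟨s, hs⟩
    by_contra hcon
    push Not at hcon
    exact hs (.later fun s' hs' => by_contra fun h => hcon ⟨s', h⟩ hs')
  choose f hf using hstep
  obtain ⟨k, hk, -⟩ := h (fun i => (f^[i] ⟨s, hs⟩).1) (fun i => by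
    simp only [Function.iterate_succ_apply']; exact hf _) rfl
  exact (f^[k] ⟨s, hs⟩).2 (.now hk)

/-- The least number of steps in which `E (φ U ψ)` can be fulfilled. -/
noncomputable def distance (T : TransitionSystem) (φ ψ : CTL) (s : T.State) : ℕ :=
  sInf {k | ∃ π, T.IsPath π ∧ π 0 = s ∧ T.Sat ψ (π k) ∧ ∀ j < k, T.Sat φ (π j)}

/-- The tail of a shortest witnessing path, which has positive length as `ψ` does not hold yet. -/
theorem exists_distance_lt (h : T.Sat (.untl .E φ ψ) s) (hψ : ¬ T.Sat ψ s) :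
    ∃ s', T.rel s s' ∧ T.Sat (.untl .E φ ψ) s' ∧ T.distance φ ψ s' < T.distance φ ψ s := by
  have hne : {k | ∃ π, T.IsPath π ∧ π 0 = s ∧ T.Sat ψ (π k) ∧ ∀ j < k, T.Sat φ (π j)}.Nonempty := by
    obtain ⟨π, hπ, h0, k, hk⟩ := h
    exact ⟨k, π, hπ, h0, hk⟩
  obtain ⟨π, hπ, h0, hk, hj⟩ := Nat.sInf_mem hne
  change T.Sat ψ (π (T.distance φ ψ s)) at hk
  change ∀ j < T.distance φ ψ s, _ at hj
  rcases hd : T.distance φ ψ s with - | k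
  · rw [hd, h0] at hk; exact absurd hk hψ
  · rw [hd] at hk hj
    have hw : T.IsPath (fun i => π (i + 1)) ∧ π (0 + 1) = π 1 ∧ T.Sat ψ (π (k + 1)) ∧
        ∀ j < k, T.Sat φ (π (j + 1)) := ⟨IsPath.tail hπ, rfl, hk, fun j hjk => hj _ (by omega)⟩
    refine ⟨π 1, h0 ▸ hπ 0, ⟨_, hw.1, hw.2.1, k, hw.2.2⟩, Nat.lt_succ_of_le (Nat.sInf_le ?_)⟩
    exact ⟨_, hw⟩

end TransitionSystem

/-! ### Hintikka structures -/

namespace CTL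

/-- Some name of the formula `φ` belongs to the label `L`. -/
def Named {I : Type} (form : I → CTL) (L : Set I) (φ : CTL) : Prop := ∃ i ∈ L, form i = φ

/-- Hintikka structures, labelled with names of formulas, whose transitions are indexed by names. -/
structure IsHintikka {I X : Type} (form : I → CTL) (L : X → Set I) (nx : X → I → X) : Prop where
  ff : ∀ x, ¬ Named form (L x) ff
  lit : ∀ x p, Named form (L x) (pos p) → ¬ Named form (L x) (neg p)
  or : ∀ x φ ψ, Named form (L x) (or φ ψ) → Named form (L x) φ ∨ Named form (L x) ψ
  and : ∀ x φ ψ, Named form (L x) (and φ ψ) → Named form (L x) φ ∧ Named form (L x) ψ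
  nextE : ∀ x φ, Named form (L x) (next .E φ) → ∃ e, Named form (L (nx x e)) φ
  nextA : ∀ x φ, Named form (L x) (next .A φ) → ∀ e, Named form (L (nx x e)) φ
  untl : ∀ x, ∀ i ∈ L x, ∀ q φ ψ, form i = CTL.untl q φ ψ → Named form (L x) ψ ∨
    (Named form (L x) φ ∧ ∀ e, (q = .E → e = i) → i ∈ L (nx x e))
  rel : ∀ x, ∀ i ∈ L x, ∀ q φ ψ, form i = CTL.rel q φ ψ → Named form (L x) ψ ∧
    (Named form (L x) φ ∨ ∀ e, (q = .E → e = i) → i ∈ L (nx x e))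
  fair : ∀ (x : ℕ → X) (e : ℕ → I) (i : I) (q : Quant) (φ ψ : CTL), form i = CTL.untl q φ ψ →
    (∀ n, x (n + 1) = nx (x n) (e n)) → (∀ n, i ∈ L (x n)) → (q = .E → ∀ n, e n = i) →
    ∃ n, Named form (L (x n)) ψ

/-- The transition system of a Hintikka structure. -/
def hintikkaSystem {I X : Type} [Nonempty I] (form : I → CTL) (L : X → Set I) (nx : X → I → X)
    (x₀ : X) : TransitionSystem where
  State := X
  init := x₀
  rel x y := ∃ e, y = nx x e
  total x := ⟨nx x (Classical.arbitrary I), _, rfl⟩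
  label x := {p | Named form (L x) (pos p)}

/-- Induction on the formula. For an `E`-formula with name `i` the witness is the path that takes
the transition `i` for ever; for an `A`-formula the path is arbitrary. In both cases the name is
handed on from state to state until the formula is discharged, and `fair` excludes that a
`U`-formula is handed on for ever. Names rather than formulas are used because the notion is needed
twice: with formulas naming themselves, and with the entries of an input, several of which may
describe the same formula. -/
theorem IsHintikka.sat {I X : Type} [Nonempty I] {form : I → CTL} {L : X → Set I} {nx : X → I → X}
    (h : IsHintikka form L nx) (x₀ : X) (φ : CTL) :
    ∀ x : X, Named form (L x) φ → (hintikkaSystem form L nx x₀).Sat φ x := by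
  set T := hintikkaSystem form L nx x₀
  -- what happens to an eventuality along the transitions that carry it
  have until_aux : ∀ (π : ℕ → X) (e : ℕ → I) (q : Quant) (φ ψ : CTL) (i : I),
      form i = CTL.untl q φ ψ → (∀ n, π (n + 1) = nx (π n) (e n)) → (q = .E → ∀ n, e n = i) →
      i ∈ L (π 0) → ∃ k, Named form (L (π k)) ψ ∧ ∀ j < k, Named form (L (π j)) φ := by
    classical
    intro π e q φ ψ i hi hπ he h0
    have hmem : ∀ n, (∀ j < n, ¬ Named form (L (π j)) ψ) → i ∈ L (π n) := by
      intro n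
      induction n with
      | zero => exact fun _ => h0
      | succ n ih =>
        intro hn
        rcases h.untl _ i (ih fun j hj => hn j (by omega)) q φ ψ hi with h1 | ⟨-, h1⟩
        · exact absurd h1 (hn n (by omega))
        · rw [hπ]; exact h1 _ fun hq => he hq n
    have hex : ∃ k, Named form (L (π k)) ψ := by
      by_contra hcon
      push Not at hcon
      obtain ⟨n, hn⟩ := h.fair π e i q φ ψ hi hπ (fun n => hmem n fun j _ => hcon j) he
      exact hcon n hn
    refine ⟨Nat.find hex, Nat.find_spec hex, fun j hj => ?_⟩
    have hj' := hmem j fun j' hj' => Nat.find_min hex (by omega)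
    rcases h.untl _ i hj' q φ ψ hi with h1 | ⟨h1, -⟩
    · exact absurd h1 (Nat.find_min hex hj)
    · exact h1
  have rel_aux : ∀ (π : ℕ → X) (e : ℕ → I) (q : Quant) (φ ψ : CTL) (i : I),
      form i = CTL.rel q φ ψ → (∀ n, π (n + 1) = nx (π n) (e n)) → (q = .E → ∀ n, e n = i) →
      i ∈ L (π 0) → ∀ k, Named form (L (π k)) ψ ∨ ∃ j < k, Named form (L (π j)) φ := by
    intro π e q φ ψ i hi hπ he h0
    have hmem : ∀ n, (∃ j < n, Named form (L (π j)) φ) ∨ i ∈ L (π n) := by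
      intro n
      induction n with
      | zero => exact Or.inr h0
      | succ n ih =>
        rcases ih with ⟨j, hj, h1⟩ | ih
        · exact Or.inl ⟨j, by omega, h1⟩
        · rcases (h.rel _ i ih q φ ψ hi).2 with h1 | h1
          · exact Or.inl ⟨n, by omega, h1⟩
          · right; rw [hπ]; exact h1 _ fun hq => he hq n
    intro k
    rcases hmem k with h1 | h1
    · exact Or.inr h1
    · exact Or.inl (h.rel _ i h1 q φ ψ hi).1
  have iter : ∀ (x : X) (i : I) (n : ℕ),
      (fun y => nx y i)^[n + 1] x = nx ((fun y => nx y i)^[n] x) i := fun x i n =>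
    Function.iterate_succ_apply' _ _ _
  induction φ with
  | tt => exact fun _ _ => trivial
  | ff => exact fun x hx => h.ff x hx
  | pos p => exact fun x hx => hx
  | neg p => exact fun x hx hp => h.lit x p hp hx
  | or φ ψ ihφ ihψ => exact fun x hx => (h.or x φ ψ hx).imp (ihφ x) (ihψ x)
  | and φ ψ ihφ ihψ => exact fun x hx => ⟨ihφ x (h.and x φ ψ hx).1, ihψ x (h.and x φ ψ hx).2⟩
  | next q φ ih =>
    intro x hx
    cases q with
    | E =>
      obtain ⟨e, he⟩ := h.nextE x φ hx
      exact TransitionSystem.sat_next_E.2 ⟨nx x e, ⟨e, rfl⟩, ih _ he⟩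
    | A =>
      refine TransitionSystem.sat_next_A.2 ?_
      rintro _ ⟨e, rfl⟩
      exact ih _ (h.nextA x φ hx e)
  | untl q φ ψ ihφ ihψ =>
    rintro x ⟨i, hi, hf⟩
    cases q with
    | E =>
      obtain ⟨k, hk, hj⟩ := until_aux (fun n => (fun y => nx y i)^[n] x) (fun _ => i) _ φ ψ i hf
        (iter x i) (fun _ _ => rfl) hi
      exact ⟨_, fun n => ⟨i, iter x i n⟩, rfl, k, ihψ _ hk, fun j hjk => ihφ _ (hj j hjk)⟩
    | A =>
      rintro π hπ rfl
      choose e he using hπ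
      obtain ⟨k, hk, hj⟩ := until_aux π e .A φ ψ i hf he nofun hi
      exact ⟨k, ihψ _ hk, fun j hjk => ihφ _ (hj j hjk)⟩
  | rel q φ ψ ihφ ihψ =>
    rintro x ⟨i, hi, hf⟩
    cases q with
    | E =>
      have := rel_aux (fun n => (fun y => nx y i)^[n] x) (fun _ => i) _ φ ψ i hf
        (iter x i) (fun _ _ => rfl) hi
      exact ⟨_, fun n => ⟨i, iter x i n⟩, rfl, fun k => (this k).imp (ihψ _)
        fun ⟨j, hj, h1⟩ => ⟨j, hj, ihφ _ h1⟩⟩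
    | A =>
      rintro π hπ rfl k
      choose e he using hπ
      exact (rel_aux π e .A φ ψ i hf he nofun hi k).imp (ihψ _)
        fun ⟨j, hj, h1⟩ => ⟨j, hj, ihφ _ h1⟩

theorem IsHintikka.satisfiable {I X : Type} {form : I → CTL} {L : X → Set I} {nx : X → I → X}
    (h : IsHintikka form L nx) {x : X} {φ : CTL} (hx : Named form (L x) φ) : φ.Satisfiable := by
  have : Nonempty I := ⟨hx.choose⟩
  exact ⟨hintikkaSystem form L nx x, h.sat x φ x hx⟩

end CTL

/-! ### Plays and threads of the satisfiability game -/

namespace CTL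

theorem mem_universalPart {C : Finset CTL} {φ : CTL} : φ ∈ universalPart C ↔ next .A φ ∈ C := by
  unfold universalPart
  rw [Finset.mem_biUnion]
  constructor
  · rintro ⟨χ, hχ, h⟩
    split at h
    · rw [Finset.mem_singleton.1 h]; exact hχ
    · simp at h
  · intro h
    exact ⟨_, h, by simp⟩

/-- A weight that decreases in the applications of the non-modal rules. -/
def weight : CTL → ℕ
  | or φ ψ | and φ ψ | untl _ φ ψ | rel _ φ ψ => φ.weight + ψ.weight + 2
  | _ => 1

/-- The size without the operators `EX` and `AX`. It does not increase along threads. -/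
def measure : CTL → ℕ
  | or φ ψ | and φ ψ | untl _ φ ψ | rel _ φ ψ => φ.measure + ψ.measure + 1
  | next _ φ => φ.measure
  | _ => 1

theorem measure_pos (φ : CTL) : 0 < φ.measure := by
  induction φ with
  | next _ _ ih => exact ih
  | _ => simp [measure]

theorem sum_pair_le (φ ψ : CTL) : ∑ χ ∈ {φ, ψ}, weight χ ≤ φ.weight + ψ.weight := by
  by_cases h : φ = ψ
  · subst h; simp
  · rw [Finset.sum_pair h]

/-- `EX` and `AX` hide the weight of what they govern, so even the unfoldings of `U` and `R` are
lighter than the formula unfolded. -/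
theorem sum_reduct_lt {φ : CTL} {b : Bool} {D : Finset CTL} (h : φ.reduct b = some D) :
    ∑ χ ∈ D, χ.weight < φ.weight := by
  cases φ <;> cases b <;> simp only [reduct, Option.some.injEq, reduceCtorEq] at h <;> subst h
  all_goals
    first
      | (refine (sum_pair_le _ _).trans_lt ?_; simp [weight])
      | (simp [weight]; try omega)

theorem reduct_isSome {φ : CTL} (h : ¬ φ.IsLiteralOrNext) : ∃ D, φ.reduct false = some D := by
  cases φ <;> simp [IsLiteralOrNext, IsLiteral, reduct] at h ⊢

variable {ϑ : CTL}

def Rule.IsModal : Rule ϑ → Prop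
  | .reduce _ _ => False
  | _ => True

theorem Step.weight_lt {C C' : Finset CTL} {r : Rule ϑ} (h : Step C r C') (hr : ¬ r.IsModal) :
    ∑ χ ∈ C', weight χ < ∑ χ ∈ C, weight χ := by
  cases h with
  | @reduce D φ b hC hφ hD =>
    rw [← Finset.sum_erase_add C _ hφ]
    have h1 : ∑ χ ∈ C.erase φ.1 ∪ D, weight χ ≤ ∑ χ ∈ C.erase φ.1, weight χ + ∑ χ ∈ D, weight χ := by
      rw [← Finset.sum_union_inter]; exact Nat.le_add_right _ _
    have := sum_reduct_lt hD
    omega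
  | x0 _ _ _ _ => exact absurd trivial hr
  | x1 _ _ => exact absurd trivial hr

/-- Without modal rules the total weight of the configuration would decrease for ever. -/
theorem exists_isModal {C : ℕ → Config ϑ} {r : ℕ → Rule ϑ}
    (h : ∀ i, Step (C i).1 (r i) (C (i + 1)).1) (N : ℕ) : ∃ i ≥ N, (r i).IsModal := by
  by_contra hcon
  push Not at hcon
  have : ∀ k, ∑ χ ∈ (C (N + k)).1, weight χ + k ≤ ∑ χ ∈ (C N).1, weight χ := by
    intro k
    induction k with
    | zero => simp
    | succ k ih =>
      have := (h (N + k)).weight_lt (hcon _ (by omega))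
      rw [add_assoc] at this
      omega
  have := this (∑ χ ∈ (C N).1, weight χ + 1)
  omega

theorem Step.exists_connected {C C' : Finset CTL} {r : Rule ϑ} (h : Step C r C') {χ' : CTL}
    (hχ : χ' ∈ C') : ∃ χ ∈ C, Connected r χ χ' := by
  cases h with
  | @reduce D φ b hC hφ hD =>
    rcases Finset.mem_union.1 hχ with hχ | hχ
    · exact ⟨χ', Finset.mem_of_mem_erase hχ, Or.inr ⟨Finset.ne_of_mem_erase hχ, rfl⟩⟩
    · exact ⟨φ.1, hφ, Or.inl ⟨rfl, D, hD, hχ⟩⟩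
  | x0 _ _ _ _ => exact ⟨_, mem_universalPart.1 hχ, rfl⟩
  | @x1 φ hC hφ =>
    rcases Finset.mem_insert.1 hχ with rfl | hχ
    · exact ⟨_, hφ, Or.inr ⟨rfl, rfl⟩⟩
    · exact ⟨_, mem_universalPart.1 hχ, Or.inl rfl⟩

/-- Each formula of a configuration comes from some formula of the preceding one, so a thread of a
tail of the play can be prolonged backwards to the start. -/
theorem hasUThread_of_shift {C : ℕ → Config ϑ} {r : ℕ → Rule ϑ} :
    ∀ (M : ℕ), (∀ i, Step (C i).1 (r i) (C (i + 1)).1) →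
      HasUThread (fun i => C (i + M)) (fun i => r (i + M)) → HasUThread C r := by
  intro M
  induction M with
  | zero => exact fun _ h => h
  | succ M ih =>
    intro h ⟨t, ht, hc, q, φ, ψ, hf⟩
    refine ih h ?_
    have h0 := ht 0
    simp only [zero_add] at h0
    obtain ⟨χ, hχ, hcon⟩ := (h M).exists_connected h0
    refine ⟨fun i => Nat.casesOn i χ t, fun i => ?_, fun i => ?_, q, φ, ψ, ?_⟩
    · cases i with
      | zero => simpa using hχ
      | succ i => simpa [add_assoc, add_comm 1] using ht i
    · cases i with
      | zero => simpa using hcon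
      | succ i => simpa [add_assoc, add_comm 1] using hc i
    · rw [frequently_atTop] at hf ⊢
      intro a
      obtain ⟨b, hb, hbt⟩ := hf a
      exact ⟨b + 1, by omega, hbt⟩

/-- The unfolding `QXχ` of `χ` is the only reduct that is not smaller; this is why threads can
circulate only through `χ` and `QXχ`. -/
theorem measure_reduct_lt {φ χ : CTL} {b : Bool} {D : Finset CTL} (h : φ.reduct b = some D)
    (hχ : χ ∈ D) : χ.measure < φ.measure ∨ ∃ q, χ = next q φ ∧ b = true := by
  cases φ <;> cases b <;> simp only [reduct, Option.some.injEq, reduceCtorEq] at h <;> subst h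
  all_goals
    simp only [Finset.mem_insert, Finset.mem_singleton] at hχ
  all_goals
    rename_i φ ψ
    have h1 := measure_pos φ
    have h2 := measure_pos ψ
    first
      | (rcases hχ with hχ | hχ <;> subst hχ)
      | subst hχ
    all_goals
      first
        | (left; simp only [measure]; omega)
        | exact Or.inr ⟨_, rfl, rfl⟩

theorem Connected.measure_le {r : Rule ϑ} {χ χ' : CTL} (h : Connected r χ χ') :
    χ'.measure ≤ χ.measure := by
  cases r with
  | reduce φ b =>
    rcases h with ⟨-, D, hD, hχ⟩ | ⟨-, rfl⟩
    · rcases measure_reduct_lt hD hχ with h | ⟨q, rfl, -⟩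
      · exact h.le
      · exact le_rfl
    · exact le_rfl
  | x0 => exact (congrArg measure (h : χ = _)).ge
  | x1 φ =>
    rcases h with h | ⟨h, -⟩
    · exact (congrArg measure (h : χ = _)).ge
    · exact (congrArg measure (h : χ = _)).ge

/-- A thread in which some `q (φ U ψ)` occurs infinitely often is in the end confined to `q (φ U ψ)` and
`q X q (φ U ψ)`. -/
theorem thread_eventually {r : ℕ → Rule ϑ} {t : ℕ → CTL}
    (hc : ∀ i, Connected (r i) (t i) (t (i + 1))) {q : Quant} {φ ψ : CTL}
    (hf : ∃ᶠ i in atTop, t i = untl q φ ψ) :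
    ∃ N, ∀ i ≥ N, t i = untl q φ ψ ∨ t i = next q (untl q φ ψ) := by
  have anti : Antitone fun i => (t i).measure := antitone_nat_of_succ_le fun i => (hc i).measure_le
  rw [frequently_atTop] at hf
  have hm : ∀ i, (untl q φ ψ).measure ≤ (t i).measure := by
    intro i
    obtain ⟨j, hj, h⟩ := hf i
    have := anti hj
    simp only [h] at this
    exact this
  obtain ⟨N, -, hN⟩ := hf 0
  refine ⟨N, fun i hi => ?_⟩
  induction i, hi using Nat.le_induction with
  | base => exact Or.inl hN
  | succ i hi ih =>
    have hcon := hc i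
    have hmi := hm (i + 1)
    rcases ih with ih | ih
    · rw [ih] at hcon
      cases hr : r i with
      | reduce ρ b =>
        rw [hr] at hcon
        rcases hcon with ⟨-, D, hD, hχ⟩ | ⟨-, h⟩
        · cases b <;> simp only [reduct, Option.some.injEq] at hD <;> subst hD
          · rw [Finset.mem_singleton.1 hχ] at hmi
            simp only [measure] at hmi; omega
          · rcases Finset.mem_insert.1 hχ with h | h
            · rw [h] at hmi
              simp only [measure] at hmi
              have := measure_pos ψ
              omega
            · exact Or.inr (Finset.mem_singleton.1 h)
        · exact Or.inl h
      | x0 => rw [hr] at hcon; exact absurd hcon (by simp [Connected])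
      | x1 ρ => rw [hr] at hcon; exact absurd hcon (by simp [Connected])
    · rw [ih] at hcon
      cases hr : r i with
      | reduce ρ b =>
        rw [hr] at hcon
        rcases hcon with ⟨-, D, hD, hχ⟩ | ⟨-, h⟩
        · simp [reduct] at hD
        · exact Or.inr h
      | x0 =>
        rw [hr] at hcon
        simp only [Connected, next.injEq] at hcon
        exact Or.inl hcon.2.symm
      | x1 ρ =>
        rw [hr] at hcon
        simp only [Connected, next.injEq] at hcon
        rcases hcon with h | h
        · exact Or.inl h.2.symm
        · exact Or.inl h.1.2.symm

/-! ### The automaton -/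

def IsUntl : CTL → Bool
  | untl _ _ _ => true
  | _ => false

def IsA : CTL → Bool
  | untl .A _ _ => true
  | _ => false

/-- How tokens on the formula `χ` (the first one) and on `q X χ` (the second one) are moved. -/
def advance (χ : CTL) (r : Rule ϑ) (a b : Bool) : Bool × Bool :=
  match r with
  | .reduce ρ c => if ρ.1 = χ then (false, b || (a && c)) else (a, b)
  | .x0 => (b && χ.IsA, false)
  | .x1 ρ => (b && (χ.IsA || decide (ρ.1 = χ)), false)

/-- There is a cyclic permutation of every finite type. -/
theorem exists_cycle (α : Type) [Finite α] : ∃ f : α → α, ∀ x y, ∃ n, f^[n] x = y := by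
  rcases isEmpty_or_nonempty α with h | h
  · exact ⟨id, fun x => h.elim x⟩
  · obtain ⟨n, e, -⟩ : ∃ n, ∃ _ : α ≃ ZMod (n + 1), True := by
      obtain ⟨n, ⟨e⟩⟩ := Finite.exists_equiv_fin α
      obtain ⟨n, rfl⟩ : ∃ m, n = m + 1 :=
        Nat.exists_eq_succ_of_ne_zero fun h0 => by subst h0; exact (e h.some).elim0
      exact ⟨n, e, trivial⟩
    refine ⟨fun x => e.symm (e x + 1), fun x y => ⟨(e y - e x).val, ?_⟩⟩
    have : ∀ k : ℕ, (fun x => e.symm (e x + 1))^[k] x = e.symm (e x + (k : ZMod (n + 1))) := by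
      intro k
      induction k with
      | zero => simp
      | succ k ih => rw [Function.iterate_succ_apply', ih]; simp [add_assoc]
    rw [this]
    simp

def Focus (ϑ : CTL) : Type := {χ : CTL // χ ∈ ϑ.closure}

instance (ϑ : CTL) : Finite (Focus ϑ) := Finset.finite_toSet ϑ.closure

noncomputable def cycle (ϑ : CTL) : Focus ϑ → Focus ϑ := (exists_cycle (Focus ϑ)).choose

/-- No token is on the `U`-formula in the focus. -/
def Idle (x : Focus ϑ × Bool × Bool) : Prop :=
  x.1.1.IsUntl = false ∨ (x.2.1 = false ∧ x.2.2 = false)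

instance (x : Focus ϑ × Bool × Bool) : Decidable (Idle x) := by unfold Idle; infer_instance

theorem self_mem_closure (ϑ : CTL) : ϑ ∈ ϑ.closure := by simp [closure, self_mem_sub]

/-- The automaton checks the formulas of the closure one after the other, and follows the tokens on the
formula in the focus until all of them have disappeared. -/
noncomputable def automaton (ϑ : CTL) : DBA (Rule ϑ) where
  State := Focus ϑ × Bool × Bool
  finite := inferInstance
  init := (⟨ϑ, self_mem_closure ϑ⟩, true, true)
  step x r := if Idle x then (cycle ϑ x.1, true, true) else (x.1, advance x.1.1 r x.2.1 x.2.2)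
  final := {x | Idle x}

section

variable {C : ℕ → Config ϑ} {r : ℕ → Rule ϑ} {x : ℕ → Focus ϑ × Bool × Bool}

/-- Each idle state moves the focus one place along the cycle and sets both tokens anew. If this
happens infinitely often, the focus passes through every formula of the closure arbitrarily late. -/
theorem exists_focus (hx : ∀ n, x (n + 1) = (automaton ϑ).step (x n) (r n))
    (hf : ∃ᶠ n in atTop, Idle (x n)) (N : ℕ) (χ : Focus ϑ) : ∃ n ≥ N, x n = (χ, true, true) := by
  have hx' : ∀ n, x (n + 1) = if Idle (x n) then (cycle ϑ (x n).1, true, true) else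
    ((x n).1, advance (x n).1.1 (r n) (x n).2.1 (x n).2.2) := hx
  rw [frequently_atTop] at hf
  have one : ∀ n, ∃ m > n, x m = (cycle ϑ (x n).1, true, true) := by
    intro n
    have hex : ∃ m, m ≥ n ∧ Idle (x m) := hf n
    have hk : ∀ k, n + k ≤ Nat.find hex → (x (n + k)).1 = (x n).1 := by
      intro k
      induction k with
      | zero => exact fun _ => rfl
      | succ k ih =>
        intro hk
        have hnot : ¬ Idle (x (n + k)) := fun h =>
          Nat.find_min hex (m := n + k) (by omega) ⟨by omega, h⟩
        rw [← add_assoc, hx', if_neg hnot]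
        exact ih (by omega)
    obtain ⟨h1, h2⟩ := Nat.find_spec hex
    refine ⟨Nat.find hex + 1, by omega, ?_⟩
    have := hk (Nat.find hex - n) (by omega)
    rw [Nat.add_sub_cancel' h1] at this
    rw [hx', if_pos h2, this]
  have many : ∀ j, ∃ n ≥ N, x n = ((cycle ϑ)^[j] (cycle ϑ (x N).1), true, true) := by
    intro j
    induction j with
    | zero =>
      obtain ⟨m, hm, h⟩ := one N
      exact ⟨m, hm.le, h⟩
    | succ j ih =>
      obtain ⟨n, hn, h⟩ := ih
      obtain ⟨m, hm, h'⟩ := one n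
      refine ⟨m, by omega, ?_⟩
      rw [h', h, Function.iterate_succ_apply']
  obtain ⟨j, hj⟩ := (exists_cycle (Focus ϑ)).choose_spec (cycle ϑ (x N).1) χ
  obtain ⟨n, hn, h⟩ := many j
  exact ⟨n, hn, by rw [h]; exact congrArg (·, true, true) hj⟩

/-- Tokens over-approximate threads: a thread that stays on the formula in focus and its `X`-version
always stands on a token. -/
theorem advance_of_connected {q : Quant} {φ ψ t t' : CTL} {ρ : Rule ϑ} {a b : Bool}
    (h : Connected ρ t t') (ht : t = untl q φ ψ ∧ a = true ∨ t = next q (untl q φ ψ) ∧ b = true)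
    (ht' : t' = untl q φ ψ ∨ t' = next q (untl q φ ψ)) :
    t' = untl q φ ψ ∧ (advance (untl q φ ψ) ρ a b).1 = true ∨
      t' = next q (untl q φ ψ) ∧ (advance (untl q φ ψ) ρ a b).2 = true := by
  have hne : next q (untl q φ ψ) ≠ untl q φ ψ := by simp
  cases ρ with
  | reduce ρ c =>
    rcases h with ⟨rfl, D, hD, hm⟩ | ⟨hne', rfl⟩
    · rcases ht with ⟨ht, rfl⟩ | ⟨ht, rfl⟩
      · rcases ht' with rfl | rfl
        · exfalso
          rw [ht] at hD
          rcases measure_reduct_lt hD hm with h | ⟨q', h, -⟩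
          · exact lt_irrefl _ h
          · simp at h
        · right
          rw [ht] at hD
          rcases measure_reduct_lt hD hm with h | ⟨q', -, rfl⟩
          · exact absurd h (lt_irrefl _)
          · simp [advance, ht]
      · rw [ht] at hD; simp [reduct] at hD
    · rcases ht with ⟨ht, rfl⟩ | ⟨ht, rfl⟩
      · subst ht
        exact Or.inl ⟨rfl, by simp [advance, Ne.symm hne']⟩
      · refine Or.inr ⟨ht, ?_⟩
        simp only [advance]; split_ifs <;> rfl
  | x0 =>
    simp only [Connected] at h
    rcases ht with ⟨ht, rfl⟩ | ⟨ht, rfl⟩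
    · rw [ht] at h; simp at h
    · rw [ht] at h
      simp only [next.injEq] at h
      obtain ⟨rfl, rfl⟩ := h
      simp [advance, IsA]
  | x1 ρ =>
    simp only [Connected] at h
    rcases ht with ⟨ht, rfl⟩ | ⟨ht, rfl⟩
    · rw [ht] at h; simp at h
    · rw [ht] at h
      simp only [next.injEq] at h
      rcases h with ⟨rfl, rfl⟩ | ⟨⟨rfl, rfl⟩, h⟩
      · simp [advance, IsA]
      · simp [advance, IsA, ← h]

/-- If the automaton were idle infinitely often, the formula of the thread would come into focus,
with both tokens set, after the thread has become confined. From then on the thread keeps a token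
alive and the automaton is never idle again. No initial condition on the play or the run is needed,
which allows the application to tails of plays. -/
theorem not_frequently_idle (hx : ∀ n, x (n + 1) = (automaton ϑ).step (x n) (r n))
    (ht : HasUThread C r) : ¬ ∃ᶠ n in atTop, Idle (x n) := by
  intro hf
  obtain ⟨t, htC, hc, q, φ, ψ, hu⟩ := ht
  obtain ⟨N, hN⟩ := thread_eventually hc hu
  obtain ⟨i, -, hi⟩ := frequently_atTop.1 hu 0
  have hcl : untl q φ ψ ∈ ϑ.closure := hi ▸ (C i).2.1 (htC i)
  obtain ⟨n, hn, hxn⟩ := exists_focus hx hf N ⟨_, hcl⟩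
  have inv : ∀ m ≥ n, (x m).1 = ⟨_, hcl⟩ ∧ (t m = untl q φ ψ ∧ (x m).2.1 = true ∨
      t m = next q (untl q φ ψ) ∧ (x m).2.2 = true) := by
    intro m hm
    induction m, hm using Nat.le_induction with
    | base =>
      rw [hxn]
      exact ⟨rfl, (hN n hn).imp (fun h => ⟨h, rfl⟩) fun h => ⟨h, rfl⟩⟩
    | succ m hm ih =>
      have hidle : ¬ Idle (x m) := by
        rintro (h | ⟨h1, h2⟩)
        · rw [ih.1] at h; simp [IsUntl] at h
        · rw [h1, h2] at ih; simp at ih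
      have e : x (m + 1) = ((x m).1, advance (x m).1.1 (r m) (x m).2.1 (x m).2.2) := by
        rw [hx]; exact if_neg hidle
      rw [e]
      refine ⟨ih.1, ?_⟩
      have := advance_of_connected (hc m) ih.2 (hN (m + 1) (by omega))
      rw [ih.1]
      exact this
  obtain ⟨m, hm, hidle⟩ := frequently_atTop.1 hf n
  obtain ⟨h1, h2⟩ := inv m hm
  rcases hidle with h | ⟨h, h'⟩
  · rw [h1] at h; simp [IsUntl] at h
  · rw [h, h'] at h2; simp at h2

/-- The formula on which the token is. -/
def token (χ : CTL) (q : Quant) (a : Bool) : CTL := if a then χ else next q χ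

/-- The converse of the over-approximation, for a single token that really lies on a formula of the
configuration: as long as it survives it remains single, lies on a formula of the configuration, and
moves along a thread. -/
theorem connected_advance {q : Quant} {φ ψ : CTL} {D D' : Finset CTL} {ρ : Rule ϑ} {a b : Bool}
    (h : Step D ρ D') (hab : b = !a) (hmem : token (untl q φ ψ) q a ∈ D)
    (hne : ¬ ((advance (untl q φ ψ) ρ a b).1 = false ∧ (advance (untl q φ ψ) ρ a b).2 = false)) :
    (advance (untl q φ ψ) ρ a b).2 = !(advance (untl q φ ψ) ρ a b).1 ∧
      token (untl q φ ψ) q (advance (untl q φ ψ) ρ a b).1 ∈ D' ∧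
      Connected ρ (token (untl q φ ψ) q a) (token (untl q φ ψ) q (advance (untl q φ ψ) ρ a b).1) := by
  subst hab
  cases h with
  | @reduce R ρ c hC hρ hD =>
    by_cases h : ρ.1 = untl q φ ψ
    · cases a with
      | true =>
        cases c with
        | false => simp [advance, h] at hne
        | true =>
          have hD' := hD
          rw [h] at hD'
          simp only [reduct, Option.some.injEq] at hD'
          simp only [advance, h, if_true, token, Bool.false_eq_true, if_false, Bool.not_true,
            Bool.false_or, Bool.and_true, Bool.not_false, true_and]
          refine ⟨Finset.mem_union_right _ (by rw [← hD']; simp), Or.inl ⟨h.symm, R, ?_, ?_⟩⟩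
          · rw [← h]; exact hD
          · rw [← hD']; simp
      | false =>
        simp only [token, Bool.false_eq_true, if_false] at hmem
        have hne' : next q (untl q φ ψ) ≠ ρ.1 := by rw [h]; simp
        simp only [advance, h, if_true, token, Bool.false_eq_true, if_false, Bool.not_false,
          Bool.false_and, Bool.true_or, true_and]
        exact ⟨Finset.mem_union_left _ (Finset.mem_erase.2 ⟨by simp, hmem⟩), Or.inr ⟨hne', rfl⟩⟩
    · have hne' : token (untl q φ ψ) q a ≠ ρ.1 := by
        cases a with
        | true => exact Ne.symm h
        | false =>
          intro e
          rw [← e] at hD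
          simp [token, reduct] at hD
      simp only [advance, h, if_false, true_and]
      exact ⟨Finset.mem_union_left _ (Finset.mem_erase.2 ⟨hne', hmem⟩), Or.inr ⟨hne', rfl⟩⟩
  | x0 _ _ hE hA =>
    cases a with
    | true => simp [advance] at hne
    | false =>
      cases q with
      | E => simp [advance, IsA] at hne
      | A =>
        simp only [advance, IsA, token, Bool.false_eq_true, if_false, Bool.not_false, Bool.and_true,
          Bool.not_true, if_true, true_and] at hmem ⊢
        exact ⟨mem_universalPart.2 hmem, rfl⟩
  | @x1 ρ hC hρ =>
    cases a with
    | true => simp [advance] at hne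
    | false =>
      cases q with
      | E =>
        by_cases h : ρ.1 = untl .E φ ψ
        · simp [advance, IsA, h, token, Connected]
        · simp [advance, IsA, h] at hne
      | A =>
        simp only [advance, IsA, token, Bool.false_eq_true, if_false, Bool.not_false,
          Bool.not_true, if_true, true_and, Bool.true_or, Bool.true_and] at hmem ⊢
        exact ⟨Finset.mem_insert_of_mem (mem_universalPart.2 hmem), Or.inl rfl⟩

theorem advance_isModal {χ : CTL} {ρ : Rule ϑ} {a b : Bool} (h : ρ.IsModal) :
    (advance χ ρ a b).2 = false ∧ ((advance χ ρ a b).1 = true → b = true) := by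
  cases ρ with
  | reduce _ _ => exact h.elim
  | x0 => simp only [advance, true_and]; cases b <;> simp
  | x1 _ => simp only [advance, true_and]; cases b <;> simp

/-- The automaton sees rules but not configurations, so the tokens set at a change of focus may lie
on formulas that are absent. If it is never idle again, a modal rule leaves just the token on `χ`,
and this token has to move to `QXχ` before the next modal rule. That move is an unfolding of `χ`,
which shows that `χ` is present; from there the token traces a true thread. It returns to `χ` at
each modal rule, hence infinitely often. -/
theorem hasUThread_of_not_idle (hstep : ∀ i, Step (C i).1 (r i) (C (i + 1)).1)
    (hx : ∀ n, x (n + 1) = (automaton ϑ).step (x n) (r n)) (hf : ¬ ∃ᶠ n in atTop, Idle (x n)) :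
    HasUThread C r := by
  rw [frequently_atTop] at hf
  push Not at hf
  obtain ⟨N, hN⟩ := hf
  obtain ⟨q, φ, ψ, hχ⟩ : ∃ q φ ψ, (x N).1.1 = untl q φ ψ := by
    have := hN N le_rfl
    simp only [Idle, not_or] at this
    generalize (x N).1.1 = χ at this ⊢
    cases χ <;> simp [IsUntl] at this ⊢
  have hx' : ∀ n ≥ N, (x n).1.1 = untl q φ ψ ∧
      (x (n + 1)).2 = advance (untl q φ ψ) (r n) (x n).2.1 (x n).2.2 := by
    intro n hn
    have e : ∀ n ≥ N, x (n + 1) = ((x n).1, advance (x n).1.1 (r n) (x n).2.1 (x n).2.2) := by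
      intro n hn
      rw [hx]; exact if_neg (hN n hn)
    have hfoc : (x n).1.1 = untl q φ ψ := by
      induction n, hn using Nat.le_induction with
      | base => exact hχ
      | succ n hn ih => rw [e n hn]; exact ih
    refine ⟨hfoc, ?_⟩
    rw [e n hn, hfoc]
  have hne : ∀ n ≥ N, ¬ ((x n).2.1 = false ∧ (x n).2.2 = false) := by
    intro n hn h
    exact hN n hn (Or.inr h)
  -- after a modal rule there is exactly one token
  have hmod : ∀ n ≥ N, (r n).IsModal → (x (n + 1)).2.1 = true ∧ (x (n + 1)).2.2 = false ∧
      (x n).2.2 = true := by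
    intro n hn hr
    obtain ⟨h1, h2⟩ := advance_isModal (χ := untl q φ ψ) (a := (x n).2.1) (b := (x n).2.2) hr
    rw [← (hx' n hn).2] at h1 h2
    have h3 := hne (n + 1) (by omega)
    rw [h1] at h3
    have h4 : (x (n + 1)).2.1 = true := by simpa using h3
    exact ⟨h4, h1, h2 h4⟩
  obtain ⟨i₁, hi₁, hm₁⟩ := exists_isModal hstep N
  obtain ⟨i₂, hi₂, hm₂⟩ := exists_isModal hstep (i₁ + 1)
  obtain ⟨ha₁, hb₁, -⟩ := hmod i₁ hi₁ hm₁
  obtain ⟨-, -, hb₂⟩ := hmod i₂ (by omega) hm₂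
  -- the first time that the token is on the second formula
  have hex : ∃ n, n > i₁ ∧ (x n).2.2 = true := ⟨i₂, hi₂, hb₂⟩
  obtain ⟨hn₀, hbn⟩ := Nat.find_spec hex
  set n₀ := Nat.find hex with hn₀def
  obtain ⟨k, hk⟩ : ∃ k, n₀ = k + 1 := ⟨n₀ - 1, by omega⟩
  have hki : k > i₁ := by
    rcases Nat.lt_or_ge i₁ k with h | h
    · exact h
    · have : k = i₁ := by omega
      rw [hk, this, hb₁] at hbn; simp at hbn
  have hbk : (x k).2.2 = false := by
    have := Nat.find_min hex (m := k) (by omega)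
    simpa [hki] using this
  have hak : (x k).2.1 = true := by
    have := hne k (by omega)
    simpa [hbk] using this
  have hadv := (hx' k (by omega)).2
  rw [hak, hbk] at hadv
  rw [hk, hadv] at hbn
  -- Only the unfolding of the formula in focus creates the second token, and a principal formula
  -- belongs to the configuration.
  obtain ⟨ρ, hρ, hρu⟩ : ∃ ρ, r k = .reduce ρ true ∧ ρ.1 = untl q φ ψ := by
    cases hr : r k with
    | reduce ρ c =>
      rw [hr] at hbn
      by_cases h : ρ.1 = untl q φ ψ
      · cases c with
        | true => exact ⟨ρ, rfl, h⟩
        | false => simp [advance, h] at hbn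
      · simp [advance, h] at hbn
    | x0 => rw [hr] at hbn; simp [advance] at hbn
    | x1 ρ => rw [hr] at hbn; simp [advance] at hbn
  have hmemk : token (untl q φ ψ) q (x k).2.1 ∈ (C k).1 := by
    have := hstep k
    rw [hρ] at this
    generalize hD' : (C (k + 1)).1 = D' at this
    cases this with
    | @reduce D _ _ _ h _ => simpa [hak, token, ← hρu] using h
  have inv : ∀ n ≥ k, (x n).2.2 = (!(x n).2.1) ∧ token (untl q φ ψ) q (x n).2.1 ∈ (C n).1 := by
    intro n hn
    induction n, hn using Nat.le_induction with
    | base => exact ⟨by rw [hak, hbk]; rfl, hmemk⟩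
    | succ n hn ih =>
      have h1 := (hx' n (by omega)).2
      have h2 := hne (n + 1) (by omega)
      rw [h1] at h2 ⊢
      have h3 := connected_advance (hstep n) ih.1 ih.2 h2
      exact ⟨h3.1, h3.2.1⟩
  refine hasUThread_of_shift k hstep ⟨fun i => token (untl q φ ψ) q (x (i + k)).2.1,
    fun i => (inv (i + k) (by omega)).2, fun i => ?_, q, φ, ψ, ?_⟩
  · have ih := inv (i + k) (by omega)
    have h1 := (hx' (i + k) (by omega)).2
    have h2 := hne (i + k + 1) (by omega)
    rw [h1] at h2
    have h3 := (connected_advance (hstep (i + k)) ih.1 ih.2 h2).2.2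
    rw [← h1] at h3
    rw [add_right_comm i k 1] at h3
    exact h3
  · rw [frequently_atTop]
    intro M
    obtain ⟨i, hi, hm⟩ := exists_isModal hstep (M + k)
    refine ⟨i + 1 - k, by omega, ?_⟩
    change token _ q (x (i + 1 - k + k)).2.1 = _
    rw [Nat.sub_add_cancel (by omega), (hmod i (by omega) hm).1]
    rfl

theorem frequently_idle_iff (hstep : ∀ i, Step (C i).1 (r i) (C (i + 1)).1)
    (hx : ∀ n, x (n + 1) = (automaton ϑ).step (x n) (r n)) :
    (∃ᶠ n in atTop, Idle (x n)) ↔ ¬ HasUThread C r :=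
  ⟨fun h ht => not_frequently_idle hx ht h, fun h => by_contra fun hf =>
    h (hasUThread_of_not_idle hstep hx hf)⟩

end

theorem recognises (ϑ : CTL) : RecognisesWinningPlays ϑ (automaton ϑ) := fun _ r h =>
  frequently_idle_iff (x := (automaton ϑ).run r) h.step fun _ => rfl

end CTL

/-! ### The satisfiability game characterises satisfiability -/

namespace CTL

variable {ϑ : CTL}

theorem sub_subset {φ ψ : CTL} (h : φ ∈ ψ.sub) : φ.sub ⊆ ψ.sub := by
  induction ψ with
  | next q ψ ih =>
    rcases Finset.mem_insert.1 h with rfl | h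
    · exact subset_rfl
    · exact (ih h).trans (Finset.subset_insert _ _)
  | or ψ χ ih ih' | and ψ χ ih ih' | untl _ ψ χ ih ih' | rel _ ψ χ ih ih' =>
    rcases Finset.mem_insert.1 h with rfl | h
    · exact subset_rfl
    · rcases Finset.mem_union.1 h with h | h
      · exact (ih h).trans (Finset.subset_union_left.trans (Finset.subset_insert _ _))
      · exact (ih' h).trans (Finset.subset_union_right.trans (Finset.subset_insert _ _))
  | _ =>
    simp only [sub, Finset.mem_singleton] at h
    subst h; exact subset_rfl

theorem sub_subset_closure : ϑ.sub ⊆ ϑ.closure :=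
  Finset.subset_union_left.trans Finset.subset_union_left

theorem next_mem_closure {q : Quant} {φ : CTL} (h : φ ∈ ϑ.sub) : next q φ ∈ ϑ.closure := by
  cases q with
  | E => exact Finset.mem_union_left _ (Finset.mem_union_right _ (Finset.mem_image_of_mem _ h))
  | A => exact Finset.mem_union_right _ (Finset.mem_image_of_mem _ h)

theorem mem_sub_of_next {q : Quant} {φ : CTL} (h : next q φ ∈ ϑ.closure) : φ ∈ ϑ.sub := by
  simp only [closure, Finset.mem_union, Finset.mem_image, next.injEq] at h
  rcases h with (h | ⟨χ, h, -, rfl⟩) | ⟨χ, h, -, rfl⟩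
  · exact sub_subset h (Finset.mem_insert_of_mem (self_mem_sub φ))
  · exact h
  · exact h

theorem mem_sub_of_closure {φ : CTL} (h : φ ∈ ϑ.closure) (hφ : ∀ q χ, φ ≠ next q χ) : φ ∈ ϑ.sub := by
  simp only [closure, Finset.mem_union, Finset.mem_image] at h
  rcases h with (h | ⟨χ, -, rfl⟩) | ⟨χ, -, rfl⟩
  · exact h
  · exact absurd rfl (hφ _ _)
  · exact absurd rfl (hφ _ _)

theorem reduct_subset {φ : CTL} {b : Bool} {D : Finset CTL} (hφ : φ ∈ ϑ.closure)
    (h : φ.reduct b = some D) : D ⊆ ϑ.closure ∧ D.Nonempty := by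
  have hsub : φ ∈ ϑ.sub := mem_sub_of_closure hφ (by rintro q χ rfl; simp [reduct] at h)
  have hs := sub_subset hsub
  have key : ∀ χ ∈ φ.sub, χ ∈ ϑ.closure := fun χ hχ => sub_subset_closure (hs hχ)
  cases φ <;> cases b <;> simp only [reduct, Option.some.injEq, reduceCtorEq] at h <;> subst h
  all_goals
    refine ⟨fun χ hχ => ?_, by simp⟩
    simp only [Finset.mem_insert, Finset.mem_singleton] at hχ
    first
      | (rcases hχ with hχ | hχ <;> rw [hχ])
      | rw [hχ]
    all_goals
      first
        | exact next_mem_closure hsub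
        | exact key _ (by simp [sub, self_mem_sub])

theorem Step.subset_closure {C C' : Finset CTL} {r : Rule ϑ} (hC : C ⊆ ϑ.closure)
    (h : Step C r C') : C' ⊆ ϑ.closure ∧ C'.Nonempty := by
  have huniv : universalPart C ⊆ ϑ.closure := fun χ hχ =>
    sub_subset_closure (mem_sub_of_next (hC (mem_universalPart.1 hχ)))
  cases h with
  | @reduce D φ b _ hφ hD =>
    obtain ⟨h1, h2⟩ := reduct_subset φ.2 hD
    exact ⟨Finset.union_subset ((Finset.erase_subset _ _).trans hC) h1,
      h2.mono Finset.subset_union_right⟩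
  | x0 _ _ _ hA =>
    obtain ⟨φ, hφ⟩ := hA
    exact ⟨huniv, φ, mem_universalPart.2 hφ⟩
  | @x1 φ _ _ => exact ⟨Finset.insert_subset φ.2 huniv, Finset.insert_nonempty _ _⟩

/-- The configuration that a rule application leads to. -/
theorem Step.exists_config {C : Config ϑ} {C' : Finset CTL} {r : Rule ϑ} (h : Step C.1 r C') :
    ∃ D : Config ϑ, D.1 = C' := ⟨⟨C', h.subset_closure C.2.1⟩, rfl⟩

theorem Step.consistent {C C' : Finset CTL} {r : Rule ϑ} (h : Step C r C') : Consistent C := by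
  cases h with
  | reduce h _ _ => exact h
  | x0 h _ _ _ => exact h
  | x1 h _ => exact h.1

theorem reduct_of_isLiteralOrNext {χ : CTL} {b : Bool} {D : Finset CTL} (h : χ.IsLiteralOrNext)
    (hD : χ.reduct b = some D) : False := by
  cases χ <;> simp [IsLiteralOrNext, IsLiteral, reduct] at h hD

theorem isLiteral_of {χ : CTL} (h : χ.IsLiteralOrNext) (hn : ∀ q φ, χ ≠ next q φ) :
    χ.IsLiteral := by
  cases χ <;> simp [IsLiteralOrNext, IsLiteral] at h hn ⊢

theorem isLiteral_of_not_applicable {C : Config ϑ} (hC : Consistent C.1) (h : ¬ Applicable C) :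
    ∀ χ ∈ C.1, χ.IsLiteral := by
  have hno : ∀ (r : Rule ϑ) (C' : Finset CTL), ¬ Step C.1 r C' := fun r C' hs => by
    obtain ⟨D, rfl⟩ := hs.exists_config
    exact h ⟨r, D, hs⟩
  have hmodal : ∀ χ ∈ C.1, χ.IsLiteralOrNext := by
    intro χ hχ
    by_contra hcon
    obtain ⟨D, hD⟩ := reduct_isSome hcon
    exact hno _ _ (.reduce (φ := ⟨χ, C.2.1 hχ⟩) hC hχ hD)
  have hE : ∀ φ, next .E φ ∉ C.1 := fun φ hφ =>
    hno _ _ (.x1 (φ := ⟨φ, sub_subset_closure (mem_sub_of_next (C.2.1 hφ))⟩) ⟨hC, hmodal, φ, hφ⟩ hφ)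
  refine fun χ hχ => isLiteral_of (hmodal χ hχ) ?_
  rintro q φ rfl
  cases q with
  | E => exact hE φ hχ
  | A => exact hno _ _ (.x0 hC hmodal hE ⟨φ, hχ⟩)

/-- The satisfiability game with the automaton. -/
noncomputable abbrev game (ϑ : CTL) : BuchiGame (Config ϑ × (automaton ϑ).State) :=
  satGame ϑ (automaton ϑ)

noncomputable instance (ϑ : CTL) : Finite (automaton ϑ).State := (automaton ϑ).finite

/-! #### From models to winning strategies -/

/-- A step of a play together with a step in a model. -/
structure Follows (T : TransitionSystem) (v : Config ϑ × (automaton ϑ).State) (s : T.State)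
    (r : Rule ϑ) (v' : Config ϑ × (automaton ϑ).State) (s' : T.State) : Prop where
  step : Step v.1.1 r v'.1.1
  aut : v'.2 = (automaton ϑ).step v.2 r
  stay : ¬ r.IsModal → s' = s
  move : r.IsModal → T.rel s s'
  untl : ∀ ρ q φ ψ, r = .reduce ρ true → ρ.1 = CTL.untl q φ ψ → ¬ T.Sat ψ s
  dist : ∀ ρ φ ψ, r = .x1 ρ → ρ.1 = CTL.untl .E φ ψ →
    ∀ s'', T.rel s s'' → T.Sat (.untl .E φ ψ) s'' → T.distance φ ψ s' ≤ T.distance φ ψ s''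

/-- Truth in the state selects the alternative. For `U` the left one is preferred, so a `U`-formula
is unfolded only in states where it cannot be fulfilled at once. -/
theorem exists_reduct_sat {T : TransitionSystem} {s : T.State} {χ : CTL} (h : T.Sat χ s)
    (hχ : ¬ χ.IsLiteralOrNext) : ∃ b D, χ.reduct b = some D ∧ (∀ χ' ∈ D, T.Sat χ' s) ∧
      ∀ q φ ψ, χ = untl q φ ψ → b = true → ¬ T.Sat ψ s := by
  cases χ with
  | or φ ψ =>
    rcases h with h | h
    · exact ⟨false, {φ}, rfl, by simpa using h, by simp⟩
    · exact ⟨true, {ψ}, rfl, by simpa using h, by simp⟩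
  | and φ ψ =>
    exact ⟨false, {φ, ψ}, rfl, by simpa using (show T.Sat φ s ∧ T.Sat ψ s from h), by simp⟩
  | untl q φ ψ =>
    by_cases hψ : T.Sat ψ s
    · exact ⟨false, {ψ}, rfl, by simpa using hψ, by simp⟩
    · have := (TransitionSystem.sat_untl.1 h).resolve_left hψ
      refine ⟨true, _, rfl, by simpa using this, ?_⟩
      rintro q φ ψ h - h'
      injection h with _ _ h
      exact hψ (h ▸ h')
  | rel q φ ψ =>
    obtain ⟨hψ, h | h⟩ := TransitionSystem.sat_rel.1 h
    · exact ⟨false, {φ, ψ}, rfl, by simpa using ⟨h, hψ⟩, by simp⟩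
    · exact ⟨true, _, rfl, by simpa using ⟨hψ, h⟩, by simp⟩
  | _ => exact absurd trivial hχ

/-- The choices of player 0 are guided by truth in the model and those of player 1 by the level, so
one round keeps the configuration true and the position outside of the winning region. -/
theorem exists_follows {T : TransitionSystem} {lvl : Config ϑ × (automaton ϑ).State → ℕ}
    (hl : ∀ v ∉ (game ϑ).win,
      (v ∈ (game ϑ).player0 → ∀ u, (game ϑ).edge v u →
        u ∉ (game ϑ).win ∧ lvl u ≤ lvl v ∧ (v ∈ (game ϑ).accepting → lvl u < lvl v)) ∧
      (v ∉ (game ϑ).player0 → ∃ u, (game ϑ).edge v u ∧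
        u ∉ (game ϑ).win ∧ lvl u ≤ lvl v ∧ (v ∈ (game ϑ).accepting → lvl u < lvl v)))
    {v : Config ϑ × (automaton ϑ).State} {s : T.State} (hv : v ∉ (game ϑ).win)
    (hs : ∀ χ ∈ v.1.1, T.Sat χ s) :
    ∃ r v' s', Follows T v s r v' s' ∧ v' ∉ (game ϑ).win ∧ (∀ χ ∈ v'.1.1, T.Sat χ s') ∧
      lvl v' ≤ lvl v ∧ (v ∈ (game ϑ).accepting → lvl v' < lvl v) := by
  have hC : Consistent v.1.1 := ⟨fun h => hs _ h, fun p h => hs _ h.2 (hs _ h.1)⟩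
  have hstep : ∀ {r C'}, v ∈ (game ϑ).player0 → Step v.1.1 r C' →
      ∃ v', Step v.1.1 r v'.1.1 ∧ v'.1.1 = C' ∧ v'.2 = (automaton ϑ).step v.2 r ∧
        v' ∉ (game ϑ).win ∧ lvl v' ≤ lvl v ∧ (v ∈ (game ϑ).accepting → lvl v' < lvl v) := by
    intro r C' h0 h
    obtain ⟨D, rfl⟩ := h.exists_config
    exact ⟨(D, (automaton ϑ).step v.2 r), h, rfl, rfl, (hl v hv).1 h0 _ (Or.inl ⟨r, h, rfl⟩)⟩
  by_cases hmodal : ∀ χ ∈ v.1.1, χ.IsLiteralOrNext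
  · by_cases hE : ∃ φ, next .E φ ∈ v.1.1
    · have hX : X1Applies v.1.1 := ⟨hC, hmodal, hE⟩
      obtain ⟨v', he, hv', hl'⟩ := (hl v hv).2 fun h => h hX
      rcases he with ⟨r, h, ha⟩ | ⟨hna, -⟩
      · obtain ⟨ρ, rfl⟩ : ∃ ρ, r = .x1 ρ := by
          generalize v'.1.1 = C' at h
          cases h with
          | reduce _ hφ hD => exact (reduct_of_isLiteralOrNext (hmodal _ hφ) hD).elim
          | x0 _ _ hE' _ => exact absurd hE.choose_spec (hE' _)
          | @x1 ρ _ _ => exact ⟨ρ, rfl⟩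
        have hρ : next .E ρ.1 ∈ v.1.1 ∧ v'.1.1 = insert ρ.1 (universalPart v.1.1) := by
          generalize v'.1.1 = C' at h
          cases h with
          | x1 _ h => exact ⟨h, rfl⟩
        -- For a formula `E (φ U ψ)` the successor is chosen among the satisfying ones with least
        -- distance to fulfilment; this makes threads of such formulas terminate.
        obtain ⟨s', hs', hsat, hmin⟩ : ∃ s', T.rel s s' ∧ T.Sat ρ.1 s' ∧
            ∀ φ ψ, ρ.1 = untl .E φ ψ → ∀ s'', T.rel s s'' → T.Sat (.untl .E φ ψ) s'' →
              T.distance φ ψ s' ≤ T.distance φ ψ s'' := by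
          obtain ⟨s₁, hs₁, hsat₁⟩ := TransitionSystem.sat_next_E.1 (hs _ hρ.1)
          by_cases hu : ∃ φ ψ, ρ.1 = untl .E φ ψ
          · obtain ⟨φ, ψ, hu⟩ := hu
            have hex : ∃ k s', T.rel s s' ∧ T.Sat ρ.1 s' ∧ T.distance φ ψ s' = k :=
              ⟨_, s₁, hs₁, hsat₁, rfl⟩
            classical
            obtain ⟨s', h1, h2, h3⟩ := Nat.find_spec hex
            refine ⟨s', h1, h2, fun φ' ψ' hu' s'' hs'' hsat'' => ?_⟩
            rw [hu] at hu'
            injection hu' with _ e1 e2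
            subst e1 e2
            rw [h3]
            exact Nat.find_min' hex ⟨s'', hs'', hu ▸ hsat'', rfl⟩
          · exact ⟨s₁, hs₁, hsat₁, fun φ ψ h => absurd ⟨φ, ψ, h⟩ hu⟩
        refine ⟨.x1 ρ, v', s', ⟨h, ha, fun h => absurd trivial h, fun _ => hs', nofun, ?_⟩, hv', ?_, hl'⟩
        · rintro ρ' φ ψ e
          injection e with e
          subst e
          exact hmin φ ψ
        · rw [hρ.2]
          intro χ hχ
          rcases Finset.mem_insert.1 hχ with rfl | hχ
          · exact hsat
          · exact TransitionSystem.sat_next_A.1 (hs _ (mem_universalPart.1 hχ)) s' hs'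
      · refine absurd ?_ hna
        obtain ⟨φ, hφ⟩ := hE
        have h := Step.x1 (φ := ⟨φ, sub_subset_closure (mem_sub_of_next (v.1.2.1 hφ))⟩) hX hφ
        obtain ⟨D, hD⟩ := h.exists_config
        exact ⟨_, D, hD ▸ h⟩
    · have h0 : v ∈ (game ϑ).player0 := fun h => hE h.2.2
      by_cases hA : ∃ φ, next .A φ ∈ v.1.1
      · obtain ⟨v', h, hD, ha, hv'⟩ := hstep h0 (.x0 hC hmodal (fun φ hφ => hE ⟨φ, hφ⟩) hA)
        obtain ⟨s', hs'⟩ := T.total s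
        refine ⟨.x0, v', s', ⟨h, ha, fun h => absurd trivial h, fun _ => hs', nofun, nofun⟩, hv'.1,
          ?_, hv'.2⟩
        rw [hD]
        exact fun χ hχ => TransitionSystem.sat_next_A.1 (hs _ (mem_universalPart.1 hχ)) s' hs'
      -- A true configuration without `EX` and `AX` consists of consistent literals. Its position is
      -- accepting and only repeats itself, so its level would have to be less than itself.
      · exfalso
        have hlit : ∀ χ ∈ v.1.1, χ.IsLiteral := by
          refine fun χ hχ => isLiteral_of (hmodal χ hχ) ?_
          rintro q φ rfl
          cases q with
          | E => exact hE ⟨φ, hχ⟩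
          | A => exact hA ⟨φ, hχ⟩
        have hna : ¬ Applicable v.1 := by
          rintro ⟨r, C', h⟩
          generalize C'.1 = C' at h
          cases h with
          | reduce _ hφ hD => exact reduct_of_isLiteralOrNext (hmodal _ hφ) hD
          | x0 _ _ _ hA' => exact hA hA'
          | x1 _ h => exact hE ⟨_, h⟩
        have := ((hl v hv).1 h0 v (Or.inr ⟨hna, rfl⟩)).2.2 (Or.inl ⟨hC, hlit⟩)
        exact lt_irrefl _ this
  · push Not at hmodal
    obtain ⟨χ, hχ, hχ'⟩ := hmodal
    have h0 : v ∈ (game ϑ).player0 := fun h => hχ' (h.2.1 χ hχ)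
    obtain ⟨b, D, hD, hsat, hu⟩ := exists_reduct_sat (hs χ hχ) hχ'
    obtain ⟨v', h, hD', ha, hv'⟩ := hstep h0 (.reduce (φ := ⟨χ, v.1.2.1 hχ⟩) hC hχ hD)
    refine ⟨_, v', s, ⟨h, ha, fun _ => rfl, fun h => h.elim, ?_, nofun⟩, hv'.1, ?_, hv'.2⟩
    · rintro ρ q φ ψ e hρ
      injection e with e1 e2
      subst e1
      exact hu q φ ψ hρ e2
    · rw [hD']
      intro χ' h'
      rcases Finset.mem_union.1 h' with h' | h'
      · exact hs _ (Finset.mem_of_mem_erase h')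
      · exact hsat _ h'

/-! ### `U`-threads followed in a model -/

section

variable {T : TransitionSystem} {v : ℕ → Config ϑ × (automaton ϑ).State} {s : ℕ → T.State}
  {r : ℕ → Rule ϑ} {t : ℕ → CTL} {q : Quant} {φ ψ : CTL} {N : ℕ}

/-- The next step of a `U`-thread in the model. -/
theorem exists_next_untl (h : ∀ i, Follows T (v i) (s i) (r i) (v (i + 1)) (s (i + 1)))
    (hc : ∀ i, Connected (r i) (t i) (t (i + 1)))
    (hN : ∀ i ≥ N, t i = untl q φ ψ ∨ t i = next q (untl q φ ψ)) {i : ℕ} (hi : N ≤ i)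
    (ht : t i = untl q φ ψ) :
    ∃ j > i, t j = untl q φ ψ ∧ T.rel (s i) (s j) ∧ ¬ T.Sat ψ (s i) ∧ (q = .E → ∀ s'',
      T.rel (s i) s'' → T.Sat (.untl .E φ ψ) s'' → T.distance φ ψ (s j) ≤ T.distance φ ψ s'') := by
  classical
  have hex : ∃ k, i ≤ k ∧ (r k).IsModal :=
    (exists_isModal (C := fun i => (v i).1) (fun i => (h i).step) i)
  obtain ⟨hik, hmod⟩ := Nat.find_spec hex
  set k := Nat.find hex with hk
  have hinv : ∀ l, i ≤ l → l ≤ k → s l = s i ∧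
      (t l = untl q φ ψ ∨ (t l = next q (untl q φ ψ) ∧ ¬ T.Sat ψ (s i))) := by
    intro l hl
    induction l, hl using Nat.le_induction with
    | base => exact fun _ => ⟨rfl, Or.inl ht⟩
    | succ l hl ih =>
      intro hlk
      obtain ⟨h1, h2⟩ := ih (by omega)
      have hnm : ¬ (r l).IsModal := fun hm => Nat.find_min hex (m := l) (by omega) ⟨hl, hm⟩
      refine ⟨((h l).stay hnm).trans h1, ?_⟩
      have hcl := hc l
      cases hr : r l with
      | reduce ρ b =>
        rw [hr] at hcl
        rcases hcl with ⟨hρ, D, hD, hm⟩ | ⟨-, he⟩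
        · rcases h2 with h2 | ⟨h2, -⟩
          · rw [h2] at hD hρ
            rcases measure_reduct_lt hD hm with hlt | ⟨q', -, rfl⟩
            · exfalso
              rcases hN (l + 1) (by omega) with e | e <;> rw [e] at hlt <;> exact lt_irrefl _ hlt
            · refine Or.inr ⟨?_, h1 ▸ (h l).untl ρ q φ ψ hr hρ.symm⟩
              refine (hN (l + 1) (by omega)).resolve_left fun e => ?_
              rw [e] at hm
              simp only [reduct, Option.some.injEq] at hD
              subst hD
              rcases Finset.mem_insert.1 hm with e' | e'
              · have := congrArg measure e'
                simp only [measure] at this; omega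
              · simp at e'
          · rw [h2] at hD; simp [reduct] at hD
        · rw [he]; exact h2
      | x0 => exact absurd (hr ▸ trivial) hnm
      | x1 ρ => exact absurd (hr ▸ trivial) hnm
  obtain ⟨h1, h2⟩ := hinv k hik le_rfl
  have hck := hc k
  have hrel := (h k).move hmod
  rw [h1] at hrel
  cases hr : r k with
  | reduce ρ b => rw [hr] at hmod; exact hmod.elim
  | x0 =>
    rw [hr] at hck
    simp only [Connected] at hck
    rcases h2 with h2 | ⟨h2, h3⟩
    · rw [h2] at hck; simp at hck
    · rw [h2] at hck
      simp only [next.injEq] at hck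
      exact ⟨k + 1, by omega, hck.2.symm, hrel, h3, fun hq => by simp [hq] at hck⟩
  | x1 ρ =>
    rw [hr] at hck
    simp only [Connected] at hck
    rcases h2 with h2 | ⟨h2, h3⟩
    · rw [h2] at hck; simp at hck
    · rw [h2] at hck
      simp only [next.injEq] at hck
      rcases hck with hck | ⟨hck, hρ⟩
      · exact ⟨k + 1, by omega, hck.2.symm, hrel, h3, fun hq => by simp [hq] at hck⟩
      · refine ⟨k + 1, by omega, hck.2.symm, hrel, h3, fun hq s'' hs'' hsat => ?_⟩
        refine (h k).dist ρ φ ψ hr ?_ s'' (by rw [h1]; exact hs'') hsat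
        rw [← hρ, ← hck.2, hq]

/-- Every return of a confined thread to its formula is one transition further in the model, with
`ψ` false in the state left behind. For `A` this contradicts the inevitability of `ψ`, by induction
on `Inevitable`; for `E` the distance decreases each time, as the successors were chosen nearest to
fulfilment. -/
theorem not_hasUThread (h : ∀ i, Follows T (v i) (s i) (r i) (v (i + 1)) (s (i + 1)))
    (hs : ∀ i, ∀ χ ∈ (v i).1.1, T.Sat χ (s i)) : ¬ HasUThread (fun i => (v i).1) r := by
  rintro ⟨t, htC, hc, q, φ, ψ, hu⟩
  obtain ⟨N, hN⟩ := thread_eventually hc hu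
  obtain ⟨i, hi, ht⟩ := frequently_atTop.1 hu N
  have hsat : ∀ i, t i = untl q φ ψ → T.Sat (untl q φ ψ) (s i) := fun i h => h ▸ hs i _ (htC i)
  cases q with
  | A =>
    have key : ∀ s₀, T.Inevitable (T.Sat ψ) s₀ → ∀ i ≥ N, t i = untl .A φ ψ → s i = s₀ → False := by
      intro s₀ h0
      induction h0 with
      | now h0 =>
        rintro i hi ht rfl
        obtain ⟨_, _, _, _, h1, _⟩ := exists_next_untl h hc hN hi ht
        exact h1 h0
      | later _ ih =>
        rintro i hi ht rfl
        obtain ⟨j, hj, htj, hrel, -⟩ := exists_next_untl h hc hN hi ht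
        exact ih _ hrel j (by omega) htj rfl
    exact key _ (TransitionSystem.inevitable_of_sat (hsat i ht)) i hi ht rfl
  | E =>
    have key : ∀ d, ∀ i ≥ N, t i = untl .E φ ψ → T.distance φ ψ (s i) = d → False := by
      intro d
      induction d using Nat.strong_induction_on with
      | _ d ih =>
        rintro i hi ht rfl
        obtain ⟨j, hj, htj, hrel, hψ, hmin⟩ := exists_next_untl h hc hN hi ht
        obtain ⟨s', h1, h2, h3⟩ := TransitionSystem.exists_distance_lt (hsat i ht) hψ
        exact ih _ ((hmin rfl s' h1 h2).trans_lt h3) j (by omega) htj rfl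
    exact key _ i hi ht rfl

end

/-- From a losing initial position the guided play goes on for ever with true configurations, hence
without a `U`-thread. So the automaton is idle infinitely often and accepting positions recur,
although the level drops at each of them. -/
theorem mem_win_of_satisfiable (h : ϑ.Satisfiable) : (game ϑ).init ∈ (game ϑ).win := by
  obtain ⟨T, hT⟩ := h
  by_contra hinit
  obtain ⟨lvl, hl⟩ := (game ϑ).exists_level
  let Y := {y : (Config ϑ × (automaton ϑ).State) × T.State //
    y.1 ∉ (game ϑ).win ∧ ∀ χ ∈ y.1.1.1, T.Sat χ y.2}
  have hnext : ∀ y : Y, ∃ (r : Rule ϑ) (y' : Y), Follows T y.1.1 y.1.2 r y'.1.1 y'.1.2 ∧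
      lvl y'.1.1 ≤ lvl y.1.1 ∧ (y.1.1 ∈ (game ϑ).accepting → lvl y'.1.1 < lvl y.1.1) := by
    rintro ⟨⟨v, s⟩, hv, hs⟩
    obtain ⟨r, v', s', hf, hv', hs', hlv⟩ := exists_follows hl hv hs
    exact ⟨r, ⟨(v', s'), hv', hs'⟩, hf, hlv⟩
  choose r f hf hlv using hnext
  let y : ℕ → Y := fun n => f^[n] ⟨((game ϑ).init, T.init), hinit, by
    intro χ hχ
    rw [Finset.mem_singleton.1 (show χ ∈ ({ϑ} : Finset CTL) from hχ)]; exact hT⟩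
  have hy : ∀ n, y (n + 1) = f (y n) := fun n => Function.iterate_succ_apply' _ _ _
  have hfol : ∀ n, Follows T (y n).1.1 (y n).1.2 (r (y n)) (y (n + 1)).1.1 (y (n + 1)).1.2 := by
    intro n; rw [hy]; exact hf _
  have hnacc : ¬ ∃ᶠ n in atTop, (y n).1.1 ∈ (game ϑ).accepting :=
    BuchiGame.not_frequently_of_level (x := fun n => (y n).1.1) (lvl := lvl) fun n => by
      simp only [hy]; exact hlv _
  refine not_hasUThread hfol (fun n => (y n).2.2)
    (hasUThread_of_not_idle (x := fun n => (y n).1.1.2) (fun n => (hfol n).step)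
      (fun n => (hfol n).aut) fun hidle => hnacc (hidle.mono fun n hn => Or.inr ⟨?_, hn⟩))
  exact ⟨_, _, (hfol n).step⟩

end CTL

/-! #### From winning strategies to models -/

namespace CTL

variable {ϑ : CTL}

/-- An inconsistent configuration is a dead end that is not accepting, so its rank would have to
decrease along the loop. -/
theorem consistent_of_mem_win {v : Config ϑ × (automaton ϑ).State} (hv : v ∈ (game ϑ).win) :
    Consistent v.1.1 := by
  obtain ⟨rk, hr⟩ := (game ϑ).exists_rank
  by_contra hC
  have hna : ¬ Applicable v.1 := fun ⟨_, _, h⟩ => hC h.consistent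
  have hacc : v ∉ (game ϑ).accepting := by
    rintro (⟨h, -⟩ | ⟨h, -⟩)
    · exact hC h
    · exact hna h
  obtain ⟨-, u, he, -, h2⟩ | ⟨h0, -⟩ := hr v hv
  · rcases he with ⟨r, h, -⟩ | ⟨-, rfl⟩
    · exact hC h.consistent
    · exact lt_irrefl _ (h2 hacc)
  · exact h0 fun h => hC h.1

/-- The positions in the winning region of player 0. -/
abbrev WinPos (ϑ : CTL) : Type := {v : Config ϑ × (automaton ϑ).State // v ∈ (game ϑ).win}

def WinPos.config (v : WinPos ϑ) : Finset CTL := v.1.1.1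

theorem WinPos.subset_closure (v : WinPos ϑ) : v.config ⊆ ϑ.closure := v.1.1.2.1

/-- Only the modal rules can apply. -/
def WinPos.Modal (v : WinPos ϑ) : Prop := ∀ χ ∈ v.config, χ.IsLiteralOrNext

/-- Some rule can apply. -/
def WinPos.Live (v : WinPos ϑ) : Prop := ∃ χ ∈ v.config, ¬ χ.IsLiteral

/-- A move inside the winning region. -/
structure WinPos.Move (rk : Config ϑ × (automaton ϑ).State → ℕ) (v : WinPos ϑ) (r : Rule ϑ)
    (v' : WinPos ϑ) : Prop where
  step : Step v.config r v'.config
  aut : v'.1.2 = (automaton ϑ).step v.1.2 r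
  rank : v.1 ∉ (game ϑ).accepting → rk v'.1 < rk v.1

theorem WinPos.Live.applicable {v : WinPos ϑ} (hv : v.Live) : Applicable v.1.1 := by
  by_contra hna
  obtain ⟨χ, hχ, h⟩ := hv
  exact h (isLiteral_of_not_applicable (consistent_of_mem_win v.2) hna χ hχ)

theorem Step.isModal_iff {C C' : Finset CTL} {r : Rule ϑ} (h : Step C r C') :
    r.IsModal ↔ ∀ χ ∈ C, χ.IsLiteralOrNext := by
  cases h with
  | reduce _ hφ hD =>
    exact ⟨fun h => h.elim, fun h => (reduct_of_isLiteralOrNext (h _ hφ) hD).elim⟩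
  | x0 _ h _ _ => exact ⟨fun _ => h, fun _ => trivial⟩
  | x1 h _ => exact ⟨fun _ => h.2.1, fun _ => trivial⟩

/-- Where player 1 moves, all moves stay in the winning region, so the move for a prescribed `EX e`
is available. Elsewhere the move is that of player 0. -/
theorem WinPos.Live.exists_move {rk : Config ϑ × (automaton ϑ).State → ℕ}
    (hr : ∀ v ∈ (game ϑ).win, v ∈ (game ϑ).cpre
      {u | u ∈ (game ϑ).win ∧ (v ∉ (game ϑ).accepting → rk u < rk v)})
    {v : WinPos ϑ} (hv : v.Live) (e : CTL) :
    ∃ r v', v.Move rk r v' ∧ (v.Modal → next .E e ∈ v.config → ∃ ρ, r = .x1 ρ ∧ ρ.1 = e) := by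
  have happ := hv.applicable
  by_cases hX : X1Applies v.config
  · obtain ⟨h0, -⟩ | ⟨-, hall⟩ := hr _ v.2
    · exact absurd hX h0
    · obtain ⟨φ, hφ, he⟩ : ∃ φ, next .E φ ∈ v.config ∧ (next .E e ∈ v.config → φ = e) := by
        by_cases he : next .E e ∈ v.config
        · exact ⟨e, he, fun _ => rfl⟩
        · exact ⟨_, hX.2.2.choose_spec, fun h => absurd h he⟩
      let ρ : {χ : CTL // χ ∈ ϑ.closure} :=
        ⟨φ, sub_subset_closure (mem_sub_of_next (v.subset_closure hφ))⟩
      have h := Step.x1 (φ := ρ) hX hφ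
      obtain ⟨D, hD⟩ := Step.exists_config (C := v.1.1) h
      rw [← hD] at h
      obtain ⟨hu, hrk⟩ := hall (D, (automaton ϑ).step v.1.2 (.x1 ρ)) (Or.inl ⟨_, h, rfl⟩)
      exact ⟨.x1 ρ, ⟨_, hu⟩, ⟨h, rfl, hrk⟩, fun _ h => ⟨ρ, rfl, he h⟩⟩
  · obtain ⟨-, u, hedge, hu, hrk⟩ | ⟨h0, -⟩ := hr _ v.2
    · rcases hedge with ⟨r, h, ha⟩ | ⟨hna, -⟩
      · exact ⟨r, ⟨u, hu⟩, ⟨h, ha, hrk⟩, fun hm he =>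
          absurd ⟨consistent_of_mem_win v.2, hm, _, he⟩ hX⟩
      · exact absurd happ hna
    · exact absurd hX h0

/-- A choice of moves, also for player 1. -/
structure Moves (ϑ : CTL) where
  rk : Config ϑ × (automaton ϑ).State → ℕ
  rule : WinPos ϑ → CTL → Rule ϑ
  next : WinPos ϑ → CTL → WinPos ϑ
  move : ∀ (v : WinPos ϑ) (e : CTL), v.Live → v.Move rk (rule v e) (next v e)
  choice : ∀ (v : WinPos ϑ) (e : CTL), v.Modal → CTL.next .E e ∈ v.config → ∃ ρ, rule v e = .x1 ρ ∧ ρ.1 = e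

theorem exists_moves (ϑ : CTL) : Nonempty (Moves ϑ) := by
  obtain ⟨rk, hr⟩ := (game ϑ).exists_rank
  have : ∀ (v : WinPos ϑ) e, ∃ r v', v.Live → v.Move rk r v' ∧
      (v.Modal → next .E e ∈ v.config → ∃ ρ, r = .x1 ρ ∧ ρ.1 = e) := by
    intro v e
    by_cases hv : v.Live
    · obtain ⟨r, v', h⟩ := hv.exists_move hr e
      exact ⟨r, v', fun _ => h⟩
    · exact ⟨.x0, v, fun h => absurd h hv⟩
  choose r f hf using this
  exact ⟨⟨rk, r, f, fun v e h => (hf v e h).1, fun v e hm he =>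
    (hf v e ⟨_, he, by simp [IsLiteral]⟩).2 hm he⟩⟩

namespace Moves

variable (M : Moves ϑ)

theorem live_of_not_modal {v : WinPos ϑ} (h : ¬ v.Modal) : v.Live := by
  unfold WinPos.Modal at h
  push Not at h
  obtain ⟨χ, hχ, h⟩ := h
  exact ⟨χ, hχ, fun hl => h (by cases χ <;> simp_all [IsLiteral, IsLiteralOrNext])⟩

open Classical in
/-- Apply a rule that is not modal, if there is one. -/
noncomputable def saturate (v : WinPos ϑ) : WinPos ϑ := if v.Modal then v else M.next v ff

theorem saturate_of_modal {v : WinPos ϑ} (h : v.Modal) : M.saturate v = v := if_pos h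

theorem saturate_of_not_modal {v : WinPos ϑ} (h : ¬ v.Modal) : M.saturate v = M.next v ff :=
  if_neg h

theorem exists_modal (v : WinPos ϑ) : ∃ k, (M.saturate^[k] v).Modal := by
  induction hw : ∑ χ ∈ v.config, χ.weight using Nat.strong_induction_on generalizing v with
  | _ w ih =>
    by_cases hm : v.Modal
    · exact ⟨0, hm⟩
    · have h := (M.move v ff (live_of_not_modal hm)).step
      have hlt := h.weight_lt fun hr => hm (h.isModal_iff.1 hr)
      rw [← M.saturate_of_not_modal hm, hw] at hlt
      obtain ⟨k, hk⟩ := ih _ hlt _ rfl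
      exact ⟨k + 1, hk⟩

/-- The first position to which only the modal rules can apply. -/
noncomputable def finish (v : WinPos ϑ) : WinPos ϑ := M.saturate^[(M.exists_modal v).choose] v

theorem finish_modal (v : WinPos ϑ) : (M.finish v).Modal := (M.exists_modal v).choose_spec

theorem iterate_of_modal {v : WinPos ϑ} (h : v.Modal) (k : ℕ) : M.saturate^[k] v = v :=
  Function.iterate_fixed (M.saturate_of_modal h) k

theorem finish_eq {v : WinPos ϑ} {m : ℕ} (h : (M.saturate^[m] v).Modal) :
    M.finish v = M.saturate^[m] v := by
  rcases le_total m (M.exists_modal v).choose with hm | hm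
  · obtain ⟨k, hk⟩ := Nat.exists_eq_add_of_le' hm
    rw [finish, hk, Function.iterate_add_apply, M.iterate_of_modal h]
  · obtain ⟨k, rfl⟩ := Nat.exists_eq_add_of_le' hm
    rw [Function.iterate_add_apply]
    exact (M.iterate_of_modal (M.finish_modal v) k).symm

/-- The formulas that occur before the next modal rule. -/
def label (v : WinPos ϑ) : Set CTL := {χ | ∃ m, χ ∈ (M.saturate^[m] v).config}

/-- Non-modal rules remove only their principal formula. So a formula of the label either survives
until the modal rule or is principal at some time, and then its reducts enter the label. -/
theorem mem_finish_or {v : WinPos ϑ} {χ : CTL} (h : χ ∈ M.label v) :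
    χ ∈ (M.finish v).config ∨ ∃ b D, χ.reduct b = some D ∧ ∀ χ' ∈ D, χ' ∈ M.label v := by
  rw [or_iff_not_imp_right]
  intro hno
  obtain ⟨m, hm⟩ := h
  have hmem : ∀ k, χ ∈ (M.saturate^[m + k] v).config := by
    intro k
    induction k with
    | zero => exact hm
    | succ k ih =>
      rw [← add_assoc, Function.iterate_succ_apply']
      set u := M.saturate^[m + k] v with hu
      by_cases hmod : u.Modal
      · rwa [M.saturate_of_modal hmod]
      · have h := (M.move u ff (live_of_not_modal hmod)).step
        have hlab : ∀ χ' ∈ (M.next u ff).config, χ' ∈ M.label v := fun χ' hχ' =>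
          ⟨m + k + 1, by rwa [Function.iterate_succ_apply', ← hu, M.saturate_of_not_modal hmod]⟩
        rw [M.saturate_of_not_modal hmod]
        have hnm : ¬ (M.rule u ff).IsModal := fun hr => hmod (h.isModal_iff.1 hr)
        generalize (M.next u ff).config = C' at h hlab
        generalize M.rule u ff = r at h hnm
        cases h with
        | @reduce D ρ b _ hφ hD =>
          refine Finset.mem_union_left _ (Finset.mem_erase.2 ⟨?_, ih⟩)
          rintro rfl
          exact hno ⟨b, D, hD, fun χ' h' => hlab _ (Finset.mem_union_right _ h')⟩
        | x0 _ _ _ _ => exact absurd trivial hnm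
        | x1 _ _ => exact absurd trivial hnm
  obtain ⟨k, hk⟩ := M.exists_modal (M.saturate^[m] v)
  have h := hmem k
  rw [← Function.iterate_add_apply, add_comm] at hk
  rwa [M.finish_eq hk]

theorem mem_finish {v : WinPos ϑ} {χ : CTL} (h : χ ∈ M.label v) (hχ : ∀ b, χ.reduct b = none) :
    χ ∈ (M.finish v).config :=
  (M.mem_finish_or h).resolve_right fun ⟨b, D, hD, _⟩ => by simp [hχ] at hD

theorem exists_reduct {v : WinPos ϑ} {χ : CTL} (h : χ ∈ M.label v) (hχ : ¬ χ.IsLiteralOrNext) :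
    ∃ b D, χ.reduct b = some D ∧ ∀ χ' ∈ D, χ' ∈ M.label v :=
  (M.mem_finish_or h).resolve_left fun h => hχ (M.finish_modal v χ h)

open Classical in
/-- The position after the next modal rule. -/
noncomputable def succ (v : WinPos ϑ) (e : CTL) : WinPos ϑ :=
  if ∃ q φ, CTL.next q φ ∈ (M.finish v).config then M.next (M.finish v) e else v

theorem succ_eq {v : WinPos ϑ} {q : Quant} {φ : CTL} (h : CTL.next q φ ∈ (M.finish v).config)
    (e : CTL) : M.succ v e = M.next (M.finish v) e := if_pos ⟨q, φ, h⟩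

theorem self_subset_label {v : WinPos ϑ} {χ : CTL} (h : χ ∈ v.config) : χ ∈ M.label v := ⟨0, h⟩

theorem connected_next {v : WinPos ϑ} {q : Quant} {φ e : CTL} (hm : v.Modal)
    (h : CTL.next q φ ∈ v.config) (he : q = .E → e = φ) :
    φ ∈ (M.next v e).config ∧ Connected (M.rule v e) (CTL.next q φ) φ := by
  have hs := (M.move v e ⟨_, h, by simp [IsLiteral]⟩).step
  have hmod := hs.isModal_iff.2 hm
  have hch := M.choice v e hm
  generalize (M.next v e).config = C' at hs ⊢
  generalize M.rule v e = r at hs hmod hch ⊢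
  cases hs with
  | reduce _ _ _ => exact hmod.elim
  | x0 _ _ hE _ =>
    cases q with
    | E => exact absurd h (hE _)
    | A => exact ⟨mem_universalPart.2 h, rfl⟩
  | @x1 ρ _ _ =>
    cases q with
    | E =>
      obtain rfl := he rfl
      obtain ⟨ρ', hρ, rfl⟩ := hch h
      injection hρ with hρ
      subst hρ
      exact ⟨Finset.mem_insert_self _ _, Or.inr ⟨rfl, rfl⟩⟩
    | A => exact ⟨Finset.mem_insert_of_mem (mem_universalPart.2 h), Or.inl rfl⟩

theorem mem_label_succ {v : WinPos ϑ} {q : Quant} {φ e : CTL} (h : CTL.next q φ ∈ M.label v)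
    (he : q = .E → e = φ) : φ ∈ M.label (M.succ v e) := by
  have hf := M.mem_finish h fun b => rfl
  rw [M.succ_eq hf]
  exact M.self_subset_label (M.connected_next (M.finish_modal v) hf he).1

/-- The thread starts at `χ` and is prolonged step by step: unfolding leads to `QXχ`, since the left
alternative is excluded, and a modal rule leads back to `χ`, since for `E` the choice of player 1 is
`χ` itself. -/
theorem exists_thread {y : ℕ → WinPos ϑ} {e : ℕ → CTL} {q : Quant} {χ : CTL}
    (hlive : ∀ n, (y n).Live) (hy : ∀ n, y (n + 1) = M.next (y n) (e n)) (hχ : ∃ φ ψ, χ = untl q φ ψ)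
    (h0 : χ ∈ (y 0).config)
    (hnm : ∀ n ρ b, M.rule (y n) (e n) = .reduce ρ b → ρ.1 = χ → b = true)
    (hm : ∀ n, (y n).Modal → q = .E → e n = χ) :
    HasUThread (fun n => (y n).1.1) (fun n => M.rule (y n) (e n)) := by
  have hs : ∀ n, Step (y n).config (M.rule (y n) (e n)) (y (n + 1)).config := fun n => by
    rw [hy]; exact (M.move _ _ (hlive n)).step
  obtain ⟨φ, ψ, rfl⟩ := hχ
  set χ := untl q φ ψ with hχ
  have hstep : ∀ (n : ℕ) (t : {t // (t = χ ∨ t = CTL.next q χ) ∧ t ∈ (y n).config}),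
      ∃ t' : {t // (t = χ ∨ t = CTL.next q χ) ∧ t ∈ (y (n + 1)).config},
        Connected (M.rule (y n) (e n)) t.1 t'.1 ∧
          ((M.rule (y n) (e n)).IsModal → t'.1 = χ) := by
    rintro n ⟨t, ht, htC⟩
    by_cases hmod : (y n).Modal
    · rcases ht with rfl | rfl
      · exact (hmod _ htC).elim
      · obtain ⟨h1, h2⟩ := M.connected_next hmod htC (hm n hmod)
        rw [← hy] at h1
        exact ⟨⟨χ, Or.inl rfl, h1⟩, h2, fun _ => rfl⟩
    · have hs := hs n
      have hr : ¬ (M.rule (y n) (e n)).IsModal := fun hr => hmod (hs.isModal_iff.1 hr)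
      have hnm := hnm n
      generalize M.rule (y n) (e n) = r at hs hr hnm ⊢
      generalize (y (n + 1)).config = C' at hs ⊢
      cases hs with
      | @reduce D ρ b _ hφ hD =>
        by_cases hρ : t = ρ.1
        · rcases ht with rfl | rfl
          · have hb := hnm ρ b rfl hρ.symm
            rw [hb] at hD ⊢
            have hD' : some {φ, CTL.next q χ} = some D := by rw [← hD, ← hρ]; rfl
            injection hD' with hD'
            refine ⟨⟨CTL.next q χ, Or.inr rfl, Finset.mem_union_right _ (by simp [← hD'])⟩,
              Or.inl ⟨hρ, D, (congrArg (reduct · true) hρ).trans hD, by simp [← hD']⟩, fun h => h.elim⟩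
          · rw [← hρ] at hD; simp [reduct] at hD
        · exact ⟨⟨t, ht, Finset.mem_union_left _ (Finset.mem_erase.2 ⟨hρ, htC⟩)⟩,
            Or.inr ⟨hρ, rfl⟩, fun h => h.elim⟩
      | x0 _ _ _ _ => exact absurd trivial hr
      | x1 _ _ => exact absurd trivial hr
  choose f hf hfm using hstep
  let t : ∀ n, {t // (t = χ ∨ t = CTL.next q χ) ∧ t ∈ (y n).config} := fun n =>
    Nat.rec ⟨χ, Or.inl rfl, h0⟩ (fun n t => f n t) n
  refine ⟨fun n => (t n).1, fun n => (t n).2.2, fun n => hf n (t n), q, φ, ψ, ?_⟩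
  rw [frequently_atTop]
  intro N
  obtain ⟨n, hn, hmod⟩ := exists_isModal (C := fun n => (y n).1.1) hs N
  exact ⟨n + 1, by omega, hfm n (t n) hmod⟩

theorem frequently_idle {y : ℕ → WinPos ϑ} {e : ℕ → CTL} (hlive : ∀ n, (y n).Live)
    (hy : ∀ n, y (n + 1) = M.next (y n) (e n)) : ∃ᶠ n in atTop, Idle (y n).1.2 := by
  have h : ∃ᶠ n in atTop, (y n).1 ∈ (game ϑ).accepting :=
    BuchiGame.frequently_of_rank (x := fun n => (y n).1) (rk := M.rk) fun n hn => by
      simp only [hy]; exact (M.move _ _ (hlive n)).rank hn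
  refine h.mono fun n hn => ?_
  rcases hn with ⟨-, hlit⟩ | ⟨-, hn⟩
  · obtain ⟨χ, hχ, h⟩ := hlive n
    exact absurd (hlit χ hχ) h
  · exact hn

open Classical in
/-- The sequence of all positions between the modal steps of a sequence of successors. -/
noncomputable def interleave (v : WinPos ϑ) (e : ℕ → CTL) : ℕ → WinPos ϑ × ℕ
  | 0 => (v, 0)
  | n + 1 =>
    let y := interleave v e n
    if y.1.Modal then (M.next y.1 (e y.2), y.2 + 1) else (M.next y.1 ff, y.2)

/-- If `ψ` never occurred, `χ` would be unfolded in every state and `QXχ` would survive to each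
modal rule. Stringing together the moves between consecutive states gives an infinite sequence
inside the winning region with a `U`-thread, while the rank forces the automaton to be idle
infinitely often. -/
theorem fair {x : ℕ → WinPos ϑ} {e : ℕ → CTL} {q : Quant} {φ ψ : CTL}
    (hx : ∀ n, x (n + 1) = M.succ (x n) (e n)) (hmem : ∀ n, untl q φ ψ ∈ M.label (x n))
    (he : q = .E → ∀ n, e n = untl q φ ψ) : ∃ n, ψ ∈ M.label (x n) := by
  classical
  by_contra hψ
  push Not at hψ
  set χ := untl q φ ψ with hχ
  have hnext : ∀ n, CTL.next q χ ∈ (M.finish (x n)).config := by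
    intro n
    obtain ⟨b, D, hD, hsub⟩ := M.exists_reduct (hmem n) (by simp [χ, IsLiteralOrNext, IsLiteral])
    cases b <;> simp only [χ, reduct, Option.some.injEq] at hD <;> subst hD
    · exact absurd (hsub ψ (by simp)) (hψ n)
    · exact M.mem_finish (hsub _ (by simp [χ])) fun _ => rfl
  have hx' : ∀ n, x (n + 1) = M.next (M.finish (x n)) (e n) := fun n =>
    (hx n).trans (M.succ_eq (hnext n) _)
  -- the sequence starts after the first modal step
  let z := M.interleave (x 1) fun n => e (n + 1)
  let e' : ℕ → CTL := fun n => if (z n).1.Modal then e ((z n).2 + 1) else ff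
  have hz : ∀ n, z (n + 1) = if (z n).1.Modal then (M.next (z n).1 (e ((z n).2 + 1)), (z n).2 + 1)
      else (M.next (z n).1 ff, (z n).2) := fun n => rfl
  have hinv : ∀ n, ∃ m, (z n).1 = M.saturate^[m] (x ((z n).2 + 1)) := by
    intro n
    induction n with
    | zero => exact ⟨0, rfl⟩
    | succ n ih =>
      obtain ⟨m, hm⟩ := ih
      rw [hz]
      split_ifs with hmod
      · refine ⟨0, ?_⟩
        change M.next (z n).1 _ = x ((z n).2 + 1 + 1)
        rw [hx', hm, M.finish_eq (hm ▸ hmod)]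
      · refine ⟨m + 1, ?_⟩
        simp only
        rw [Function.iterate_succ_apply', ← hm, M.saturate_of_not_modal hmod]
  have hfin : ∀ n, (z n).1.Modal → CTL.next q χ ∈ (z n).1.config := by
    intro n hmod
    obtain ⟨m, hm⟩ := hinv n
    rw [hm, ← M.finish_eq (hm ▸ hmod)]
    exact hnext _
  have hlive : ∀ n, (z n).1.Live := by
    intro n
    by_cases hmod : (z n).1.Modal
    · exact ⟨_, hfin n hmod, by simp [IsLiteral]⟩
    · exact live_of_not_modal hmod
  have hz' : ∀ n, (z (n + 1)).1 = M.next (z n).1 (e' n) := by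
    intro n
    rw [hz]
    simp only [e']
    split_ifs <;> rfl
  refine not_frequently_idle (x := fun n => (z n).1.1.2)
    (r := fun n => M.rule (z n).1 (e' n)) (C := fun n => (z n).1.1.1) (fun n => ?_)
    (M.exists_thread (q := q) (χ := χ) hlive hz' ⟨φ, ψ, rfl⟩ ?_ ?_ ?_) (M.frequently_idle hlive hz')
  · rw [hz']
    exact (M.move _ _ (hlive n)).aut
  -- In `x 0` the formula is only known to occur somewhere before the modal rule; just after a modal
  -- step it stands in the configuration itself, where a thread can begin.
  · change χ ∈ (x 1).config
    rw [hx']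
    exact (M.connected_next (M.finish_modal _) (hnext 0) fun hq => he hq 0).1
  · intro n ρ b hr hρ
    by_contra hb
    rw [Bool.not_eq_true] at hb
    subst hb
    obtain ⟨m, hm⟩ := hinv n
    have hs := (M.move (z n).1 (e' n) (hlive n)).step
    have hmod : ¬ (z n).1.Modal := fun hmod => by
      have := hs.isModal_iff.2 hmod
      rw [hr] at this
      exact this
    have hsat : M.next (z n).1 (e' n) = M.saturate^[m + 1] (x ((z n).2 + 1)) := by
      rw [Function.iterate_succ_apply', ← hm, M.saturate_of_not_modal hmod]
      simp only [e', if_neg hmod]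
    have hlab : ∀ χ' ∈ (M.next (z n).1 (e' n)).config, χ' ∈ M.label (x ((z n).2 + 1)) := by
      intro χ' h
      rw [hsat] at h
      exact ⟨_, h⟩
    generalize (M.next (z n).1 (e' n)).config = C' at hs hlab
    rw [hr] at hs
    cases hs with
    | @reduce D _ _ _ _ hD =>
      rw [hρ] at hD
      simp only [χ, reduct, Option.some.injEq] at hD
      subst hD
      exact hψ _ (hlab ψ (by simp))
  · intro n hmod hq
    simp only [e', if_pos hmod]
    exact he hq _

/-- Formulas serve as their own names, and the transition for `e` is the play in which player 1
chooses `EX e` if possible. A position whose saturation contains no `EX` or `AX` formula is its own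
successor, which is harmless because nothing is demanded of its successors. -/
theorem isHintikka : IsHintikka id M.label M.succ := by
  have named : ∀ {L : Set CTL} {φ : CTL}, Named id L φ ↔ φ ∈ L := by simp [Named]
  have nr : ∀ {χ : CTL}, χ.IsLiteralOrNext → ∀ b, χ.reduct b = none := by
    intro χ h b
    by_contra hcon
    obtain ⟨D, hD⟩ := Option.ne_none_iff_exists'.1 hcon
    exact reduct_of_isLiteralOrNext h hD
  have hC := fun v : WinPos ϑ => consistent_of_mem_win (M.finish v).2
  constructor
  · intro v h
    exact (hC v).1 (M.mem_finish (named.1 h) (nr trivial))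
  · intro v p h h'
    exact (hC v).2 p ⟨M.mem_finish (named.1 h) (nr trivial), M.mem_finish (named.1 h') (nr trivial)⟩
  · intro v φ ψ h
    rw [named] at h ⊢
    rw [named]
    obtain ⟨b, D, hD, hsub⟩ := M.exists_reduct h fun h => h
    cases b <;> simp only [reduct, Option.some.injEq] at hD <;> subst hD
    · exact Or.inl (hsub _ (by simp))
    · exact Or.inr (hsub _ (by simp))
  · intro v φ ψ h
    rw [named] at h ⊢
    rw [named]
    obtain ⟨b, D, hD, hsub⟩ := M.exists_reduct h fun h => h
    cases b <;> simp only [reduct, Option.some.injEq, reduceCtorEq] at hD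
    subst hD
    exact ⟨hsub _ (by simp), hsub _ (by simp)⟩
  · intro v φ h
    exact ⟨φ, named.2 (M.mem_label_succ (named.1 h) fun _ => rfl)⟩
  · intro v φ h e
    exact named.2 (M.mem_label_succ (named.1 h) nofun)
  · rintro v _ h q φ ψ rfl
    obtain ⟨b, D, hD, hsub⟩ := M.exists_reduct h fun h => h
    cases b <;> simp only [reduct, Option.some.injEq] at hD <;> subst hD
    · exact Or.inl (named.2 (hsub _ (by simp)))
    · exact Or.inr ⟨named.2 (hsub _ (by simp)), fun e he =>
        M.mem_label_succ (hsub _ (by simp)) he⟩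
  · rintro v _ h q φ ψ rfl
    obtain ⟨b, D, hD, hsub⟩ := M.exists_reduct h fun h => h
    cases b <;> simp only [reduct, Option.some.injEq] at hD <;> subst hD
    · exact ⟨named.2 (hsub _ (by simp)), Or.inl (named.2 (hsub _ (by simp)))⟩
    · exact ⟨named.2 (hsub _ (by simp)), Or.inr fun e he =>
        M.mem_label_succ (hsub _ (by simp)) he⟩
  · rintro x e _ q φ ψ rfl hx hmem he
    obtain ⟨n, hn⟩ := M.fair hx hmem he
    exact ⟨n, named.2 hn⟩

end Moves

theorem satisfiable_of_mem_win (h : (game ϑ).init ∈ (game ϑ).win) : ϑ.Satisfiable := by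
  obtain ⟨M⟩ := exists_moves ϑ
  refine M.isHintikka.satisfiable (x := ⟨_, h⟩) ⟨ϑ, M.self_subset_label ?_, rfl⟩
  exact Finset.mem_singleton_self ϑ

theorem satisfiable_iff_player0Wins (ϑ : CTL) : ϑ.Satisfiable ↔ (game ϑ).Player0Wins := by
  rw [BuchiGame.player0Wins_iff]
  exact ⟨mem_win_of_satisfiable, satisfiable_of_mem_win⟩

/-! #### The size of the game -/

theorem card_closure_le (ϑ : CTL) : ϑ.closure.card ≤ 3 * ϑ.size := by
  have h1 := Finset.card_union_le (ϑ.sub ∪ ϑ.sub.image (next .E)) (ϑ.sub.image (next .A))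
  have h2 := Finset.card_union_le ϑ.sub (ϑ.sub.image (next .E))
  have h3 : (ϑ.sub.image (next .E)).card ≤ ϑ.sub.card := Finset.card_image_le
  have h4 : (ϑ.sub.image (next .A)).card ≤ ϑ.sub.card := Finset.card_image_le
  have : ϑ.sub.card ≤ ϑ.size := Nat.le_add_right _ _
  unfold closure
  omega

/-- If `N ≤ 3|ϑ|` is the size of the closure, there are at most `2^N` configurations and `4N ≤
2^(N+2)` automaton states. The exponent `2N + 2 ≤ 6|ϑ| + 2` is at most `8|ϑ|` because `|ϑ| ≥ 1`. -/
theorem card_positions_le (ϑ : CTL) :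
    Nat.card (Config ϑ × (automaton ϑ).State) ≤ 2 ^ (8 * ϑ.size) := by
  have hpos : 1 ≤ ϑ.size :=
    (Finset.card_pos.2 ⟨ϑ, self_mem_sub ϑ⟩).trans_le (Nat.le_add_right _ _)
  have hcl := card_closure_le ϑ
  have h1 : Nat.card (Config ϑ) ≤ 2 ^ ϑ.closure.card := by
    rw [← Finset.card_powerset, ← Nat.card_eq_finsetCard]
    refine Nat.card_le_card_of_injective
      (fun C : Config ϑ => (⟨C.1, Finset.mem_powerset.2 C.2.1⟩ : ϑ.closure.powerset)) ?_
    intro C C' h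
    exact Subtype.ext (Subtype.mk.inj h)
  have h2 : Nat.card (Focus ϑ) = ϑ.closure.card := Nat.card_eq_finsetCard _
  have h3 : Nat.card (automaton ϑ).State = ϑ.closure.card * (2 * 2) := by
    change Nat.card (Focus ϑ × Bool × Bool) = _
    simp [Nat.card_prod, h2]
  rw [Nat.card_prod, h3]
  calc _ ≤ 2 ^ ϑ.closure.card * (2 ^ ϑ.closure.card * (2 * 2)) := by
        gcongr
        exact Nat.lt_two_pow_self.le
    _ = 2 ^ (2 * ϑ.closure.card + 2) := by ring
    _ ≤ 2 ^ (8 * ϑ.size) := Nat.pow_le_pow_right (by norm_num) (by omega)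

/-- The number of all pairs of positions is already small enough. -/
theorem ncard_edges_le (ϑ : CTL) :
    Set.ncard {e : (Config ϑ × (automaton ϑ).State) × (Config ϑ × (automaton ϑ).State) |
      (game ϑ).edge e.1 e.2} ≤ 2 ^ (16 * ϑ.size) := by
  have h := card_positions_le ϑ
  calc _ ≤ Set.ncard (Set.univ : Set ((Config ϑ × (automaton ϑ).State) ×
        (Config ϑ × (automaton ϑ).State))) := Set.ncard_le_ncard (Set.subset_univ _)
    _ = Nat.card (Config ϑ × (automaton ϑ).State) * Nat.card (Config ϑ × (automaton ϑ).State) := by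
        rw [Set.ncard_univ, Nat.card_prod]
    _ ≤ 2 ^ (8 * ϑ.size) * 2 ^ (8 * ϑ.size) := Nat.mul_le_mul h h
    _ = 2 ^ (16 * ϑ.size) := by ring

end CTL

/-! ### Functions computed by loop programs whose loops run as often as the variable 0 says -/

namespace Cmd

/-- Some command puts `f` into the variable `d`, preserves all variables below, and needs time
polynomial in the variable 0. -/
def Realizable (d : ℕ) (f : List ℕ → (ℕ → ℕ) → ℕ) : Prop :=
  ∃ (c : Cmd) (p : Polynomial ℕ), ∀ w s, (c.eval w s).var d = f w s.var ∧
    (∀ x < d, (c.eval w s).var x = s.var x) ∧ c.cost w s ≤ p.eval (s.var 0)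

/-- A function of the input and of an environment is computable if it is realizable for every
placement `ρ` of the environment in the variables. The name 0 always stands for the variable 0. -/
def IsComputable (f : List ℕ → (ℕ → ℕ) → ℕ) : Prop :=
  ∀ (ρ : ℕ → ℕ) (d : ℕ), ρ 0 = 0 → (∀ x, ρ x < d) → Realizable d fun w v => f w (v ∘ ρ)

open Classical in
def IsDecidable (P : List ℕ → (ℕ → ℕ) → Prop) : Prop := IsComputable fun w v => if P w v then 1 else 0

/-- Iteration of `f`, which is given the number of the iteration and the current value. -/
def iter (f : ℕ → ℕ → ℕ) (a : ℕ) : ℕ → ℕ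
  | 0 => a
  | n + 1 => f n (iter f a n)

theorem iter_congr {f g : ℕ → ℕ → ℕ} {a n : ℕ} (h : ∀ i < n, ∀ r, f i r = g i r) :
    iter f a n = iter g a n := by
  induction n with
  | zero => rfl
  | succ n ih =>
    rw [iter, iter, ih fun i hi => h i (by omega), h n (by omega)]

theorem comp_eq_of_preserved {s s' : Store} {ρ : ℕ → ℕ} {d : ℕ} (hρ : ∀ x, ρ x < d)
    (h : ∀ x < d, s'.var x = s.var x) : s'.var ∘ ρ = s.var ∘ ρ := funext fun x => h _ (hρ x)

namespace IsComputable

variable {f g a b : List ℕ → (ℕ → ℕ) → ℕ}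

theorem congr (hf : IsComputable f) (h : ∀ w v, f w v = g w v) : IsComputable g := by
  rwa [show g = f from funext fun w => funext fun v => (h w v).symm]

theorem const (n : ℕ) : IsComputable fun _ _ => n := by
  intro ρ d _ _
  exact ⟨.const d n, 1, fun w s => ⟨by simp [eval, Store.set], fun x hx => by
    simp [eval, Store.set, hx.ne], by simp [cost]⟩⟩

theorem var (x : ℕ) : IsComputable fun _ v => v x := by
  intro ρ d _ hρ
  have := hρ x
  exact ⟨.seq (.const d 0) (.add d (ρ x) d), 2, fun w s => ⟨by
    simp [eval, Store.set, this.ne], fun y hy => by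
    simp [eval, Store.set, hy.ne], by simp [cost]⟩⟩

theorem len : IsComputable fun w _ => w.length := by
  intro ρ d _ hρ
  exact ⟨.len d, 1, fun w s => ⟨by simp [eval, Store.set], fun y hy => by
    simp [eval, Store.set, hy.ne], by simp [cost]⟩⟩

theorem input (hf : IsComputable f) : IsComputable fun w v => w.getD (f w v) 0 := by
  intro ρ d h0 hρ
  obtain ⟨c, p, hc⟩ := hf ρ d h0 hρ
  refine ⟨.seq c (.input d d), p + 4, fun w s => ?_⟩
  obtain ⟨h1, h2, h3⟩ := hc w s
  refine ⟨by simp [eval, Store.set, h1], fun y hy => ?_, by simpa [cost] using h3⟩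
  simp [eval, Store.set, hy.ne, h2 y hy]

/-- The second argument is computed at `d + 1`, and therefore preserves the first result at `d`. -/
theorem binary {op : ℕ → ℕ → ℕ} {instr : ℕ → ℕ → ℕ → Cmd}
    (he : ∀ w x y z s, (instr x y z).eval w s = s.set x (op (s.var y) (s.var z)))
    (hcost : ∀ w x y z s, (instr x y z).cost w s = 1) (hf : IsComputable f) (hg : IsComputable g) :
    IsComputable fun w v => op (f w v) (g w v) := by
  intro ρ d h0 hρ
  obtain ⟨c, p, hc⟩ := hf ρ d h0 hρ
  obtain ⟨c', p', hc'⟩ := hg ρ (d + 1) h0 fun x => (hρ x).trans d.lt_succ_self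
  refine ⟨.seq c (.seq c' (instr d d (d + 1))), p + (p' + 1), fun w s => ?_⟩
  obtain ⟨h1, h2, h3⟩ := hc w s
  obtain ⟨h1', h2', h3'⟩ := hc' w (c.eval w s)
  beta_reduce at h1 h1'
  rw [comp_eq_of_preserved hρ h2] at h1'
  rw [h2 0 (h0 ▸ hρ 0)] at h3'
  refine ⟨?_, fun y hy => ?_, ?_⟩
  · simp [eval, Store.set, he, h1', h2', h1]
  · simp [eval, Store.set, he, hy.ne, h2' y (hy.trans d.lt_succ_self), h2 y hy]
  · simp only [cost, hcost, Polynomial.eval_add, Polynomial.eval_one]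
    omega

theorem add (hf : IsComputable f) (hg : IsComputable g) : IsComputable fun w v => f w v + g w v :=
  binary (instr := .add) (fun _ _ _ _ _ => rfl) (fun _ _ _ _ _ => rfl) hf hg

theorem sub (hf : IsComputable f) (hg : IsComputable g) : IsComputable fun w v => f w v - g w v :=
  binary (instr := .sub) (fun _ _ _ _ _ => rfl) (fun _ _ _ _ _ => rfl) hf hg

theorem cond (hf : IsComputable f) (ha : IsComputable a) (hb : IsComputable b) :
    IsComputable fun w v => if f w v = 0 then b w v else a w v := by
  intro ρ d h0 hρ
  obtain ⟨c, p, hc⟩ := hf ρ d h0 hρ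
  obtain ⟨ca, pa, hca⟩ := ha ρ d h0 hρ
  obtain ⟨cb, pb, hcb⟩ := hb ρ d h0 hρ
  refine ⟨.seq c (.ite d ca cb), p + (pa + pb + 2), fun w s => ?_⟩
  obtain ⟨h1, h2, h3⟩ := hc w s
  obtain ⟨h1a, h2a, h3a⟩ := hca w (c.eval w s)
  obtain ⟨h1b, h2b, h3b⟩ := hcb w (c.eval w s)
  beta_reduce at h1 h1a h1b
  rw [comp_eq_of_preserved hρ h2] at h1a h1b
  rw [h2 0 (h0 ▸ hρ 0)] at h3a h3b
  simp only [eval, cost, h1, Polynomial.eval_add, Polynomial.eval_ofNat]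
  split_ifs
  · exact ⟨h1b, fun y hy => (h2b y hy).trans (h2 y hy), by omega⟩
  · exact ⟨h1a, fun y hy => (h2a y hy).trans (h2 y hy), by omega⟩

open Classical in
theorem ite {P : List ℕ → (ℕ → ℕ) → Prop} (hP : IsDecidable P) (ha : IsComputable a)
    (hb : IsComputable b) : IsComputable fun w v => if P w v then a w v else b w v :=
  (cond hP ha hb).congr fun w v => by split_ifs <;> simp_all

/-- A loop whose body first evaluates a test. -/
theorem _root_.Cmd.Realizable.loop {d : ℕ} {init : List ℕ → (ℕ → ℕ) → ℕ}
    {step : List ℕ → (ℕ → ℕ) → ℕ → ℕ → ℕ} (hd : 0 < d) (hinit : Realizable d init)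
    (hstep : Realizable (d + 2) fun w v => step w v (v (d + 1)) (v d))
    (hlocal : ∀ w v v', (∀ x < d, v' x = v x) → step w v' = step w v) :
    Realizable d fun w v => iter (step w v) (init w v) (v 0) := by
  obtain ⟨c, p, hc⟩ := hinit
  obtain ⟨c', p', hc'⟩ := hstep
  -- The accumulator is at `d` and the index at `d + 1`. The new value is formed at `d + 2` and then
  -- copied by adding zero; `d + 3` holds the constants 0 and 1.
  let body : Cmd := .seq c' (.seq (.const (d + 3) 0) (.seq (.add d (d + 2) (d + 3))
    (.seq (.const (d + 3) 1) (.add (d + 1) (d + 1) (d + 3)))))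
  refine ⟨.seq c (.seq (.const (d + 1) 0) (.rep 0 body)), p + (1 + (2 + .X * (4 + (p' + 4)))),
    fun w s => ?_⟩
  obtain ⟨h1, h2, h3⟩ := hc w s
  set s₁ := (Cmd.const (d + 1) 0).eval w (c.eval w s) with hs₁
  have hv : ∀ x, s₁.var x = if x = d + 1 then 0 else (c.eval w s).var x := fun x => by
    simp [hs₁, eval, Store.set, Function.update_apply]
  have hlow : ∀ x < d, s₁.var x = s.var x := fun x hx => by
    rw [hv, if_neg (by omega), h2 x hx]
  have hrep := rep_inv (w := w) (c := body) (x := 0) (s := s₁) (t := p'.eval (s.var 0) + 4)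
    (N := s.var 0)
    (fun i s' => s'.var d = iter (step w s.var) (init w s.var) i ∧ s'.var (d + 1) = i ∧
      ∀ x < d, s'.var x = s.var x) (hlow 0 hd)
    ⟨by rw [hv, if_neg (by omega), h1]; rfl, by rw [hv, if_pos rfl], hlow⟩ ?_
  · obtain ⟨⟨e1, -, e3⟩, hcost⟩ := hrep
    refine ⟨e1, e3, ?_⟩
    have e : (Cmd.seq c (.seq (.const (d + 1) 0) (.rep 0 body))).cost w s =
      c.cost w s + (1 + (Cmd.rep 0 body).cost w s₁) := rfl
    rw [e]
    simp only [Polynomial.eval_add, Polynomial.eval_mul, Polynomial.eval_one, Polynomial.eval_X,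
      Polynomial.eval_ofNat]
    omega
  · rintro i - s' ⟨e1, e2, e3⟩
    obtain ⟨h1', h2', h3'⟩ := hc' w s'
    beta_reduce at h1'
    rw [hlocal w s.var s'.var e3, e1, e2] at h1'
    rw [e3 0 hd] at h3'
    have hb : ∀ x, (body.eval w s').var x = if x = d + 1 then i + 1 else if x = d + 3 then 1 else
        if x = d then step w s.var i (iter (step w s.var) (init w s.var) i) else
          (c'.eval w s').var x := by
      intro x
      have := h2' (d + 1) (by omega)
      simp only [body, eval, Store.set, Function.update_apply]
      split_ifs <;> simp_all
    refine ⟨⟨by rw [hb]; simp [iter], by rw [hb]; simp, fun x hx => ?_⟩, ?_⟩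
    · rw [hb, if_neg (by omega), if_neg (by omega), if_neg (by omega), h2' x (by omega), e3 x hx]
    · have e : body.cost w s' = c'.cost w s' + 4 := rfl
      omega

-- The test sees the index but not the accumulator. So the name `y` of the accumulator may also
-- occur in the test with its outer meaning, and quantifiers can use `x + 1` for it without a
-- freshness condition.
open Classical in
theorem loopIte {x y : ℕ} {init : List ℕ → (ℕ → ℕ) → ℕ} {P : List ℕ → (ℕ → ℕ) → Prop} (hx : x ≠ 0)
    (hy : y ≠ 0) (hinit : IsComputable init) (hP : IsDecidable P) (ha : IsComputable a)
    (hb : IsComputable b) :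
    IsComputable fun w v => iter (fun i r => if P w (Function.update v x i) then
      a w (Function.update (Function.update v x i) y r) else
      b w (Function.update (Function.update v x i) y r)) (init w v) (v 0) := by
  intro ρ d h0 hρ
  have hd : 0 < d := h0 ▸ hρ 0
  simp only [Function.comp_apply, h0]
  have upd : ∀ {ρ : ℕ → ℕ} {x d' : ℕ} (v : ℕ → ℕ),
      v ∘ Function.update ρ x d' = Function.update (v ∘ ρ) x (v d') := fun v =>
    Function.comp_update _ _ _ _
  have hρ1 : ∀ z, Function.update ρ x (d + 1) z < d + 2 := fun z => by
    have := hρ z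
    rw [Function.update_apply]; split_ifs <;> omega
  have hρ2 : ∀ z, Function.update (Function.update ρ x (d + 1)) y d z < d + 2 := fun z => by
    have := hρ1 z
    rw [Function.update_apply]; split_ifs <;> omega
  obtain ⟨c, p, hc⟩ := hP (Function.update ρ x (d + 1)) (d + 2)
    (by rw [Function.update_of_ne hx.symm, h0]) hρ1
  obtain ⟨ca, pa, hca⟩ := ha (Function.update (Function.update ρ x (d + 1)) y d) (d + 2)
    (by rw [Function.update_of_ne hy.symm, Function.update_of_ne hx.symm, h0]) hρ2
  obtain ⟨cb, pb, hcb⟩ := hb (Function.update (Function.update ρ x (d + 1)) y d) (d + 2)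
    (by rw [Function.update_of_ne hy.symm, Function.update_of_ne hx.symm, h0]) hρ2
  refine Realizable.loop (step := fun w v i r =>
    if P w (Function.update (v ∘ ρ) x i) then
      a w (Function.update (Function.update (v ∘ ρ) x i) y r) else
      b w (Function.update (Function.update (v ∘ ρ) x i) y r)) hd (hinit ρ d h0 hρ) ?_ ?_
  · refine ⟨.seq c (.ite (d + 2) ca cb), p + (pa + pb + 2), fun w s => ?_⟩
    obtain ⟨h1, h2, h3⟩ := hc w s
    obtain ⟨h1a, h2a, h3a⟩ := hca w (c.eval w s)
    obtain ⟨h1b, h2b, h3b⟩ := hcb w (c.eval w s)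
    beta_reduce at h1 h1a h1b
    rw [comp_eq_of_preserved hρ2 h2, upd, upd] at h1a h1b
    rw [upd] at h1
    rw [h2 0 (by omega)] at h3a h3b
    simp only [eval, cost, h1, Polynomial.eval_add, Polynomial.eval_ofNat]
    by_cases h : P w (Function.update (s.var ∘ ρ) x (s.var (d + 1)))
    · simp only [h, if_true, one_ne_zero, if_false]
      exact ⟨h1a, fun y hy => (h2a y hy).trans (h2 y hy), by omega⟩
    · simp only [h, if_false, if_true]
      exact ⟨h1b, fun y hy => (h2b y hy).trans (h2 y hy), by omega⟩
  · intro w v v' h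
    rw [show v' ∘ ρ = v ∘ ρ from funext fun x => h _ (hρ x)]

theorem loop {x y : ℕ} {init : List ℕ → (ℕ → ℕ) → ℕ} (hx : x ≠ 0) (hy : y ≠ 0)
    (hinit : IsComputable init) (ha : IsComputable a) :
    IsComputable fun w v => iter (fun i r => a w (Function.update (Function.update v x i) y r))
      (init w v) (v 0) := by
  have h := loopIte (P := fun _ _ => True) hx hy hinit (by
    simpa only [IsDecidable, if_true] using const 1) ha ha
  exact h.congr fun w v => iter_congr fun i _ r => if_pos trivial

/-- Composition. -/
theorem app {G : ℕ → ℕ → ℕ → ℕ} (hG : IsComputable fun _ v => G (v 0) (v 1) (v 2)) (ha : IsComputable a)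
    (hb : IsComputable b) : IsComputable fun w v => G (v 0) (a w v) (b w v) := by
  intro ρ d h0 hρ
  have hd : 0 < d := h0 ▸ hρ 0
  obtain ⟨c, p, hc⟩ := ha ρ d h0 hρ
  obtain ⟨c', p', hc'⟩ := hb ρ (d + 1) h0 fun x => (hρ x).trans d.lt_succ_self
  -- The names 1 and 2 are placed where the arguments have just been computed. `G` uses no further
  -- names, so these may be sent to 0.
  obtain ⟨c₂, p₂, hc₂⟩ := hG (fun x => if x = 1 then d else if x = 2 then d + 1 else 0) (d + 2) rfl
    fun x => by split_ifs <;> omega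
  refine ⟨.seq c (.seq c' (.seq c₂ (.seq (.const d 0) (.add d (d + 2) d)))), p + (p' + (p₂ + 2)),
    fun w s => ?_⟩
  obtain ⟨h1, h2, h3⟩ := hc w s
  obtain ⟨h1', h2', h3'⟩ := hc' w (c.eval w s)
  obtain ⟨h1₂, h2₂, h3₂⟩ := hc₂ w (c'.eval w (c.eval w s))
  beta_reduce at h1 h1' h1₂
  rw [comp_eq_of_preserved hρ h2] at h1'
  simp only [Function.comp_apply, if_true, OfNat.zero_ne_ofNat, OfNat.ofNat_ne_one, if_false,
    zero_ne_one] at h1₂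
  rw [h2' 0 (by omega), h2 0 hd] at h3₂
  rw [h2' 0 (by omega), h2 0 hd, h2' d (by omega), h1, h1'] at h1₂
  rw [h2 0 hd] at h3'
  refine ⟨?_, fun y hy => ?_, ?_⟩
  · simp only [eval, Store.set, Function.update_self, Function.update_of_ne (show d + 2 ≠ d by omega),
      h1₂, Function.comp_apply, h0]
    rfl
  · simp only [eval, Store.set, Function.update_of_ne hy.ne]
    rw [h2₂ y (by omega), h2' y (by omega), h2 y hy]
  · simp only [cost, Polynomial.eval_add, Polynomial.eval_ofNat]
    omega

/-- Repeated doubling. The cap in the exponent is there because every loop runs exactly as often as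
the variable 0 says. -/
theorem twoPow (ha : IsComputable a) : IsComputable fun w v => 2 ^ min (a w v) (v 0) := by
  refine app (G := fun B n _ => 2 ^ min n B) ?_ ha ha
  have hlt : IsDecidable fun _ v => v 3 < v 1 :=
    (cond (sub (var 1) (var 3)) (const 1) (const 0)).congr fun w v => by
      split_ifs <;> omega
  refine (loopIte (x := 3) (y := 4) (by simp) (by simp) (const 1) hlt (add (var 4) (var 4))
    (var 4)).congr fun w v => ?_
  have : ∀ n, iter (fun i r => if i < v 1 then r + r else r) 1 n = 2 ^ min (v 1) n := by
    intro n
    induction n with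
    | zero => simp [iter]
    | succ n ih =>
      rw [iter, ih]
      split_ifs with h
      · rw [min_eq_right h.le, min_eq_right h, pow_succ]; omega
      · rw [min_eq_left (by omega), min_eq_left (by omega)]
  rw [← this]
  refine iter_congr fun i _ r => ?_
  simp only [Function.update_self, ne_eq, not_false_eq_true,
    Function.update_of_ne, OfNat.one_ne_ofNat]

end IsComputable

namespace IsDecidable

variable {f g a b : List ℕ → (ℕ → ℕ) → ℕ} {P Q : List ℕ → (ℕ → ℕ) → Prop}

theorem congr (hP : IsDecidable P) (h : ∀ w v, P w v ↔ Q w v) : IsDecidable Q := by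
  rwa [show Q = P from funext fun w => funext fun v => propext (h w v).symm]

theorem lt (hf : IsComputable f) (hg : IsComputable g) : IsDecidable fun w v => f w v < g w v :=
  (IsComputable.cond (hg.sub hf) (.const 1) (.const 0)).congr fun w v => by split_ifs <;> omega

theorem not (hP : IsDecidable P) : IsDecidable fun w v => ¬ P w v :=
  (IsComputable.ite hP (.const 0) (.const 1)).congr fun w v => by split_ifs <;> first | rfl | contradiction

theorem and (hP : IsDecidable P) (hQ : IsDecidable Q) : IsDecidable fun w v => P w v ∧ Q w v :=
  (IsComputable.ite hP hQ (.const 0)).congr fun w v => by split_ifs <;> simp_all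

theorem or (hP : IsDecidable P) (hQ : IsDecidable Q) : IsDecidable fun w v => P w v ∨ Q w v :=
  (hP.not.and hQ.not).not.congr fun w v => by tauto

theorem imp (hP : IsDecidable P) (hQ : IsDecidable Q) : IsDecidable fun w v => P w v → Q w v :=
  (hP.not.or hQ).congr fun w v => by tauto

theorem le (hf : IsComputable f) (hg : IsComputable g) : IsDecidable fun w v => f w v ≤ g w v :=
  (lt hg hf).not.congr fun w v => by omega

theorem eq (hf : IsComputable f) (hg : IsComputable g) : IsDecidable fun w v => f w v = g w v :=
  ((le hf hg).and (le hg hf)).congr fun w v => by omega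

theorem all (x : ℕ) (hP : IsDecidable P) (hx : x ≠ 0 := by decide) :
    IsDecidable fun w v => ∀ i < v 0, P w (Function.update v x i) := by
  classical
  refine (IsComputable.loopIte (x := x) (y := x + 1) hx (by simp) (.const 1) hP (.var (x + 1))
    (.const 0)).congr fun w v => ?_
  simp only [Function.update_self]
  have : ∀ n, iter (fun i r => if P w (Function.update v x i) then r else 0) 1 n =
      if ∀ i < n, P w (Function.update v x i) then 1 else 0 := by
    intro n
    induction n with
    | zero => simp [iter]
    | succ n ih =>
      rw [iter, ih]
      by_cases h : P w (Function.update v x n)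
      · simp only [h, if_true, Nat.lt_succ_iff_lt_or_eq, or_imp, forall_and, forall_eq, and_true]
      · rw [if_neg h, if_neg fun h' => h (h' n n.lt_succ_self)]
  rw [this]
  split_ifs <;> rfl

theorem ex (x : ℕ) (hP : IsDecidable P) (hx : x ≠ 0 := by decide) :
    IsDecidable fun w v => ∃ i < v 0, P w (Function.update v x i) :=
  (all x hP.not hx).not.congr fun w v => by push Not; rfl

end IsDecidable

/-! #### Sets of numbers, coded as numbers -/

open Classical in
/-- The code of the set of all `p < n` with `P p`. -/
noncomputable def setCode (P : ℕ → Prop) : ℕ → ℕ := iter (fun p r => if P p then r + 2 ^ p else r) 0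

/-- Membership of `i` in the set coded by `n`, for `i < B` and `n < 2 ^ B`. -/
def Mem (B n i : ℕ) : Prop :=
  2 ^ min i B ≤ iter (fun t r => if i < B - 1 - t ∧ 2 ^ min (B - 1 - t) B ≤ r then
    r - 2 ^ min (B - 1 - t) B else r) n B

theorem setCode_lt (P : ℕ → Prop) (n : ℕ) : setCode P n < 2 ^ n := by
  induction n with
  | zero => simp [setCode, iter]
  | succ n ih =>
    rw [setCode, iter]
    rw [setCode] at ih
    rw [pow_succ]
    split_ifs <;> omega

theorem setCode_succ (P : ℕ → Prop) [DecidablePred P] (n : ℕ) :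
    setCode P (n + 1) = if P n then setCode P n + 2 ^ n else setCode P n := by
  rw [setCode, iter]
  split_ifs <;> rfl

open Classical in
theorem setCode_congr {P Q : ℕ → Prop} {n : ℕ} (h : ∀ i < n, P i ↔ Q i) :
    setCode P n = setCode Q n :=
  iter_congr fun i hi _ => if_congr (h i hi) rfl rfl

/-- The binary digits above `i` are subtracted from the top downwards: after `t` rounds those from
`max (i + 1) (B - t)` on are gone. The final remainder is less than `2 ^ (i + 1)`, so comparing it
with `2 ^ i` reveals digit `i`. -/
theorem mem_setCode {P : ℕ → Prop} {n i B : ℕ} (hn : n ≤ B) (hi : i < B) :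
    Mem B (setCode P n) i ↔ i < n ∧ P i := by
  classical
  have hext : setCode P n = setCode (fun j => j < n ∧ P j) B := by
    obtain ⟨k, rfl⟩ := Nat.exists_eq_add_of_le hn
    clear hn hi
    induction k with
    | zero => exact setCode_congr fun i hi => (and_iff_right hi).symm
    | succ k ih => rw [← add_assoc, setCode_succ, if_neg (by omega), ← ih]
  rw [hext]
  generalize hQ : (fun j => j < n ∧ P j) = Q
  rw [show (i < n ∧ P i) ↔ Q i by rw [← hQ]]
  have key : ∀ t, iter (fun t r => if i < B - 1 - t ∧ 2 ^ min (B - 1 - t) B ≤ r then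
      r - 2 ^ min (B - 1 - t) B else r) (setCode Q B) t = setCode Q (max (i + 1) (B - t)) := by
    intro t
    induction t with
    | zero => rw [iter, max_eq_right (by omega)]; rfl
    | succ t ih =>
      rw [iter, ih]
      by_cases ht : i < B - 1 - t
      · rw [max_eq_right (by omega), max_eq_right (by omega), show B - t = B - 1 - t + 1 by omega,
          show B - (t + 1) = B - 1 - t by omega, setCode_succ, min_eq_left (by omega)]
        have := setCode_lt Q (B - 1 - t)
        by_cases h : Q (B - 1 - t)
        · simp [h, ht]
        · simp [h, this]
      · rw [if_neg (fun h => ht h.1), max_eq_left (by omega), max_eq_left (by omega)]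
  rw [Mem, key, Nat.sub_self, max_eq_left (Nat.zero_le _), setCode_succ, min_eq_left hi.le]
  have := setCode_lt Q i
  split_ifs with h
  · simp [h]
  · simp [h, this]

theorem IsDecidable.mem {a b : List ℕ → (ℕ → ℕ) → ℕ} (ha : IsComputable a) (hb : IsComputable b) :
    IsDecidable fun w v => Mem (v 0) (a w v) (b w v) := by
  classical
  refine IsComputable.app (G := fun B n i => if Mem B n i then 1 else 0) ?_ ha hb
  refine IsDecidable.le (.twoPow (.var 2)) ?_
  have hj : IsComputable fun _ v => v 0 - 1 - v 3 := ((IsComputable.var 0).sub (.const 1)).sub (.var 3)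
  refine (IsComputable.loop (x := 3) (y := 4) (by simp) (by simp) (.var 1)
    (IsComputable.ite ((IsDecidable.lt (.var 2) hj).and (.le (.twoPow hj) (.var 4)))
      ((IsComputable.var 4).sub (.twoPow hj)) (.var 4))).congr fun w v => ?_
  refine iter_congr fun i _ r => ?_
  simp only [Function.update_self, ne_eq, Nat.reduceEqDiff, not_false_eq_true,
    Function.update_of_ne, OfNat.zero_ne_ofNat]

theorem IsComputable.setCode {P : List ℕ → (ℕ → ℕ) → Prop} (x : ℕ) (hP : IsDecidable P)
    (hx : x ≠ 0 := by decide) :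
    IsComputable fun w v => setCode (fun i => P w (Function.update v x i)) (v 0) := by
  classical
  refine (IsComputable.loopIte (x := x) (y := x + 1) hx (by simp) (.const 0) hP
    ((IsComputable.var (x + 1)).add (.twoPow (.var x))) (.var (x + 1))).congr fun w v => ?_
  refine iter_congr fun i hi r => ?_
  have h1 : x ≠ x + 1 := by omega
  simp only [Function.update_self, Function.update_of_ne h1, Function.update_of_ne hx.symm,
    Function.update_of_ne (show (0 : ℕ) ≠ x + 1 by omega), min_eq_left hi.le]

end Cmd

/-! ### An exhaustive search for Hintikka structures -/

namespace CTL

namespace Search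

/-- The operation code of the entry `i` of the input. -/
def op (w : List ℕ) (i : ℕ) : ℕ := w.getD (i + i + i) 0

/-- The first argument of the entry `i`. -/
def fst (w : List ℕ) (i : ℕ) : ℕ := w.getD (i + i + i + 1) 0

/-- The second argument of the entry `i`. -/
def snd (w : List ℕ) (i : ℕ) : ℕ := w.getD (i + i + i + 2) 0

/-- The `k` entries of the input describe formulas. -/
def Valid (w : List ℕ) (B k : ℕ) : Prop :=
  ∀ i < B, i < k → op w i < 12 ∧ (4 ≤ op w i → fst w i < i) ∧
    ((4 ≤ op w i ∧ op w i < 6) ∨ 8 ≤ op w i → snd w i < i)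

open Cmd (Mem)

/-- The set `S` of entries has no local contradictions. -/
def Local (w : List ℕ) (B k S : ℕ) : Prop :=
  ∀ i < B, i < k → Mem B S i → ¬ op w i = 1 ∧
    (op w i = 2 → ∀ i' < B, i' < k → Mem B S i' → ¬ (op w i' = 3 ∧ fst w i' = fst w i)) ∧
    (op w i = 4 → Mem B S (fst w i) ∨ Mem B S (snd w i)) ∧
    (op w i = 5 → Mem B S (fst w i) ∧ Mem B S (snd w i)) ∧
    (op w i = 8 ∨ op w i = 9 → Mem B S (snd w i) ∨ Mem B S (fst w i)) ∧
    (op w i = 10 ∨ op w i = 11 → Mem B S (snd w i))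

/-- The set `S'` can be the successor of `S` for the entry `e`. -/
def Succ (w : List ℕ) (B k S e S' : ℕ) : Prop :=
  ∀ i < B, i < k → Mem B S i →
    (op w i = 7 ∨ (op w i = 6 ∧ e = i) → Mem B S' (fst w i)) ∧
    (op w i = 9 ∨ (op w i = 8 ∧ e = i) → Mem B S (snd w i) ∨ Mem B S' i) ∧
    (op w i = 11 ∨ (op w i = 10 ∧ e = i) → Mem B S (fst w i) ∨ Mem B S' i)

/-- The entry `j` is an eventuality that is not fulfilled in `S` and is passed on to the successor
for `e`. -/
def Waits (w : List ℕ) (B S e j : ℕ) : Prop :=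
  Mem B S j ∧ ¬ Mem B S (snd w j) ∧ (op w j = 9 ∨ (op w j = 8 ∧ e = j))

/-- The code of the pair of a set of entries and an entry. -/
def code (B k S j : ℕ) : ℕ := 2 ^ min (k + j) B + S

/-- One step of the nested fixpoint iteration. -/
def Body (w : List ℕ) (B k z y p : ℕ) : Prop :=
  ∃ j < B, ∃ S < B, j < k ∧ S < 2 ^ min k B ∧ p = code B k S j ∧ Local w B k S ∧
    ∀ e < B, e < k → ∃ S' < B, S' < 2 ^ min k B ∧ Succ w B k S e S' ∧
      ((Waits w B S e j ∧ Mem B y (code B k S' j)) ∨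
        (¬ Waits w B S e j ∧ ((j + 1 < k ∧ Mem B z (code B k S' (j + 1))) ∨
          (¬ j + 1 < k ∧ Mem B z (code B k S' 0)))))

/-- The code of the nested fixpoint. -/
noncomputable def result (w : List ℕ) (B k : ℕ) : ℕ :=
  Cmd.iter (fun _ z => Cmd.iter (fun _ y => Cmd.setCode (Body w B k z y) B) 0 B)
    (Cmd.setCode (fun _ => True) B) B

/-- The search is successful. -/
def Accepts (w : List ℕ) (B : ℕ) : Prop :=
  ∃ k < B, w.length = k + k + k ∧ 0 < k ∧ Valid w B k ∧
    ∃ S < B, S < 2 ^ min k B ∧ Mem B S (k - 1) ∧ Mem B (result w B k) (code B k S 0)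

section

open Cmd

variable {a : List ℕ → (ℕ → ℕ) → ℕ}

theorem computable_op (ha : IsComputable a) : IsComputable fun w v => op w (a w v) :=
  .input ((ha.add ha).add ha)

theorem computable_fst (ha : IsComputable a) : IsComputable fun w v => fst w (a w v) :=
  .input (((ha.add ha).add ha).add (.const 1))

theorem computable_snd (ha : IsComputable a) : IsComputable fun w v => snd w (a w v) :=
  .input (((ha.add ha).add ha).add (.const 2))

/-- The names are the same in all these lemmas: 0 is `B`, 1 is `k`, 2 and 3 are the coded sets `z`
and `y`, 4 is `p`, 5 is `j`, 6 is `S`, 7 is `e`, 8 is `S'`, and 9 and 10 are bound entries. Hence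
the quantifiers can be put in front one after the other without renaming. -/
theorem decidable_valid : IsDecidable fun w v => Valid w (v 0) (v 1) := by
  have h : IsDecidable fun w v => v 9 < v 1 → op w (v 9) < 12 ∧
      (4 ≤ op w (v 9) → fst w (v 9) < v 9) ∧
      ((4 ≤ op w (v 9) ∧ op w (v 9) < 6) ∨ 8 ≤ op w (v 9) → snd w (v 9) < v 9) := by
    repeat' first
      | exact .var _ | exact .const _ | apply computable_op | apply computable_fst
      | apply computable_snd | apply IsDecidable.and | apply IsDecidable.or | apply IsDecidable.lt
      | apply IsDecidable.le | apply IsDecidable.imp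
  exact h.all 9

theorem decidable_local : IsDecidable fun w v => Local w (v 0) (v 1) (v 6) := by
  have h : IsDecidable fun w v => v 10 < v 1 → Mem (v 0) (v 6) (v 10) →
      ¬ (op w (v 10) = 3 ∧ fst w (v 10) = fst w (v 9)) := by
    repeat' first
      | exact .var _ | exact .const _ | apply computable_op | apply computable_fst
      | apply IsDecidable.and | apply IsDecidable.not | apply IsDecidable.eq
      | apply IsDecidable.mem | apply IsDecidable.lt | apply IsDecidable.imp
  have h' : IsDecidable fun w v => v 9 < v 1 → Mem (v 0) (v 6) (v 9) → ¬ op w (v 9) = 1 ∧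
      (op w (v 9) = 2 → ∀ i' < v 0, i' < v 1 → Mem (v 0) (v 6) i' →
        ¬ (op w i' = 3 ∧ fst w i' = fst w (v 9))) ∧
      (op w (v 9) = 4 → Mem (v 0) (v 6) (fst w (v 9)) ∨ Mem (v 0) (v 6) (snd w (v 9))) ∧
      (op w (v 9) = 5 → Mem (v 0) (v 6) (fst w (v 9)) ∧ Mem (v 0) (v 6) (snd w (v 9))) ∧
      (op w (v 9) = 8 ∨ op w (v 9) = 9 →
        Mem (v 0) (v 6) (snd w (v 9)) ∨ Mem (v 0) (v 6) (fst w (v 9))) ∧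
      (op w (v 9) = 10 ∨ op w (v 9) = 11 → Mem (v 0) (v 6) (snd w (v 9))) := by
    repeat' first
      | exact .var _ | exact .const _ | exact h.all 10 | apply computable_op | apply computable_fst
      | apply computable_snd | apply IsDecidable.and | apply IsDecidable.or | apply IsDecidable.not
      | apply IsDecidable.eq | apply IsDecidable.mem | apply IsDecidable.lt | apply IsDecidable.imp
  exact h'.all 9

theorem decidable_succ : IsDecidable fun w v => Succ w (v 0) (v 1) (v 6) (v 7) (v 8) := by
  have h : IsDecidable fun w v => v 9 < v 1 → Mem (v 0) (v 6) (v 9) →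
      (op w (v 9) = 7 ∨ (op w (v 9) = 6 ∧ v 7 = v 9) → Mem (v 0) (v 8) (fst w (v 9))) ∧
      (op w (v 9) = 9 ∨ (op w (v 9) = 8 ∧ v 7 = v 9) →
        Mem (v 0) (v 6) (snd w (v 9)) ∨ Mem (v 0) (v 8) (v 9)) ∧
      (op w (v 9) = 11 ∨ (op w (v 9) = 10 ∧ v 7 = v 9) →
        Mem (v 0) (v 6) (fst w (v 9)) ∨ Mem (v 0) (v 8) (v 9)) := by
    repeat' first
      | exact .var _ | exact .const _ | apply computable_op | apply computable_fst
      | apply computable_snd | apply IsDecidable.and | apply IsDecidable.or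
      | apply IsDecidable.eq | apply IsDecidable.mem | apply IsDecidable.lt | apply IsDecidable.imp
  exact h.all 9

theorem decidable_waits : IsDecidable fun w v => Waits w (v 0) (v 6) (v 7) (v 5) := by
  have h : IsDecidable fun w v => Mem (v 0) (v 6) (v 5) ∧ ¬ Mem (v 0) (v 6) (snd w (v 5)) ∧
      (op w (v 5) = 9 ∨ (op w (v 5) = 8 ∧ v 7 = v 5)) := by
    repeat' first
      | exact .var _ | exact .const _ | apply computable_op | apply computable_snd
      | apply IsDecidable.and | apply IsDecidable.or | apply IsDecidable.not | apply IsDecidable.eq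
      | apply IsDecidable.mem
  exact h

theorem computable_code {a b : List ℕ → (ℕ → ℕ) → ℕ} (ha : IsComputable a) (hb : IsComputable b) :
    IsComputable fun w v => code (v 0) (v 1) (a w v) (b w v) :=
  .add (.twoPow (.add (.var 1) hb)) ha

theorem decidable_body : IsDecidable fun w v => Body w (v 0) (v 1) (v 2) (v 3) (v 4) := by
  have h1 : IsDecidable fun w v => v 8 < 2 ^ min (v 1) (v 0) ∧
      Succ w (v 0) (v 1) (v 6) (v 7) (v 8) ∧
      ((Waits w (v 0) (v 6) (v 7) (v 5) ∧ Mem (v 0) (v 3) (code (v 0) (v 1) (v 8) (v 5))) ∨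
        (¬ Waits w (v 0) (v 6) (v 7) (v 5) ∧
          ((v 5 + 1 < v 1 ∧ Mem (v 0) (v 2) (code (v 0) (v 1) (v 8) (v 5 + 1))) ∨
            (¬ v 5 + 1 < v 1 ∧ Mem (v 0) (v 2) (code (v 0) (v 1) (v 8) 0))))) := by
    repeat' first
      | exact .var _ | exact .const _ | exact decidable_succ | exact decidable_waits
      | apply computable_code | apply IsComputable.twoPow | apply IsComputable.add
      | apply IsDecidable.and | apply IsDecidable.or | apply IsDecidable.not
      | apply IsDecidable.lt | apply IsDecidable.mem
  have h2 : IsDecidable fun w v => v 7 < v 1 → ∃ S' < v 0, S' < 2 ^ min (v 1) (v 0) ∧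
      Succ w (v 0) (v 1) (v 6) (v 7) S' ∧
      ((Waits w (v 0) (v 6) (v 7) (v 5) ∧ Mem (v 0) (v 3) (code (v 0) (v 1) S' (v 5))) ∨
        (¬ Waits w (v 0) (v 6) (v 7) (v 5) ∧
          ((v 5 + 1 < v 1 ∧ Mem (v 0) (v 2) (code (v 0) (v 1) S' (v 5 + 1))) ∨
            (¬ v 5 + 1 < v 1 ∧ Mem (v 0) (v 2) (code (v 0) (v 1) S' 0))))) :=
    .imp (.lt (.var 7) (.var 1)) (h1.ex 8)
  have h3 := (IsDecidable.lt (.var 5) (.var 1)).and ((IsDecidable.lt (.var 6) (.twoPow (.var 1))).and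
    ((IsDecidable.eq (.var 4) (computable_code (.var 6) (.var 5))).and
      (decidable_local.and (h2.all 7))))
  exact (h3.ex 6).ex 5

theorem decidable_accepts : IsDecidable fun w v => Accepts w (v 0) := by
  have h1 : IsComputable fun w v => result w (v 0) (v 1) :=
    .loop (x := 12) (y := 2) (by simp) (by simp)
      (.setCode 12 (P := fun _ _ => True) ((IsDecidable.eq (.const 0) (.const 0)).congr (by simp)))
      (.loop (x := 12) (y := 3) (by simp) (by simp) (.const 0) (.setCode 4 decidable_body))
  have h2 := (IsDecidable.lt (.var 6) (.twoPow (.var 1))).and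
    ((IsDecidable.mem (.var 6) ((IsComputable.var 1).sub (.const 1))).and
      (.mem h1 (computable_code (.var 6) (.const 0))))
  have h3 : IsDecidable fun w v => w.length = v 1 + v 1 + v 1 ∧ 0 < v 1 ∧ Valid w (v 0) (v 1) ∧
      ∃ S < v 0, S < 2 ^ min (v 1) (v 0) ∧ Mem (v 0) S (v 1 - 1) ∧
        Mem (v 0) (result w (v 0) (v 1)) (code (v 0) (v 1) S 0) :=
    .and (.eq .len (.add (.add (.var 1) (.var 1)) (.var 1))) (.and (.lt (.const 0) (.var 1))
      (.and decidable_valid (h2.ex 6)))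
  exact h3.ex 1

end

end Search

end CTL

/-! #### Exponential time -/

theorem length_le_bitSize (w : List ℕ) : w.length ≤ bitSize w := by
  induction w with
  | nil => simp
  | cons a w ih => simp only [bitSize, List.map_cons, List.sum_cons, List.length_cons] at ih ⊢; omega

/-- For a monomial, `a ≤ 2 ^ a` and `(2 ^ n) ^ d = 2 ^ (n * d)`; a sum of two powers of two is
absorbed by adding the exponents and one more. -/
theorem exists_eval_two_pow_le (p : Polynomial ℕ) :
    ∃ q : Polynomial ℕ, ∀ n m, n ≤ m → p.eval (2 ^ n) ≤ 2 ^ q.eval m := by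
  induction p using Polynomial.induction_on' with
  | add p p' ih ih' =>
    obtain ⟨q, hq⟩ := ih
    obtain ⟨q', hq'⟩ := ih'
    refine ⟨q + q' + 1, fun n m h => ?_⟩
    simp only [Polynomial.eval_add, Polynomial.eval_one, pow_succ, pow_add]
    have h1 := hq n m h
    have h2 := hq' n m h
    have h3 := Nat.one_le_two_pow (n := q.eval m)
    have h4 := Nat.one_le_two_pow (n := q'.eval m)
    nlinarith
  | monomial d a =>
    refine ⟨.C a + .X * .C d, fun n m h => ?_⟩
    simp only [Polynomial.eval_monomial, Polynomial.eval_add, Polynomial.eval_C,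
      Polynomial.eval_mul, Polynomial.eval_X, pow_add]
    refine Nat.mul_le_mul Nat.lt_two_pow_self.le ?_
    rw [← pow_mul]
    exact Nat.pow_le_pow_right (by norm_num) (Nat.mul_le_mul_right _ h)

/-- A property of the input is decidable in exponential time if it is decidable by a loop program in
which the number of iterations of every loop is exponential. -/
theorem Cmd.IsDecidable.inEXPTIME {P : List ℕ → ℕ → Prop} (h : IsDecidable fun w v => P w (v 0))
    {L : Set (List ℕ)} (hL : ∀ w, w ∈ L ↔ P w (2 ^ w.length)) : InEXPTIME L := by
  classical
  obtain ⟨c, p, hc⟩ := h (fun _ => 0) 1 rfl fun _ => one_pos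
  obtain ⟨q, hq⟩ := exists_eval_two_pow_le (p + 1)
  -- Doubling 1 as often as the input is long puts the common loop bound `2 ^ w.length` into the
  -- variable 0.
  let pre : Cmd := .seq (.len 1) (.seq (.const 0 1) (.rep 1 (.add 0 0 0)))
  -- The summand `5 * X + 5` in the exponent pays for this preparation, which is linear in the
  -- length of the input, and for the final copy of the result.
  refine ⟨(Cmd.seq pre c).program 1, q + 5 * .X + 5, fun w => ?_⟩
  have hrep := rep_inv' (w := w) (c := .add 0 0 0) (x := 1)
    (s := (Cmd.const 0 1).eval w ((Cmd.len 1).eval w initStore)) (N := w.length)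
    (fun i s => s.var 0 = 2 ^ i) rfl (by simp [eval, Store.set]) (by simp [eval, Store.set])
    (fun i _ s hs => by
      simp only [eval, Store.set, Function.update_self, pow_succ, hs]
      omega)
  obtain ⟨h0, hcost⟩ := hrep
  change (pre.eval w initStore).var 0 = _ at h0
  obtain ⟨h1, -, h3⟩ := hc w (pre.eval w initStore)
  simp only [Function.comp_apply, h0] at h1 h3
  refine Cmd.decidesWithin _ 1 w ?_ ?_
  · have e : (Cmd.seq pre c).cost w initStore = 1 + (1 + (Cmd.rep 1 (.add 0 0 0)).cost w
        ((Cmd.const 0 1).eval w ((Cmd.len 1).eval w initStore))) +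
        c.cost w (pre.eval w initStore) := rfl
    have hb := length_le_bitSize w
    have h4 := hq _ _ hb
    simp only [Polynomial.eval_add, Polynomial.eval_one, Polynomial.eval_mul, Polynomial.eval_X,
      Polynomial.eval_ofNat, pow_add] at h4 ⊢
    set x := 2 ^ q.eval (bitSize w)
    have h5 : 5 * bitSize w < 2 ^ (5 * bitSize w) := Nat.lt_two_pow_self
    have hx : 1 ≤ x := Nat.one_le_two_pow
    simp only [Cmd.bound] at hcost
    rw [e]
    nlinarith
  · change ((Cmd.seq pre c).eval w initStore).var 1 = _ at h1
    rw [h1, hL]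
    by_cases hP : P w (2 ^ w.length) <;> simp [hP]

namespace CTL

namespace Search

/-! #### What an input describes -/

/-- `IsEntry form o a b φ`: the entry `o, a, b` describes `φ` if the formula with number `i` is
`form i`. -/
inductive IsEntry (form : ℕ → CTL) : ℕ → ℕ → ℕ → CTL → Prop
  | tt (a b : ℕ) : IsEntry form 0 a b .tt
  | ff (a b : ℕ) : IsEntry form 1 a b .ff
  | pos (a b : ℕ) : IsEntry form 2 a b (.pos a)
  | neg (a b : ℕ) : IsEntry form 3 a b (.neg a)
  | or (a b : ℕ) : IsEntry form 4 a b (.or (form a) (form b))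
  | and (a b : ℕ) : IsEntry form 5 a b (.and (form a) (form b))
  | nextE (a b : ℕ) : IsEntry form 6 a b (.next .E (form a))
  | nextA (a b : ℕ) : IsEntry form 7 a b (.next .A (form a))
  | untlE (a b : ℕ) : IsEntry form 8 a b (.untl .E (form a) (form b))
  | untlA (a b : ℕ) : IsEntry form 9 a b (.untl .A (form a) (form b))
  | relE (a b : ℕ) : IsEntry form 10 a b (.rel .E (form a) (form b))
  | relA (a b : ℕ) : IsEntry form 11 a b (.rel .A (form a) (form b))

/-- The arguments of the entry `o, a, b` are smaller than `n`. -/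
def ValidEntry (n o a b : ℕ) : Prop :=
  o < 12 ∧ (4 ≤ o → a < n) ∧ ((4 ≤ o ∧ o < 6) ∨ 8 ≤ o → b < n)

theorem exists_decodeEntry {L : List CTL} {o a b : ℕ} (h : ValidEntry L.length o a b) :
    ∃ φ, decodeEntry L o a b = some φ := by
  obtain ⟨ho, ha, hb⟩ := h
  interval_cases o <;> simp at ha hb <;> simp [decodeEntry, *]

theorem decodeEntry_valid {L : List CTL} {o a b : ℕ} {φ : CTL}
    (h : decodeEntry L o a b = some φ) : ValidEntry L.length o a b := by
  by_cases ho : o < 12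
  · refine ⟨ho, fun h4 => ?_, fun h8 => ?_⟩ <;> by_contra hcon <;>
      interval_cases o <;> simp_all [decodeEntry]
  · obtain ⟨o, rfl⟩ := Nat.exists_eq_add_of_le' (not_lt.1 ho)
    simp [decodeEntry] at h

theorem isEntry_of_decodeEntry {L L' : List CTL} {o a b : ℕ} {φ : CTL}
    (h : decodeEntry L o a b = some φ) :
    IsEntry (fun i => (L ++ L').getD i .tt) o a b φ := by
  obtain ⟨ho, ha, hb⟩ := decodeEntry_valid h
  have hget : ∀ i < L.length, L[i]? = some ((L ++ L').getD i .tt) := fun i hi => by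
    simp [List.getElem?_append_left, hi]
  change ∀ i < L.length, L[i]? = some ((fun i => (L ++ L').getD i .tt) i) at hget
  generalize (fun i => (L ++ L').getD i .tt) = f at hget ⊢
  interval_cases o <;> simp only [Nat.reduceLeDiff, le_refl, forall_const, Nat.reduceLT, and_true,
    or_true, or_false, and_false] at ha hb <;>
    simp only [decodeEntry, hget, ha, hb, Option.bind_eq_bind, Option.bind_some, Option.pure_def,
      Option.some.injEq] at h <;> subst h <;> constructor

theorem entry_cons (x y z : ℕ) (w : List ℕ) (i : ℕ) : op (x :: y :: z :: w) (i + 1) = op w i ∧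
    fst (x :: y :: z :: w) (i + 1) = fst w i ∧ snd (x :: y :: z :: w) (i + 1) = snd w i := by
  have h : i + 1 + (i + 1) + (i + 1) = i + i + i + 3 := by ring
  simp only [op, fst, snd, h]
  exact ⟨rfl, rfl, rfl⟩

theorem decodeList_eq_some {L w L' : List _} (h : decodeList L w = some L') :
    ∃ M : List CTL, L' = L ++ M ∧ w.length = M.length + M.length + M.length ∧
      ∀ i (hi : i < M.length),
        decodeEntry (L ++ M.take i) (op w i) (fst w i) (snd w i) = some M[i] := by
  fun_induction decodeList L w with
  | case1 L => exact ⟨[], by simpa using h.symm, rfl, by simp⟩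
  | case2 L o a b w φ hφ ih =>
    obtain ⟨M, rfl, hlen, hM⟩ := ih h
    refine ⟨φ :: M, by simp, by simp [hlen]; omega, fun i hi => ?_⟩
    rcases i with - | i
    · simpa [op, fst, snd] using hφ
    · obtain ⟨e1, e2, e3⟩ := entry_cons o a b w i
      rw [e1, e2, e3]
      simpa using hM i (by simpa using hi)
  | case3 => cases h
  | case4 => cases h

theorem exists_decodeList {w : List ℕ} {k : ℕ} : ∀ {L : List CTL}, w.length = k + k + k →
    (∀ i < k, ValidEntry (L.length + i) (op w i) (fst w i) (snd w i)) →
    ∃ L', decodeList L w = some L' := by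
  induction k generalizing w with
  | zero =>
    intro L hw _
    rw [List.length_eq_zero_iff.1 hw]
    exact ⟨L, rfl⟩
  | succ k ih =>
    intro L hw h
    rcases w with - | ⟨o, - | ⟨a, - | ⟨b, w⟩⟩⟩
    · simp at hw
    · simp at hw; omega
    · simp at hw; omega
    · obtain ⟨φ, hφ⟩ := exists_decodeEntry (h 0 k.succ_pos)
      change decodeEntry L o a b = some φ at hφ
      simp only [decodeList, hφ]
      refine ih (by simp at hw; omega) fun i hi => ?_
      have := h (i + 1) (by omega)
      obtain ⟨e1, e2, e3⟩ := entry_cons o a b w i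
      rw [e1, e2, e3] at this
      rwa [List.length_append, List.length_singleton, add_assoc, add_comm 1]

/-- The input `w` describes the formulas `form i` for `i < k`. -/
structure Describes (w : List ℕ) (k : ℕ) (form : ℕ → CTL) : Prop where
  valid : ∀ i < k, ValidEntry i (op w i) (fst w i) (snd w i)
  entry : ∀ i < k, IsEntry form (op w i) (fst w i) (snd w i) (form i)

theorem describes_of_decode {w : List ℕ} {φ : CTL} (h : decode w = some φ) :
    ∃ k form, w.length = k + k + k ∧ 0 < k ∧ Describes w k form ∧ φ = form (k - 1) := by
  obtain ⟨L, hL, hφ⟩ := Option.bind_eq_some_iff.1 h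
  obtain ⟨_, rfl, hlen, hM⟩ := decodeList_eq_some hL
  refine ⟨L.length, fun i => L.getD i .tt, hlen, ?_, ⟨fun i hi => ?_, fun i hi => ?_⟩, ?_⟩
  · refine List.length_pos_iff.2 ?_
    rintro rfl
    simp at hφ
  · have := decodeEntry_valid (hM i hi)
    rwa [List.nil_append, List.length_take, min_eq_left hi.le] at this
  · have := isEntry_of_decodeEntry (L' := L.drop i) (hM i hi)
    simp only [List.nil_append, List.take_append_drop] at this
    rwa [List.getD_eq_getElem _ _ hi]
  · rw [List.getLast?_eq_getElem?] at hφ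
    simp [hφ]

theorem exists_decode {w : List ℕ} {k : ℕ} (hw : w.length = k + k + k) (hk : 0 < k)
    (h : ∀ i < k, ValidEntry i (op w i) (fst w i) (snd w i)) : ∃ φ, decode w = some φ := by
  obtain ⟨L, hL⟩ := exists_decodeList (L := []) hw (by simpa using h)
  obtain ⟨_, rfl, hlen, -⟩ := decodeList_eq_some hL
  have : L ≠ [] := List.length_pos_iff.1 (by omega)
  exact ⟨L.getLast this, by simp [decode, hL, List.getLast?_eq_some_getLast this]⟩

section

variable {form : ℕ → CTL} {o a b p : ℕ} {q : Quant} {φ ψ : CTL}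

theorem IsEntry.ff_inv (h : IsEntry form o a b .ff) : o = 1 := by cases h; rfl

theorem IsEntry.pos_inv (h : IsEntry form o a b (.pos p)) : o = 2 ∧ a = p := by
  cases h; exact ⟨rfl, rfl⟩

theorem IsEntry.neg_inv (h : IsEntry form o a b (.neg p)) : o = 3 ∧ a = p := by
  cases h; exact ⟨rfl, rfl⟩

theorem IsEntry.or_inv (h : IsEntry form o a b (.or φ ψ)) : o = 4 ∧ form a = φ ∧ form b = ψ := by
  cases h; exact ⟨rfl, rfl, rfl⟩

theorem IsEntry.and_inv (h : IsEntry form o a b (.and φ ψ)) : o = 5 ∧ form a = φ ∧ form b = ψ := by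
  cases h; exact ⟨rfl, rfl, rfl⟩

theorem IsEntry.next_inv (h : IsEntry form o a b (.next q φ)) :
    ((q = .E ∧ o = 6) ∨ (q = .A ∧ o = 7)) ∧ form a = φ := by
  cases h
  · exact ⟨Or.inl ⟨rfl, rfl⟩, rfl⟩
  · exact ⟨Or.inr ⟨rfl, rfl⟩, rfl⟩

theorem IsEntry.untl_inv (h : IsEntry form o a b (.untl q φ ψ)) :
    ((q = .E ∧ o = 8) ∨ (q = .A ∧ o = 9)) ∧ form a = φ ∧ form b = ψ := by
  cases h
  · exact ⟨Or.inl ⟨rfl, rfl⟩, rfl, rfl⟩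
  · exact ⟨Or.inr ⟨rfl, rfl⟩, rfl, rfl⟩

theorem IsEntry.rel_inv (h : IsEntry form o a b (.rel q φ ψ)) :
    ((q = .E ∧ o = 10) ∨ (q = .A ∧ o = 11)) ∧ form a = φ ∧ form b = ψ := by
  cases h
  · exact ⟨Or.inl ⟨rfl, rfl⟩, rfl, rfl⟩
  · exact ⟨Or.inr ⟨rfl, rfl⟩, rfl, rfl⟩

end

/-! #### The fixpoint and its code -/

open Cmd (Mem)

/-- The next eventuality to wait for, in a cyclic order. -/
def nextPos {k : ℕ} (j : Fin k) : Fin k := ⟨if j.val + 1 < k then j + 1 else 0, by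
  have := j.2
  split_ifs <;> omega⟩

/-- Go up to the last position, wrap around to 0, and go up to `j`. -/
theorem exists_iterate_nextPos {k : ℕ} (i j : Fin k) : ∃ n, nextPos^[n] i = j := by
  have hk : 0 < k := i.pos
  have h0 : ∀ d, ∀ i : Fin k, i.val + d + 1 = k → nextPos^[d + 1] i = ⟨0, hk⟩ := by
    intro d
    induction d with
    | zero => exact fun i hi => Fin.ext (if_neg (by omega))
    | succ d ih =>
      intro i hi
      rw [Function.iterate_succ_apply]
      refine ih _ ?_
      simp only [nextPos]
      rw [if_pos (by omega)]; omega
  have h1 : ∀ n (hn : n < k), nextPos^[n] ⟨0, hk⟩ = ⟨n, hn⟩ := by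
    intro n
    induction n with
    | zero => exact fun _ => rfl
    | succ n ih =>
      intro hn
      rw [Function.iterate_succ_apply', ih (by omega)]
      exact Fin.ext (if_pos hn)
  refine ⟨j.val + (k - i.val - 1 + 1), ?_⟩
  rw [Function.iterate_add_apply, h0 _ i (by omega), h1 _ j.2]

variable {w : List ℕ} {B k : ℕ}

/-- Pairs of a set of entries and an eventuality that is waited for. -/
abbrev Pair (k : ℕ) : Type := Fin (2 ^ k) × Fin k

/-- The operator of which the nested fixpoint is computed. -/
def step (w : List ℕ) (B k : ℕ) (Z Y : Set (Pair k)) : Set (Pair k) :=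
  {v | Local w B k v.1 ∧ ∀ e < k, ∃ S' : Fin (2 ^ k), Succ w B k v.1 e S' ∧
    ((Waits w B v.1 e v.2 ∧ (S', v.2) ∈ Y) ∨ (¬ Waits w B v.1 e v.2 ∧ (S', nextPos v.2) ∈ Z))}

theorem step_mono : NestedFix.Mono (step w B k) := by
  rintro Z Z' Y Y' hZ hY v ⟨h1, h2⟩
  refine ⟨h1, fun e he => ?_⟩
  obtain ⟨S', h3, h4⟩ := h2 e he
  exact ⟨S', h3, h4.imp (fun h => ⟨h.1, hY h.2⟩) fun h => ⟨h.1, hZ h.2⟩⟩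

/-- The number of a pair. -/
def Pair.num (v : Pair k) : ℕ := 2 ^ (k + v.2.val) + v.1

/-- The number `z` codes the set `Z`. -/
def Codes (B : ℕ) (z : ℕ) (Z : Set (Pair k)) : Prop := ∀ v, Mem B z v.num ↔ v ∈ Z

theorem Pair.num_lt (hB : 2 ^ (k + k) ≤ B) (v : Pair k) : v.num < B := by
  have h1 := v.1.2
  have h2 : 2 ^ k ≤ 2 ^ (k + v.2.val) := Nat.pow_le_pow_right (by norm_num) (by omega)
  have h3 : 2 ^ (k + v.2.val + 1) ≤ 2 ^ (k + k) := Nat.pow_le_pow_right (by norm_num) (by omega)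
  rw [pow_succ] at h3
  unfold Pair.num
  omega

/-- The set occupies the `k` lowest binary digits and the leading digit at `k + j` shows the
eventuality. -/
theorem Pair.num_injective : Function.Injective (Pair.num (k := k)) := by
  rintro ⟨S, i⟩ ⟨S', j⟩ h
  have key : ∀ {S S' : Fin (2 ^ k)} {i j : Fin k}, i < j →
      Pair.num (S, i) < Pair.num (S', j) := by
    intro S S' i j hij
    have h1 := S.2
    have h2 : 2 ^ k ≤ 2 ^ (k + i.val) := Nat.pow_le_pow_right (by norm_num) (by omega)
    have h3 : 2 ^ (k + i.val + 1) ≤ 2 ^ (k + j.val) :=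
      Nat.pow_le_pow_right (by norm_num) (by rw [Fin.lt_def] at hij; omega)
    rw [pow_succ] at h3
    simp only [Pair.num]
    omega
  rcases lt_trichotomy i j with hij | rfl | hij
  · exact absurd h (key hij).ne
  · simp only [Pair.num, Nat.add_left_cancel_iff] at h
    rw [Fin.ext h]
  · exact absurd h (key hij).ne'

theorem bounds (hB : 2 ^ (k + k) ≤ B) : k + k < B ∧ 2 ^ k ≤ B :=
  ⟨Nat.lt_two_pow_self.trans_le hB,
    (Nat.pow_le_pow_right (by norm_num) (Nat.le_add_right k k)).trans hB⟩

theorem code_eq (hB : 2 ^ (k + k) ≤ B) (v : Pair k) : code B k v.1 v.2 = v.num := by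
  have := bounds hB
  rw [code, min_eq_left (by omega), Pair.num]

/-- All numbers that matter are less than `B`, so bounding the quantifiers by `B` and capping the
exponents at `B` change nothing. -/
theorem codes_step (hB : 2 ^ (k + k) ≤ B) {z y : ℕ} {Z Y : Set (Pair k)} (hz : Codes B z Z)
    (hy : Codes B y Y) : Codes B (Cmd.setCode (Body w B k z y) B) (step w B k Z Y) := by
  intro v
  obtain ⟨hk, hk'⟩ := bounds hB
  rw [Cmd.mem_setCode le_rfl (v.num_lt hB)]
  have hmin : min k B = k := min_eq_left (by omega)
  have hnext : ∀ S' : Fin (2 ^ k), (S', nextPos v.2) ∈ Z ↔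
      (v.2.val + 1 < k ∧ Mem B z (code B k S' (v.2.val + 1))) ∨
        (¬ v.2.val + 1 < k ∧ Mem B z (code B k S' 0)) := by
    intro S'
    rw [← hz, ← code_eq hB]
    simp only [nextPos]
    split_ifs with h <;> simp [h]
  have hnow : ∀ S' : Fin (2 ^ k), (S', v.2) ∈ Y ↔ Mem B y (code B k S' v.2) := by
    intro S'
    rw [← hy, ← code_eq hB]
  constructor
  · rintro ⟨-, j, -, S, -, hj, hS, hv, hloc, h⟩
    rw [hmin] at hS
    obtain rfl : v = (⟨S, hS⟩, ⟨j, hj⟩) :=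
      Pair.num_injective (hv.trans (code_eq hB (⟨S, hS⟩, ⟨j, hj⟩)))
    refine ⟨hloc, fun e he => ?_⟩
    obtain ⟨S', -, hS', hsucc, h⟩ := h e (by omega) he
    rw [hmin] at hS'
    refine ⟨⟨S', hS'⟩, hsucc, ?_⟩
    rw [hnext, hnow]
    exact h
  · rintro ⟨hloc, h⟩
    refine ⟨v.num_lt hB, v.2, by omega, v.1, by omega, v.2.2, by rw [hmin]; exact v.1.2,
      (code_eq hB v).symm, hloc, fun e _ he => ?_⟩
    obtain ⟨S', hsucc, h⟩ := h e he
    rw [hnext, hnow] at h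
    exact ⟨S', by omega, by rw [hmin]; exact S'.2, hsucc, h⟩

theorem codes_result (hB : 2 ^ (k + k) ≤ B) :
    Codes B (result w B k) (NestedFix.outer (step w B k) B) := by
  have hin : ∀ z Z, Codes B z Z → ∀ n,
      Codes B (Cmd.iter (fun _ y => Cmd.setCode (Body w B k z y) B) 0 n)
        ((step w B k Z)^[n] ∅) := by
    intro z Z hz n
    induction n with
    | zero =>
      intro v
      have := Cmd.mem_setCode (P := fun _ => True) (Nat.zero_le B) (v.num_lt hB)
      simpa [Cmd.setCode, Cmd.iter] using this
    | succ n ih =>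
      rw [Function.iterate_succ_apply']
      exact codes_step hB hz ih
  have hout : ∀ n, Codes B (Cmd.iter (fun _ z => Cmd.iter (fun _ y =>
      Cmd.setCode (Body w B k z y) B) 0 B) (Cmd.setCode (fun _ => True) B) n)
        ((NestedFix.inner (step w B k) B)^[n] Set.univ) := by
    intro n
    induction n with
    | zero =>
      intro v
      simp [Cmd.iter, Cmd.mem_setCode le_rfl (v.num_lt hB), v.num_lt hB]
    | succ n ih =>
      rw [Function.iterate_succ_apply']
      exact hin _ _ ih B
  exact hout B

/-- This makes `B` rounds enough to reach both fixpoints. -/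
theorem card_pair_le (hB : 2 ^ (k + k) ≤ B) : Nat.card (Pair k) ≤ B := by
  rw [Nat.card_prod, Nat.card_fin, Nat.card_fin]
  refine le_trans ?_ hB
  rw [pow_add]
  exact Nat.mul_le_mul_left _ Nat.lt_two_pow_self.le

end Search

end CTL

namespace CTL

namespace Search

open Cmd (Mem)

variable {w : List ℕ} {B k : ℕ} {form : ℕ → CTL}

/-! #### The search is sound -/

/-- While an eventuality is waited for, it remains the current one and the rank drops, so the
waiting comes to an end. -/
theorem exists_not_waits {x : ℕ → Pair k} {e : ℕ → Fin k} {rk : Pair k → ℕ}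
    (h : ∀ n, Waits w B (x n).1 (e n) (x n).2 → (x (n + 1)).2 = (x n).2 ∧ rk (x (n + 1)) < rk (x n))
    (n : ℕ) : ∃ m ≥ n, (x m).2 = (x n).2 ∧ ¬ Waits w B (x m).1 (e m) (x m).2 := by
  induction hr : rk (x n) using Nat.strong_induction_on generalizing n with
  | _ r ih =>
    by_cases hw : Waits w B (x n).1 (e n) (x n).2
    · obtain ⟨h1, h2⟩ := h n hw
      obtain ⟨m, hm, h3, h4⟩ := ih _ (hr ▸ h2) _ rfl
      exact ⟨m, by omega, h3.trans h1, h4⟩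
    · exact ⟨n, le_rfl, rfl, hw⟩

/-- The pairs in the fixpoint are the states of a Hintikka structure whose names are the entries of
the input. Local and successor conditions are built into `step`; fairness comes from the rank of the
inner iteration together with the cyclic change of the eventuality. -/
theorem satisfiable_of_mem_outer (hB : 2 ^ (k + k) ≤ B) (hD : Describes w k form) {v : Pair k}
    (hv : v ∈ NestedFix.outer (step w B k) B) {i : ℕ} (hi : i < k) (hm : Mem B v.1 i) :
    (form i).Satisfiable := by
  have hkB := (bounds hB).1
  obtain ⟨rk, hrk⟩ := NestedFix.exists_rank (step_mono (w := w) (B := B) (k := k))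
    (card_pair_le hB)
  let X := {v : Pair k // v ∈ NestedFix.outer (step w B k) B}
  have hnx : ∀ (x : X) (e : Fin k), ∃ y : X, Succ w B k x.1.1 e y.1.1 ∧
      (Waits w B x.1.1 e x.1.2 → y.1.2 = x.1.2 ∧ rk y.1 < rk x.1) ∧
      (¬ Waits w B x.1.1 e x.1.2 → y.1.2 = nextPos x.1.2) := by
    intro x e
    obtain ⟨S', h1, ⟨h2, h3, h4⟩ | ⟨h2, h3⟩⟩ := (hrk _ x.2).2 e e.2
    · exact ⟨⟨_, h3⟩, h1, fun _ => ⟨rfl, h4⟩, fun h => absurd h2 h⟩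
    · exact ⟨⟨_, h3⟩, h1, fun h => absurd h h2, fun _ => rfl⟩
  choose nx hsucc hwaits hnwaits using hnx
  have hloc : ∀ (x : X) (i : Fin k), Mem B x.1.1 i → _ := fun x i hi =>
    (hrk _ x.2).1 i (by omega) i.2 hi
  have hval := fun i : Fin k => hD.valid i i.2
  have ent : ∀ {i : Fin k} {χ : CTL}, form i = χ → IsEntry form (op w i) (fst w i) (snd w i) χ :=
    fun {i χ} he => he ▸ hD.entry i i.2
  -- arguments of entries are names of formulas
  have arg : ∀ {x : X} {a i : ℕ} {φ : CTL}, a < i → i < k → form a = φ → Mem B x.1.1 a →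
      Named (fun i : Fin k => form i) {i | Mem B x.1.1 i} φ := fun ha hi hφ h =>
    ⟨⟨_, ha.trans hi⟩, h, hφ⟩
  have main : IsHintikka (fun i : Fin k => form i) (fun x : X => {i : Fin k | Mem B x.1.1 i}) nx := by
    constructor
    · rintro x ⟨i, hi, he⟩
      exact (hloc x i hi).1 (ent he).ff_inv
    · rintro x p ⟨i, hi, he⟩ ⟨i', hi', he'⟩
      obtain ⟨h1, h2⟩ := (ent he).pos_inv
      obtain ⟨h1', h2'⟩ := (ent he').neg_inv
      exact (hloc x i hi).2.1 h1 i' (by omega) i'.2 hi' ⟨h1', h2'.trans h2.symm⟩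
    · rintro x φ ψ ⟨i, hi, he⟩
      obtain ⟨ho, ha, hb⟩ := (ent he).or_inv
      obtain ⟨-, h1, h2⟩ := hval i
      exact ((hloc x i hi).2.2.1 ho).imp (arg (h1 (by omega)) i.2 ha) (arg (h2 (by omega)) i.2 hb)
    · rintro x φ ψ ⟨i, hi, he⟩
      obtain ⟨ho, ha, hb⟩ := (ent he).and_inv
      obtain ⟨-, h1, h2⟩ := hval i
      exact ((hloc x i hi).2.2.2.1 ho).imp (arg (h1 (by omega)) i.2 ha) (arg (h2 (by omega)) i.2 hb)
    · rintro x φ ⟨i, hi, he⟩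
      obtain ⟨ho, ha⟩ := (ent he).next_inv
      obtain ⟨-, h1, h2⟩ := hval i
      have ho : op w i = 6 := by simpa using ho
      exact ⟨i, arg (h1 (by omega)) i.2 ha
        ((hsucc x i i (by omega) i.2 hi).1 (Or.inr ⟨ho, rfl⟩))⟩
    · rintro x φ ⟨i, hi, he⟩ e
      obtain ⟨ho, ha⟩ := (ent he).next_inv
      obtain ⟨-, h1, h2⟩ := hval i
      have ho : op w i = 7 := by simpa using ho
      exact arg (h1 (by omega)) i.2 ha ((hsucc x e i (by omega) i.2 hi).1 (Or.inl ho))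
    · rintro x i hi q φ ψ he
      obtain ⟨ho, ha, hb⟩ := (ent he).untl_inv
      obtain ⟨-, h1, h2⟩ := hval i
      have ho' : op w i = 8 ∨ op w i = 9 := by tauto
      by_cases hψ : Mem B x.1.1 (snd w i)
      · exact Or.inl (arg (h2 (by omega)) i.2 hb hψ)
      · refine Or.inr ⟨arg (h1 (by omega)) i.2 ha
          (((hloc x i hi).2.2.2.2.1 ho').resolve_left hψ), fun e hq => ?_⟩
        refine ((hsucc x e i (by omega) i.2 hi).2.1 ?_).resolve_left hψ
        rcases ho with ⟨hE, ho⟩ | ⟨-, ho⟩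
        · exact Or.inr ⟨ho, congrArg Fin.val (hq hE)⟩
        · exact Or.inl ho
    · rintro x i hi q φ ψ he
      obtain ⟨ho, ha, hb⟩ := (ent he).rel_inv
      obtain ⟨-, h1, h2⟩ := hval i
      have ho' : op w i = 10 ∨ op w i = 11 := by tauto
      refine ⟨arg (h2 (by omega)) i.2 hb ((hloc x i hi).2.2.2.2.2 ho'), ?_⟩
      by_cases hφ : Mem B x.1.1 (fst w i)
      · exact Or.inl (arg (h1 (by omega)) i.2 ha hφ)
      · refine Or.inr fun e hq => ?_
        refine ((hsucc x e i (by omega) i.2 hi).2.2 ?_).resolve_left hφ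
        rcases ho with ⟨hE, ho⟩ | ⟨-, ho⟩
        · exact Or.inr ⟨ho, congrArg Fin.val (hq hE)⟩
        · exact Or.inl ho
    · intro x e i q φ ψ he hx hi hq
      obtain ⟨ho, -, hb⟩ := (ent he).untl_inv
      obtain ⟨-, h1, h2⟩ := hval i
      by_contra hcon
      push Not at hcon
      -- An eventuality that is carried along and never fulfilled waits whenever it is the current
      -- one. But no waiting lasts for ever, so its turn comes and its waiting would have to end.
      have hw : ∀ n, (x n).1.2 = i → Waits w B (x n).1.1 (e n) (x n).1.2 := by
        intro n hn
        rw [hn]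
        refine ⟨hi n, fun hψ => hcon n (arg (h2 (by omega)) i.2 hb hψ), ?_⟩
        rcases ho with ⟨hE, ho⟩ | ⟨-, ho⟩
        · exact Or.inr ⟨ho, congrArg Fin.val (hq hE n)⟩
        · exact Or.inl ho
      have hex := exists_not_waits (w := w) (B := B) (x := fun n => (x n).1) (e := e) (rk := rk)
        fun n hn => by
          simp only [hx]; exact hwaits _ _ hn
      have hall : ∀ t, ∃ m, (x m).1.2 = nextPos^[t] (x 0).1.2 := by
        intro t
        induction t with
        | zero => exact ⟨0, rfl⟩
        | succ t ih =>
          obtain ⟨m, hm⟩ := ih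
          obtain ⟨m', -, hm', hn⟩ := hex m
          refine ⟨m' + 1, ?_⟩
          rw [hx, hnwaits _ _ hn, hm', hm, Function.iterate_succ_apply']
      obtain ⟨t, ht⟩ := exists_iterate_nextPos (x 0).1.2 i
      obtain ⟨m, hm⟩ := hall t
      obtain ⟨m', -, hm', hn⟩ := hex m
      exact hn (hw m' (hm'.trans (hm.trans ht)))
  exact main.satisfiable (x := ⟨v, hv⟩) ⟨⟨i, hi⟩, hm, rfl⟩

/-! #### The search is complete -/

/-- The set of the entries that hold in a state. -/
noncomputable def theory (T : TransitionSystem) (form : ℕ → CTL) (k : ℕ) (s : T.State) :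
    Fin (2 ^ k) := ⟨Cmd.setCode (fun i => T.Sat (form i) s) k, Cmd.setCode_lt _ _⟩

variable {T : TransitionSystem}

theorem mem_theory (hB : 2 ^ (k + k) ≤ B) {s : T.State} {i : ℕ} (hi : i < k) :
    Mem B (theory T form k s) i ↔ T.Sat (form i) s := by
  have := bounds hB
  exact (Cmd.mem_setCode (by omega) (by omega)).trans (and_iff_right hi)

theorem local_theory (hB : 2 ^ (k + k) ≤ B) (hD : Describes w k form) (s : T.State) :
    Local w B k (theory T form k s) := by
  intro i _ hi hm
  rw [mem_theory hB hi] at hm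
  have he := hD.entry i hi
  obtain ⟨-, h1, h2⟩ := hD.valid i hi
  refine ⟨fun ho => ?_, fun ho i' _ hi' hm' h => ?_, fun ho => ?_, fun ho => ?_, fun ho => ?_,
    fun ho => ?_⟩
  · rw [ho] at he
    generalize form i = χ at he hm
    cases he
    exact hm
  · rw [mem_theory hB hi'] at hm'
    have he' := hD.entry i' hi'
    rw [ho] at he
    rw [h.1, h.2] at he'
    generalize form i = χ at he hm
    generalize form i' = χ' at he' hm'
    cases he
    cases he'
    exact hm' hm
  · have ha := h1 (by omega)
    have hb := h2 (by omega)
    rw [mem_theory hB (by omega), mem_theory hB (by omega)]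
    rw [ho] at he
    generalize form i = χ at he hm
    cases he
    exact hm
  · have ha := h1 (by omega)
    have hb := h2 (by omega)
    rw [mem_theory hB (by omega), mem_theory hB (by omega)]
    rw [ho] at he
    generalize form i = χ at he hm
    cases he
    exact hm
  · have ha := h1 (by omega)
    have hb := h2 (by omega)
    rw [mem_theory hB (by omega), mem_theory hB (by omega)]
    generalize form i = χ at he hm
    rcases ho with ho | ho <;> rw [ho] at he <;> cases he <;>
      exact (TransitionSystem.sat_untl.1 hm).imp_right And.left
  · have hb := h2 (by omega)
    rw [mem_theory hB (by omega)]
    generalize form i = χ at he hm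
    rcases ho with ho | ho <;> rw [ho] at he <;> cases he <;>
      exact (TransitionSystem.sat_rel.1 hm).1

/-- Every formula has a successor that it needs. -/
theorem exists_witness (χ : CTL) (s : T.State) : ∃ s', T.rel s s' ∧
    (∀ φ, χ = next .E φ → T.Sat χ s → T.Sat φ s') ∧
    (∀ φ ψ, χ = untl .E φ ψ → T.Sat χ s → ¬ T.Sat ψ s →
      T.Sat χ s' ∧ T.distance φ ψ s' < T.distance φ ψ s) ∧
    (∀ φ ψ, χ = rel .E φ ψ → T.Sat χ s → ¬ T.Sat φ s → T.Sat χ s') := by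
  obtain ⟨s₀, h₀⟩ := T.total s
  by_cases hs : T.Sat χ s
  swap
  · exact ⟨s₀, h₀, fun _ _ h => absurd h hs, fun _ _ _ h => absurd h hs, fun _ _ _ h => absurd h hs⟩
  match χ, hs with
  | .next .E φ, hs =>
    obtain ⟨s', h1, h2⟩ := TransitionSystem.sat_next_E.1 hs
    exact ⟨s', h1, fun _ e _ => by injection e with _ e; exact e ▸ h2, nofun, nofun⟩
  | .untl .E φ ψ, hs =>
    by_cases hψ : T.Sat ψ s
    · exact ⟨s₀, h₀, nofun, fun _ _ e _ h => by injection e with _ _ e; exact absurd (e ▸ hψ) h,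
        nofun⟩
    · obtain ⟨s', h1, h2, h3⟩ := TransitionSystem.exists_distance_lt hs hψ
      exact ⟨s', h1, nofun, fun _ _ e _ _ => by
        injection e with _ e1 e2; subst e1 e2; exact ⟨h2, h3⟩, nofun⟩
  | .rel .E φ ψ, hs =>
    by_cases hφ : T.Sat φ s
    · exact ⟨s₀, h₀, nofun, nofun, fun _ _ e _ h => by
        injection e with _ e; exact absurd (e ▸ hφ) h⟩
    · obtain ⟨s', h1, h2⟩ := TransitionSystem.sat_next_E.1
        ((TransitionSystem.sat_rel.1 hs).2.resolve_left hφ)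
      exact ⟨s', h1, nofun, nofun, fun _ _ _ _ _ => h2⟩
  | .next .A _, _ | .untl .A _ _, _ | .rel .A _ _, _ | .tt, _ | .ff, _ | .pos _, _ | .neg _, _
  | .or _ _, _ | .and _ _, _ => exact ⟨s₀, h₀, nofun, nofun, nofun⟩

theorem exists_succ (hB : 2 ^ (k + k) ≤ B) (hD : Describes w k form) (s : T.State) (e : ℕ) :
    ∃ s', T.rel s s' ∧ Succ w B k (theory T form k s) e (theory T form k s') ∧
      ∀ φ ψ, form e = untl .E φ ψ → T.Sat (form e) s → ¬ T.Sat ψ s →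
        T.distance φ ψ s' < T.distance φ ψ s := by
  obtain ⟨s', hs, hX, hU, hR⟩ := exists_witness (T := T) (form e) s
  refine ⟨s', hs, fun i _ hi hm => ?_, fun φ ψ h1 h2 h3 => (hU φ ψ h1 h2 h3).2⟩
  rw [mem_theory hB hi] at hm
  have he := hD.entry i hi
  obtain ⟨-, h1, h2⟩ := hD.valid i hi
  refine ⟨fun ho => ?_, fun ho => ?_, fun ho => ?_⟩
  · have ha := h1 (by omega)
    rw [mem_theory hB (by omega)]
    rcases ho with ho | ⟨ho, rfl⟩
    · rw [ho] at he
      generalize form i = χ at he hm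
      cases he
      exact TransitionSystem.sat_next_A.1 hm s' hs
    · rw [ho] at he
      generalize form e = χ at he hm hX
      cases he
      exact hX _ rfl hm
  · have hb := h2 (by omega)
    rw [mem_theory hB (by omega), mem_theory hB hi]
    rcases ho with ho | ⟨ho, rfl⟩
    · rw [ho] at he
      generalize form i = χ at he hm ⊢
      cases he
      exact (TransitionSystem.sat_untl.1 hm).imp_right fun h =>
        TransitionSystem.sat_next_A.1 h.2 s' hs
    · rw [ho] at he
      generalize form e = χ at he hm hU ⊢
      cases he
      exact or_iff_not_imp_left.2 fun h => (hU _ _ rfl hm h).1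
  · have ha := h1 (by omega)
    rw [mem_theory hB (by omega), mem_theory hB hi]
    rcases ho with ho | ⟨ho, rfl⟩
    · rw [ho] at he
      generalize form i = χ at he hm ⊢
      cases he
      exact (TransitionSystem.sat_rel.1 hm).2.imp_right fun h =>
        TransitionSystem.sat_next_A.1 h s' hs
    · rw [ho] at he
      generalize form e = χ at he hm hR ⊢
      cases he
      exact or_iff_not_imp_left.2 fun h => hR _ _ rfl hm h

/-- It suffices that the pairs formed with theories of states are contained in their own inner
fixpoint. For an eventuality `j` that is true this follows by induction, on `Inevitable` for `A` and
on the distance for `E`. If `j` is false in the state or is no eventuality, there is nothing to wait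
for. -/
theorem theory_mem_outer (hB : 2 ^ (k + k) ≤ B) (hD : Describes w k form) (s : T.State)
    (j : Fin k) : (theory T form k s, j) ∈ NestedFix.outer (step w B k) B := by
  refine NestedFix.subset_outer (Z := {v | ∃ s, v.1 = theory T form k s}) step_mono ?_ ⟨s, rfl⟩
  rintro ⟨S, j⟩ ⟨s, rfl⟩
  set Z : Set (Pair k) := {v | ∃ s : T.State, v.1 = theory T form k s}
  set M := NestedFix.inner (step w B k) B Z
  have hM : step w B k Z M = M := NestedFix.inner_fix step_mono (card_pair_le hB) Z
  have key : ∀ s : T.State, (∀ e s', e < k → T.rel s s' →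
      Waits w B (theory T form k s) e j → (∀ φ ψ, form e = untl .E φ ψ → T.Sat (form e) s →
        ¬ T.Sat ψ s → T.distance φ ψ s' < T.distance φ ψ s) → (theory T form k s', j) ∈ M) →
      (theory T form k s, j) ∈ M := by
    intro s h
    rw [← hM]
    refine ⟨local_theory hB hD s, fun e he => ?_⟩
    obtain ⟨s', h1, h2, h3⟩ := exists_succ hB hD s e
    refine ⟨_, h2, ?_⟩
    by_cases hw : Waits w B (theory T form k s) e j
    · exact Or.inl ⟨hw, h e s' he h1 hw h3⟩
    · exact Or.inr ⟨hw, s', rfl⟩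
  have he := hD.entry j j.2
  obtain ⟨-, h1, h2⟩ := hD.valid j j.2
  have waits : ∀ {s : T.State} {e : ℕ}, Waits w B (theory T form k s) e j →
      T.Sat (form j) s ∧ ¬ T.Sat (form (snd w j)) s ∧ (op w j = 9 ∨ (op w j = 8 ∧ e = j)) := by
    rintro s e ⟨h3, h4, h5⟩
    have := h2 (by omega)
    rw [mem_theory hB j.2] at h3
    rw [mem_theory hB (by omega)] at h4
    exact ⟨h3, h4, h5⟩
  by_cases h9 : op w j = 9
  · by_cases hs : T.Sat (form j) s
    · have hform : form j = untl .A (form (fst w j)) (form (snd w j)) := by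
        rw [h9] at he
        generalize form j = χ at he
        cases he
        rfl
      have hin := TransitionSystem.inevitable_of_sat (hform ▸ hs)
      clear hs
      induction hin with
      | now h => exact key _ fun e s' _ _ hw _ => absurd h (waits hw).2.1
      | later _ ih => exact key _ fun e s' _ hr _ _ => ih s' hr
    · exact key _ fun e s' _ _ hw _ => absurd (waits hw).1 hs
  · by_cases h8 : op w j = 8
    · have hform : form j = untl .E (form (fst w j)) (form (snd w j)) := by
        rw [h8] at he
        generalize form j = χ at he
        cases he
        rfl
      induction hd : T.distance (form (fst w j)) (form (snd w j)) s using Nat.strong_induction_on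
        generalizing s with
      | _ d ih =>
        refine key s fun e s' _ _ hw hdist => ?_
        obtain ⟨h3, h4, h5⟩ := waits hw
        obtain rfl : e = j := by omega
        exact ih _ (hd ▸ hdist _ _ hform h3 h4) s' rfl
    · exact key _ fun e s' _ _ hw _ => by
        have := (waits hw).2.2
        omega

/-- An input with `k` entries has length `3k`, so `B = 2 ^ (3k)` exceeds `2 ^ (2k)`, the bound for
the codes of pairs. -/
theorem mem_SAT_iff (w : List ℕ) : w ∈ SAT ↔ Accepts w (2 ^ w.length) := by
  have hB : ∀ {k}, w.length = k + k + k → 2 ^ (k + k) ≤ 2 ^ w.length := fun h =>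
    Nat.pow_le_pow_right (by norm_num) (by omega)
  have hmem : ∀ {k S : ℕ} (hw : w.length = k + k + k) (hk : 0 < k) (hS : S < 2 ^ k),
      Mem (2 ^ w.length) (result w (2 ^ w.length) k) (code (2 ^ w.length) k S 0) ↔
        ((⟨S, hS⟩, ⟨0, hk⟩) : Pair k) ∈
          NestedFix.outer (step w (2 ^ w.length) k) (2 ^ w.length) := by
    intro k S hw hk hS
    rw [← codes_result (hB hw), ← code_eq (hB hw)]
  constructor
  · rintro ⟨φ, hφ, T, hT⟩
    obtain ⟨k, form, hw, hk, hD, rfl⟩ := describes_of_decode hφ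
    have hb := bounds (hB hw)
    refine ⟨k, by omega, hw, hk, fun i _ hi => hD.valid i hi, theory T form k T.init,
      (theory T form k T.init).2.trans_le hb.2, ?_, ?_, ?_⟩
    · rw [min_eq_left (by omega)]
      exact (theory T form k T.init).2
    · rwa [mem_theory (hB hw) (by omega)]
    · rw [hmem hw hk (theory T form k T.init).2]
      exact theory_mem_outer (hB hw) hD T.init _
  · rintro ⟨k, hkB, hw, hk, hv, S, -, hS, h1, h2⟩
    obtain ⟨φ, hφ⟩ := exists_decode hw hk fun i hi => hv i (by omega) hi
    refine ⟨φ, hφ, ?_⟩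
    obtain ⟨k', form, hw', -, hD, rfl⟩ := describes_of_decode hφ
    obtain rfl : k = k' := by omega
    rw [min_eq_left (by omega)] at hS
    rw [hmem hw hk hS] at h2
    exact satisfiable_of_mem_outer (hB hw) hD h2 (by omega) h1

end Search

theorem SAT_inEXPTIME : InEXPTIME SAT :=
  Search.decidable_accepts.inEXPTIME Search.mem_SAT_iff

end CTL

theorem mainTheorem11 :
    -- satisfiability of CTL formulas is in EXPTIME
    InEXPTIME CTL.SAT ∧
    -- the reduction to Büchi games with `2 ^ O(|ϑ|)` positions and edges
    (∃ c : ℕ, ∀ ϑ : CTL, ∃ B : DBA (CTL.Rule ϑ),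
      CTL.RecognisesWinningPlays ϑ B ∧
      Nat.card (CTL.Config ϑ × B.State) ≤ 2 ^ (c * ϑ.size) ∧
      Set.ncard {e : (CTL.Config ϑ × B.State) × (CTL.Config ϑ × B.State) |
        (CTL.satGame ϑ B).edge e.1 e.2} ≤ 2 ^ (c * ϑ.size) ∧
      (ϑ.Satisfiable ↔ (CTL.satGame ϑ B).Player0Wins)) ∧
    -- Büchi games with `n` positions and `m` edges are solvable in time `O(n * m)`
    (∃ (P : List Instr) (K : ℕ), ∀ (n : ℕ) (G : BuchiGame (Fin n))
      (edges : List (Fin n × Fin n)), edges.Nodup → (∀ u v, (u, v) ∈ edges ↔ G.edge u v) →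
      DecidesWithin P (G.code edges) (K * (n * edges.length)) G.Player0Wins) :=
  ⟨CTL.SAT_inEXPTIME,
    ⟨16, fun ϑ => ⟨CTL.automaton ϑ, CTL.recognises ϑ,
      (CTL.card_positions_le ϑ).trans (Nat.pow_le_pow_right (by norm_num) (by omega)),
      CTL.ncard_edges_le ϑ, CTL.satisfiable_iff_player0Wins ϑ⟩⟩,
    ⟨BuchiSolver.solver.program 0, 2000, fun _ _ _ _ hedges => BuchiSolver.solver_spec hedges⟩⟩
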